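/- **Conventions.** All manifolds are smooth, finite-dimensional, Hausdorff and second countable; vector bundles are smooth, real and of constant finite rank. For an open set $U\subseteq M$ and a vector bundle $V\to M$, $\Gamma_U(V)$ is the $C^\infty(U)$-module of smooth sections over $U$. A *double vector bundle* $(\mathbb E;Q,B;M)$ is a manifold $\mathbb E$ with two vector bundle structures $\pi_Q\colon\mathbb E\to Q$ and $\pi_B\colon\mathbb E\to B$ over the total spaces of vector bundles $q_Q\colon Q\to M$, $q_B\colon B\to M$, such that $q_Q\circ\pi_Q=q_B\circ\pi_B$ and such that the projection, the addition $+_B$ and the scalar multiplication of $\mathbb E\to B$ are vector bundle morphisms, with respect to $\mathbb E\to Q$, over the projection, addition and scalar multiplication of $Q\to M$. Its core is $C=\ker\pi_Q\cap\ker\pi_B$. It is a *metric* double vector bundle if $\mathbb E\to B$ carries a smooth symmetric non-degenerate fibrewise bilinear pairing $\langle\cdot,\cdot\rangle$ that is linear over $Q$: $\langle e_1+_Qe_2,f_1+_Qf_2\rangle=\langle e_1,f_1\rangle+\langle e_2,f_2\rangle$ and $\langle r\cdot_Q e,r\cdot_Q f\rangle=r\langle e,f\rangle$ whenever these expressions are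 defined. The core is then identified with $Q^*$: $\tau\in Q_m^*$ corresponds to the core element $\overline\tau$ with $\langle e,0_{\pi_B(e)}+_Q\overline\tau\rangle=\tau(\pi_Q(e))$ for all $e\in\mathbb E$ over $m$. A *linear section* of $\mathbb E\to Q$ over $U$ is a smooth section $\chi\colon Q|_U\to\mathbb E$ that is a vector bundle morphism from $Q|_U\to U$ to $\mathbb E\to B$ over some section $b\in\Gamma_U(B)$, its base section. It is *isotropic* if $\langle\chi(q),\chi(q')\rangle=0$ for all $q,q'\in Q_m$, $m\in U$. Let $\mathcal C(\mathbb E)(U)$ be the set of isotropic linear sections over $U$, a $C^\infty(U)$-module via $f\cdot\chi:=(q_Q^*f)\chi$. For $\omega\in\Omega^2(Q)(U):=\Gamma_U(Q^*\wedge Q^*)$ define $\widetilde\omega\colon Q|_U\to\mathbb E$ by $\widetilde\omega(q)=0_q+_B\overline{\omega(q,\cdot)}$. A *linear splitting* is a smooth map $\Sigma\colon Q\times_MB\to\mathbb E$ with $\pi_Q\Sigma(q,b)=q$, $\pi_B\Sigma(q,b)=b$ that is linear in $b$ for the structure over $Q$ and linear in $q$ for the structure over $B$; it is *Lagrangian*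 if $\langle\Sigma(q,b),\Sigma(q',b)\rangle=0$ for all $q,q'\in Q_m$, $b\in B_m$, $m\in M$. **Theorem.** Let $(\mathbb E;Q,B;M)$ be a metric double vector bundle. Then: 1. $U\mapsto\mathcal C(\mathbb E)(U)$, with restriction of sections, is a sheaf of $C^\infty$-modules on $M$, and it is locally free of finite rank: every $p\in M$ has an open neighbourhood $U$ with finitely many $\chi_1,\dots,\chi_n\in\mathcal C(\mathbb E)(U)$ whose restrictions to each open $W\subseteq U$ form a basis of the $C^\infty(W)$-module $\mathcal C(\mathbb E)(W)$. 2. The maps $\omega\mapsto\widetilde\omega$ and $\chi\mapsto b$ (base section) are morphisms of sheaves of $C^\infty$-modules, and $$0\longrightarrow\Omega^2(Q)\longrightarrow\mathcal C(\mathbb E)\longrightarrow\Gamma(B)\longrightarrow0$$ is a short exact sequence of sheaves of $C^\infty$-modules; it is exact over every open $U\subseteq M$. 3. Lagrangian splittings $\Sigma$ of $\mathbb E$ are in bijection with the splittings $\sigma\colon\Gamma(B)\to\mathcal C(\mathbb E)$ of this sequence (morphisms of sheaves of $C^\infty$-modules that are right inverse to $\mathcal C(\mathbb E)\to\Gamma(B)$),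 via $\sigma(b)(q)=\Sigma(q,b(m))$ for $b\in\Gamma_U(B)$, $q\in Q_m$, $m\in U$. 4. There are a vector bundle $\widehat B\to M$ and an isomorphism $\Gamma(\widehat B)\cong\mathcal C(\mathbb E)$ of sheaves of $C^\infty$-modules, and a short exact sequence of smooth vector bundles over $M$ $$0\longrightarrow Q^*\wedge Q^*\longrightarrow\widehat B\longrightarrow B\longrightarrow0$$ that under this isomorphism induces the sequence in 2 on sections. -/

import Mathlib

set_option linter.unusedSectionVars false

open Bundle Manifold ContDiff TopologicalSpace

noncomputable section

/-! ### Smooth sections of a vector bundle over the open subsets of the base -/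

section Sections

variable {EX : Type*} [NormedAddCommGroup EX] [NormedSpace ℝ EX]
  {HX : Type*} [TopologicalSpace HX] (IX : ModelWithCorners ℝ EX HX)
  {X : Type*} [TopologicalSpace X] [ChartedSpace HX X]

/-- The ring `C^∞(U)` of smooth real functions on the open set `U`. -/
abbrev SmoothFun (U : Opens X) : Type _ := C^∞⟮IX, U; 𝓘(ℝ, ℝ), ℝ⟯

/-- Restriction of smooth functions to a smaller open set. -/
abbrev SmoothFun.res {U V : Opens X} (h : V ≤ U) : SmoothFun IX U →+* SmoothFun IX V :=
  ContMDiffMap.restrictRingHom IX 𝓘(ℝ, ℝ) ℝ h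

variable (F : Type*) [NormedAddCommGroup F] [NormedSpace ℝ F]
  (V : X → Type*) [∀ x, AddCommGroup (V x)] [∀ x, Module ℝ (V x)]

/-- Set-theoretic sections over `U` form a `C^∞(U)`-module under pointwise operations. -/
instance sectionsPiModule (U : Opens X) : Module (SmoothFun IX U) (∀ x : U, V x) :=
  Module.compHom (∀ x : U, V x)
    (ContMDiffMap.coeFnRingHom : SmoothFun IX U →+* (U → ℝ))

@[simp] theorem sectionsPi_smul_apply (U : Opens X) (f : SmoothFun IX U) (s : ∀ x : U, V x)
    (x : U) : (f • s) x = f x • s x := rfl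

variable [TopologicalSpace (TotalSpace F V)] [∀ x, TopologicalSpace (V x)]
  [FiberBundle F V] [VectorBundle ℝ F V]

section Smoothness

variable {IX F V} {EN : Type*} [NormedAddCommGroup EN] [NormedSpace ℝ EN]
  {HN : Type*} [TopologicalSpace HN] {IN : ModelWithCorners ℝ EN HN}
  {N : Type*} [TopologicalSpace N] [ChartedSpace HN N] {p : N → X}

theorem contMDiff_add_along {s t : ∀ y, V (p y)}
    (hs : ContMDiff IN (IX.prod 𝓘(ℝ, F)) ∞ (fun y => (⟨p y, s y⟩ : TotalSpace F V)))
    (ht : ContMDiff IN (IX.prod 𝓘(ℝ, F)) ∞ (fun y => (⟨p y, t y⟩ : TotalSpace F V))) :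
    ContMDiff IN (IX.prod 𝓘(ℝ, F)) ∞ (fun y => (⟨p y, s y + t y⟩ : TotalSpace F V)) := by
  intro y₀
  have h1 := contMDiffAt_totalSpace.1 (hs y₀)
  have h2 := contMDiffAt_totalSpace.1 (ht y₀)
  refine contMDiffAt_totalSpace.2 ⟨h1.1, (h1.2.add h2.2).congr_of_eventuallyEq ?_⟩
  set e := trivializationAt F V (p y₀)
  have hc : ContinuousAt p y₀ := h1.1.continuousAt
  filter_upwards [hc.preimage_mem_nhds
    (e.open_baseSet.mem_nhds (mem_baseSet_trivializationAt F V (p y₀)))] with y hy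
  exact (e.linear ℝ hy).map_add _ _

theorem contMDiff_smul_along {f : N → ℝ} {s : ∀ y, V (p y)}
    (hf : ContMDiff IN 𝓘(ℝ, ℝ) ∞ f)
    (hs : ContMDiff IN (IX.prod 𝓘(ℝ, F)) ∞ (fun y => (⟨p y, s y⟩ : TotalSpace F V))) :
    ContMDiff IN (IX.prod 𝓘(ℝ, F)) ∞ (fun y => (⟨p y, f y • s y⟩ : TotalSpace F V)) := by
  intro y₀
  have h1 := contMDiffAt_totalSpace.1 (hs y₀)
  refine contMDiffAt_totalSpace.2 ⟨h1.1, ((hf y₀).smul h1.2).congr_of_eventuallyEq ?_⟩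
  set e := trivializationAt F V (p y₀)
  have hc : ContinuousAt p y₀ := h1.1.continuousAt
  filter_upwards [hc.preimage_mem_nhds
    (e.open_baseSet.mem_nhds (mem_baseSet_trivializationAt F V (p y₀)))] with y hy
  exact (e.linear ℝ hy).map_smul _ _

theorem contMDiff_zero_along (hp : ContMDiff IN IX ∞ p) :
    ContMDiff IN (IX.prod 𝓘(ℝ, F)) ∞ (fun y => (⟨p y, 0⟩ : TotalSpace F V)) := by
  intro y₀
  refine contMDiffAt_totalSpace.2 ⟨hp y₀,
    (contMDiffAt_const (c := (0 : F))).congr_of_eventuallyEq ?_⟩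
  set e := trivializationAt F V (p y₀)
  filter_upwards [(hp y₀).continuousAt.preimage_mem_nhds
    (e.open_baseSet.mem_nhds (mem_baseSet_trivializationAt F V (p y₀)))] with y hy
  exact (e.linear ℝ hy).map_zero

end Smoothness

/-- `Γ_U(V)`: the `C^∞(U)`-module of smooth sections over `U` of the vector bundle `V → X`. -/
def smoothSections (U : Opens X) : Submodule (SmoothFun IX U) (∀ x : U, V x) where
  carrier := {s | ContMDiff IX (IX.prod 𝓘(ℝ, F)) ∞ (fun x : U => (⟨x, s x⟩ : TotalSpace F V))}
  add_mem' hs ht := contMDiff_add_along hs ht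
  zero_mem' := contMDiff_zero_along contMDiff_subtype_val
  smul_mem' f _ hs := contMDiff_smul_along f.contMDiff hs

variable {V}

/-- Restriction of smooth sections to a smaller open set. -/
def smoothSections.res {U W : Opens X} (h : W ≤ U) :
    smoothSections IX F V U →ₛₗ[SmoothFun.res IX h] smoothSections IX F V W where
  toFun s := ⟨fun x => s.1 (Set.inclusion h x), s.2.comp (contMDiff_inclusion h)⟩
  map_add' _ _ := rfl
  map_smul' _ _ := rfl

end Sections

/-! ### Fibrewise operations on the total space of a vector bundle -/

section TotalSpaceOps

variable {X F : Type*} {V : X → Type*} [∀ x, AddCommGroup (V x)]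

open Classical in
/-- Fibrewise addition on the total space. It is only meaningful (and only used) for two points
in the same fibre. -/
def Bundle.TotalSpace.fadd (p q : TotalSpace F V) : TotalSpace F V :=
  if h : p.proj = q.proj then ⟨q.proj, (h ▸ p.2) + q.2⟩ else p

@[simp] theorem Bundle.TotalSpace.fadd_mk (x : X) (v w : V x) :
    (⟨x, v⟩ : TotalSpace F V).fadd ⟨x, w⟩ = ⟨x, v + w⟩ := by
  simp [Bundle.TotalSpace.fadd]

variable [∀ x, Module ℝ (V x)]

/-- Fibrewise scalar multiplication on the total space. -/
def Bundle.TotalSpace.fsmul (r : ℝ) (p : TotalSpace F V) : TotalSpace F V := ⟨p.proj, r • p.2⟩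

@[simp] theorem Bundle.TotalSpace.fsmul_mk (r : ℝ) (x : X) (v : V x) :
    (⟨x, v⟩ : TotalSpace F V).fsmul r = ⟨x, r • v⟩ := rfl

/-- The part of the total space of a vector bundle that lies over the open set `U`. -/
def opensOver [TopologicalSpace X] [TopologicalSpace F] (V : X → Type*)
    [TopologicalSpace (TotalSpace F V)]
    [∀ x, TopologicalSpace (V x)] [FiberBundle F V] (U : Opens X) : Opens (TotalSpace F V) :=
  ⟨TotalSpace.proj ⁻¹' U, U.isOpen.preimage (FiberBundle.continuous_proj F V)⟩

end TotalSpaceOps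

/-! ### Double vector bundles and metric double vector bundles -/

section DVB

variable (E : Type*) [NormedAddCommGroup E] [NormedSpace ℝ E]
  {M : Type*} [TopologicalSpace M] [ChartedSpace E M]
  (FQ : Type*) [NormedAddCommGroup FQ] [NormedSpace ℝ FQ]
  (Q : M → Type*) [∀ m, AddCommGroup (Q m)] [∀ m, Module ℝ (Q m)]
  [TopologicalSpace (TotalSpace FQ Q)] [∀ m, TopologicalSpace (Q m)]
  [FiberBundle FQ Q] [VectorBundle ℝ FQ Q]
  (FB : Type*) [NormedAddCommGroup FB] [NormedSpace ℝ FB]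
  (B : M → Type*) [∀ m, AddCommGroup (B m)] [∀ m, Module ℝ (B m)]
  [TopologicalSpace (TotalSpace FB B)] [∀ m, TopologicalSpace (B m)]
  [FiberBundle FB B] [VectorBundle ℝ FB B]
  (FDQ : Type*) [NormedAddCommGroup FDQ] [NormedSpace ℝ FDQ]
  (DQ : TotalSpace FQ Q → Type*) [∀ q, AddCommGroup (DQ q)] [∀ q, Module ℝ (DQ q)]
  [TopologicalSpace (TotalSpace FDQ DQ)] [∀ q, TopologicalSpace (DQ q)]
  [FiberBundle FDQ DQ] [VectorBundle ℝ FDQ DQ]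
  (FDB : Type*) [NormedAddCommGroup FDB] [NormedSpace ℝ FDB]
  (DB : TotalSpace FB B → Type*) [∀ b, AddCommGroup (DB b)] [∀ b, Module ℝ (DB b)]
  [TopologicalSpace (TotalSpace FDB DB)] [∀ b, TopologicalSpace (DB b)]
  [FiberBundle FDB DB] [VectorBundle ℝ FDB DB]

/-- Two vector bundle structures on one smooth manifold `D`: the vector bundle `DQ` over the total
space of `Q → M`, the vector bundle `DB` over the total space of `B → M`, and a diffeomorphism
between their total spaces, by which both are identified with `D`. We write points of `D` as
points of the total space of `DQ`. -/
structure DoubleBundleSquare where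
  /-- the identification of the two total spaces -/
  swap : Diffeomorph ((𝓘(ℝ, E).prod 𝓘(ℝ, FQ)).prod 𝓘(ℝ, FDQ))
    ((𝓘(ℝ, E).prod 𝓘(ℝ, FB)).prod 𝓘(ℝ, FDB)) (TotalSpace FDQ DQ) (TotalSpace FDB DB) ∞

namespace DoubleBundleSquare

variable {E FQ Q FB B FDQ DQ FDB DB} (S : DoubleBundleSquare E FQ Q FB B FDQ DQ FDB DB)

/-- The projection `D → Q`. -/
def projQ (_ : DoubleBundleSquare E FQ Q FB B FDQ DQ FDB DB) (d : TotalSpace FDQ DQ) :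
    TotalSpace FQ Q := d.proj

/-- The projection `D → B`. -/
def projB (d : TotalSpace FDQ DQ) : TotalSpace FB B := (S.swap d).proj

/-- The addition of the vector bundle `D → Q`. -/
def addQ (_ : DoubleBundleSquare E FQ Q FB B FDQ DQ FDB DB) (d d' : TotalSpace FDQ DQ) :
    TotalSpace FDQ DQ := d.fadd d'

/-- The scalar multiplication of the vector bundle `D → Q`. -/
def smulQ (_ : DoubleBundleSquare E FQ Q FB B FDQ DQ FDB DB) (r : ℝ) (d : TotalSpace FDQ DQ) :
    TotalSpace FDQ DQ := d.fsmul r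

/-- The zero section of the vector bundle `D → Q`. -/
def zeroQ (_ : DoubleBundleSquare E FQ Q FB B FDQ DQ FDB DB) (q : TotalSpace FQ Q) :
    TotalSpace FDQ DQ := ⟨q, 0⟩

/-- The addition of the vector bundle `D → B`. -/
def addB (d d' : TotalSpace FDQ DQ) : TotalSpace FDQ DQ := S.swap.symm ((S.swap d).fadd (S.swap d'))

/-- The scalar multiplication of the vector bundle `D → B`. -/
def smulB (r : ℝ) (d : TotalSpace FDQ DQ) : TotalSpace FDQ DQ := S.swap.symm ((S.swap d).fsmul r)

/-- The zero section of the vector bundle `D → B`. -/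
def zeroB (b : TotalSpace FB B) : TotalSpace FDQ DQ := S.swap.symm ⟨b, 0⟩

open Classical in
/-- The value of a family `g` of bilinear forms on the fibres of `D → B` on two points of `D`. It is
only meaningful (and only used) for two points over the same point of `B`. -/
def pairing (g : ∀ b : TotalSpace FB B, DB b →L[ℝ] DB b →L[ℝ] ℝ) (d d' : TotalSpace FDQ DQ) : ℝ :=
  if h : S.projB d = S.projB d' then g (S.projB d') (h ▸ (S.swap d).2) (S.swap d').2 else 0

/-- The conditions that make the square a double vector bundle `(D; Q, B; M)`: the square of
projections commutes, and the projection, the addition and the scalar multiplication of `D → B` are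
morphisms of vector bundles, from and to bundles given by `D → Q`, over the projection, the addition
and the scalar multiplication of `Q → M`. (They are smooth because `swap` is a diffeomorphism.) -/
structure IsDoubleVectorBundle : Prop where
  proj_comm : ∀ d, (S.projQ d).proj = (S.projB d).proj
  projB_addQ : ∀ d d', S.projQ d = S.projQ d' →
    S.projB (S.addQ d d') = (S.projB d).fadd (S.projB d')
  projB_smulQ : ∀ (r : ℝ) d, S.projB (S.smulQ r d) = (S.projB d).fsmul r
  projQ_addB : ∀ d d', S.projB d = S.projB d' →
    S.projQ (S.addB d d') = (S.projQ d).fadd (S.projQ d')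
  addB_addQ : ∀ d₁ d₂ d₃ d₄, S.projQ d₁ = S.projQ d₂ → S.projQ d₃ = S.projQ d₄ →
    S.projB d₁ = S.projB d₃ → S.projB d₂ = S.projB d₄ →
    S.addB (S.addQ d₁ d₂) (S.addQ d₃ d₄) = S.addQ (S.addB d₁ d₃) (S.addB d₂ d₄)
  addB_smulQ : ∀ (r : ℝ) d d', S.projB d = S.projB d' →
    S.addB (S.smulQ r d) (S.smulQ r d') = S.smulQ r (S.addB d d')
  projQ_smulB : ∀ (r : ℝ) d, S.projQ (S.smulB r d) = (S.projQ d).fsmul r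
  smulB_addQ : ∀ (r : ℝ) d d', S.projQ d = S.projQ d' →
    S.smulB r (S.addQ d d') = S.addQ (S.smulB r d) (S.smulB r d')
  smulB_smulQ : ∀ (r s : ℝ) d, S.smulB r (S.smulQ s d) = S.smulQ s (S.smulB r d)

end DoubleBundleSquare

/-- A metric double vector bundle `(D; Q, B; M)`: a double vector bundle with a smooth symmetric
non-degenerate pairing on the fibres of `D → B` that is linear over `Q`, i.e. the map from `D` to
the dual of `D → B` that it defines is linear for the vector bundle structures over `Q` and over the
dual of the core. -/
structure MetricDoubleVectorBundle extends DoubleBundleSquare E FQ Q FB B FDQ DQ FDB DB where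
  isDoubleVectorBundle : toDoubleBundleSquare.IsDoubleVectorBundle
  /-- the pairing on the fibres of `D → B` -/
  metric : ∀ b : TotalSpace FB B, DB b →L[ℝ] DB b →L[ℝ] ℝ
  metric_smooth : ContMDiff (𝓘(ℝ, E).prod 𝓘(ℝ, FB))
    ((𝓘(ℝ, E).prod 𝓘(ℝ, FB)).prod 𝓘(ℝ, FDB →L[ℝ] FDB →L[ℝ] ℝ)) ∞
    (fun b => TotalSpace.mk' (FDB →L[ℝ] FDB →L[ℝ] ℝ) b (metric b))
  metric_symm : ∀ b x y, metric b x y = metric b y x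
  metric_nondegenerate : ∀ b x, (∀ y, metric b x y = 0) → x = 0
  metric_addQ : ∀ d₁ d₂ e₁ e₂,
    toDoubleBundleSquare.projQ d₁ = toDoubleBundleSquare.projQ d₂ →
    toDoubleBundleSquare.projQ e₁ = toDoubleBundleSquare.projQ e₂ →
    toDoubleBundleSquare.projB d₁ = toDoubleBundleSquare.projB e₁ →
    toDoubleBundleSquare.projB d₂ = toDoubleBundleSquare.projB e₂ →
    toDoubleBundleSquare.pairing metric
        (toDoubleBundleSquare.addQ d₁ d₂) (toDoubleBundleSquare.addQ e₁ e₂) =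
      toDoubleBundleSquare.pairing metric d₁ e₁ + toDoubleBundleSquare.pairing metric d₂ e₂
  metric_smulQ : ∀ (r : ℝ) d e, toDoubleBundleSquare.projB d = toDoubleBundleSquare.projB e →
    toDoubleBundleSquare.pairing metric
        (toDoubleBundleSquare.smulQ r d) (toDoubleBundleSquare.smulQ r e) =
      r * toDoubleBundleSquare.pairing metric d e

variable {E FQ Q FB B FDQ DQ FDB DB}

theorem contMDiff_restrictProj (U : Opens M) :
    ContMDiff (𝓘(ℝ, E).prod 𝓘(ℝ, FQ)) 𝓘(ℝ, E) ∞
      (fun q : opensOver (F := FQ) Q U => (⟨q.1.proj, q.2⟩ : U)) := by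
  rw [← ContMDiff.subtypeVal_comp_iff]
  exact (contMDiff_proj Q).comp contMDiff_subtype_val

/-- Set-theoretic sections of `D → Q` over `Q|_U` form a `C^∞(U)`-module: a function on `U` acts by
pointwise multiplication with its pullback to `Q|_U`. -/
instance sectionsOverModule (U : Opens M) :
    Module (SmoothFun 𝓘(ℝ, E) U) (∀ q : opensOver (F := FQ) Q U, DQ q) :=
  Module.compHom (∀ q : opensOver (F := FQ) Q U, DQ q)
    ((RingHom.pi fun q : opensOver (F := FQ) Q U => Pi.evalRingHom (fun _ : U => ℝ) ⟨q.1.proj, q.2⟩).comp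
      (ContMDiffMap.coeFnRingHom : SmoothFun 𝓘(ℝ, E) U →+* (U → ℝ)))

@[simp] theorem sectionsOver_smul_apply (U : Opens M) (f : SmoothFun 𝓘(ℝ, E) U)
    (χ : ∀ q : opensOver (F := FQ) Q U, DQ q) (q : opensOver (F := FQ) Q U) :
    (f • χ) q = f ⟨q.1.proj, q.2⟩ • χ q := rfl

/-- The value in `D` of a section `χ` of `D → Q` over `Q|_U` at the point `q ∈ Q_m`. -/
def sectionValue {U : Opens M} (χ : ∀ q : opensOver (F := FQ) Q U, DQ q) (m : U) (q : Q m) :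
    TotalSpace FDQ DQ := ⟨⟨m, q⟩, χ ⟨⟨m, q⟩, m.2⟩⟩

/-- `χ : Q|_U → D` is a (fibrewise linear) bundle morphism from `Q|_U → U` to `D → B` over the
section `b` of `B` over `U`. -/
structure DoubleBundleSquare.IsLinearOver (S : DoubleBundleSquare E FQ Q FB B FDQ DQ FDB DB)
    {U : Opens M} (χ : ∀ q : opensOver (F := FQ) Q U, DQ q) (b : ∀ m : U, B m) : Prop where
  projB : ∀ (m : U) (q : Q m), S.projB (sectionValue (FDQ := FDQ) χ m q) = ⟨m, b m⟩
  map_add : ∀ (m : U) (q q' : Q m), sectionValue (FDQ := FDQ) χ m (q + q') =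
    S.addB (sectionValue χ m q) (sectionValue χ m q')
  map_smul : ∀ (m : U) (r : ℝ) (q : Q m), sectionValue (FDQ := FDQ) χ m (r • q) =
    S.smulB r (sectionValue χ m q)

namespace MetricDoubleVectorBundle

variable (𝔼 : MetricDoubleVectorBundle E FQ Q FB B FDQ DQ FDB DB)

theorem sectionValue_add {U : Opens M} (χ χ' : ∀ q : opensOver (F := FQ) Q U, DQ q)
    (m : U) (q : Q m) : sectionValue (FDQ := FDQ) (χ + χ') m q =
      𝔼.addQ (sectionValue χ m q) (sectionValue χ' m q) := by
  simp [sectionValue, DoubleBundleSquare.addQ]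

theorem sectionValue_smul {U : Opens M} (f : SmoothFun 𝓘(ℝ, E) U)
    (χ : ∀ q : opensOver (F := FQ) Q U, DQ q) (m : U) (q : Q m) :
    sectionValue (FDQ := FDQ) (f • χ) m q = 𝔼.smulQ (f m) (sectionValue χ m q) := by
  simp [sectionValue, DoubleBundleSquare.smulQ]

theorem isLinearOver_add {U : Opens M} {χ χ' : ∀ q : opensOver (F := FQ) Q U, DQ q}
    {b b' : ∀ m : U, B m} (hl : 𝔼.IsLinearOver χ b) (hl' : 𝔼.IsLinearOver χ' b') :
    𝔼.IsLinearOver (χ + χ') (b + b') := by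
  have H := 𝔼.isDoubleVectorBundle
  have key := 𝔼.sectionValue_add χ χ'
  refine ⟨?_, ?_, ?_⟩
  · intro m q
    rw [key, H.projB_addQ (sectionValue χ m q) (sectionValue χ' m q) rfl, hl.projB, hl'.projB]
    simp
  · intro m q q'
    rw [key, key, key, H.addB_addQ (sectionValue χ m q) (sectionValue χ' m q)
      (sectionValue χ m q') (sectionValue χ' m q') rfl rfl, hl.map_add, hl'.map_add]
    · rw [hl.projB, hl.projB]
    · rw [hl'.projB, hl'.projB]
  · intro m r q
    rw [key, key, H.smulB_addQ r (sectionValue χ m q) (sectionValue χ' m q) rfl, hl.map_smul, hl'.map_smul]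

theorem isLinearOver_smul {U : Opens M} (f : SmoothFun 𝓘(ℝ, E) U)
    {χ : ∀ q : opensOver (F := FQ) Q U, DQ q}
    {b : ∀ m : U, B m} (hl : 𝔼.IsLinearOver χ b) : 𝔼.IsLinearOver (f • χ) (f • b) := by
  have H := 𝔼.isDoubleVectorBundle
  have key := 𝔼.sectionValue_smul f χ
  refine ⟨?_, ?_, ?_⟩
  · intro m q
    rw [key, H.projB_smulQ, hl.projB]
    simp
  · intro m q q'
    rw [key, key, key, H.addB_smulQ, hl.map_add]
    rw [hl.projB, hl.projB]
  · intro m r q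
    rw [key, key, H.smulB_smulQ, hl.map_smul]

theorem base_unique {U : Opens M} {χ : ∀ q : opensOver (F := FQ) Q U, DQ q}
    {b b' : ∀ m : U, B m} (hl : 𝔼.IsLinearOver χ b) (hl' : 𝔼.IsLinearOver χ b') : b = b' := by
  funext m
  have h := (hl.projB m 0).symm.trans (hl'.projB m 0)
  simpa using h

/-- `Γ^ℓ_Q(𝔼)` over `U`: the smooth sections of `D → Q` over `Q|_U` that are linear over some smooth
section of `B` over `U`. -/
def linearSections (U : Opens M) :
    Submodule (SmoothFun 𝓘(ℝ, E) U) (∀ q : opensOver (F := FQ) Q U, DQ q) where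
  carrier := {χ | χ ∈ smoothSections (𝓘(ℝ, E).prod 𝓘(ℝ, FQ)) FDQ DQ (opensOver Q U) ∧
    ∃ b ∈ smoothSections 𝓘(ℝ, E) FB B U, 𝔼.toDoubleBundleSquare.IsLinearOver χ b}
  add_mem' := by
    rintro χ χ' ⟨hχ, b, hb, hl⟩ ⟨hχ', b', hb', hl'⟩
    exact ⟨add_mem hχ hχ', b + b', add_mem hb hb', 𝔼.isLinearOver_add hl hl'⟩
  zero_mem' := by
    have H := 𝔼.isDoubleVectorBundle
    have z : ∀ d : TotalSpace FDQ DQ, 𝔼.smulQ 0 d = ⟨d.proj, 0⟩ := by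
      intro d; simp [DoubleBundleSquare.smulQ, Bundle.TotalSpace.fsmul]
    have key : ∀ (m : U) (q : Q m),
        sectionValue (FDQ := FDQ) (0 : ∀ q : opensOver (F := FQ) Q U, DQ q) m q =
        𝔼.smulQ 0 ⟨⟨m, q⟩, 0⟩ := by
      intro m q
      rw [z]; rfl
    have kB : ∀ (m : U) (q : Q m), 𝔼.projB (𝔼.smulQ 0 ⟨⟨m, q⟩, 0⟩) = ⟨m, 0⟩ := by
      intro m q
      have h1 := H.proj_comm ⟨⟨m, q⟩, 0⟩
      change (m : M) = _ at h1
      rw [H.projB_smulQ]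
      revert h1
      generalize 𝔼.projB ⟨⟨m, q⟩, 0⟩ = b
      obtain ⟨n, b⟩ := b
      rintro rfl
      simp
    refine ⟨zero_mem _, 0, zero_mem _, ⟨?_, ?_, ?_⟩⟩
    · intro m q
      rw [key, kB]; rfl
    · intro m q q'
      have hp : 𝔼.projB (⟨⟨m, q⟩, 0⟩ : TotalSpace FDQ DQ) = 𝔼.projB ⟨⟨m, q'⟩, 0⟩ := by
        have h1 := kB m q
        have h2 := kB m q'
        rw [z] at h1 h2
        exact h1.trans h2.symm
      rw [key, key, key, H.addB_smulQ _ _ _ hp, z, z]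
      change _ = (⟨𝔼.projQ _, 0⟩ : TotalSpace FDQ DQ)
      rw [H.projQ_addB _ _ hp]
      change _ = (⟨(⟨m, q⟩ : TotalSpace FQ Q).fadd ⟨m, q'⟩, 0⟩ : TotalSpace FDQ DQ)
      rw [Bundle.TotalSpace.fadd_mk]
    · intro m r q
      rw [key, key, H.smulB_smulQ, z, z]
      change _ = (⟨𝔼.projQ _, 0⟩ : TotalSpace FDQ DQ)
      rw [H.projQ_smulB]
      rfl
  smul_mem' := by
    rintro f χ ⟨hχ, b, hb, hl⟩
    exact ⟨contMDiff_smul_along (f := fun q : opensOver (F := FQ) Q U => f ⟨q.1.proj, q.2⟩)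
      (f.contMDiff.comp (contMDiff_restrictProj U)) hχ,
      f • b, Submodule.smul_mem _ f hb, 𝔼.isLinearOver_smul f hl⟩

/-- `𝒞(𝔼)` over `U`: the linear sections `χ` of `D → Q` over `Q|_U` with isotropic image, i.e.
`⟨χ(q), χ(q')⟩ = 0` for all `q, q'` in the same fibre of `Q`. -/
def isotropicSections (U : Opens M) :
    Submodule (SmoothFun 𝓘(ℝ, E) U) (∀ q : opensOver (F := FQ) Q U, DQ q) where
  carrier := {χ | χ ∈ 𝔼.linearSections U ∧ ∀ (m : U) (q q' : Q m),
    𝔼.pairing 𝔼.metric (sectionValue χ m q) (sectionValue χ m q') = 0}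
  add_mem' := by
    rintro χ χ' ⟨hχ, h⟩ ⟨hχ', h'⟩
    refine ⟨add_mem hχ hχ', fun m q q' => ?_⟩
    obtain ⟨-, b, -, hl⟩ := hχ
    obtain ⟨-, b', -, hl'⟩ := hχ'
    have key : ∀ (q : Q m), sectionValue (FDQ := FDQ) (χ + χ') m q =
        𝔼.addQ (sectionValue χ m q) (sectionValue χ' m q) := by
      intro q
      simp [sectionValue, DoubleBundleSquare.addQ]
    rw [key, key, 𝔼.metric_addQ (sectionValue χ m q) (sectionValue χ' m q)
      (sectionValue χ m q') (sectionValue χ' m q') rfl rfl, h, h', add_zero]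
    · rw [hl.projB, hl.projB]
    · rw [hl'.projB, hl'.projB]
  zero_mem' := by
    refine ⟨zero_mem _, fun m q q' => ?_⟩
    obtain ⟨-, b, -, hl⟩ := (𝔼.linearSections U).zero_mem
    have key : ∀ (q : Q m),
        sectionValue (FDQ := FDQ) (0 : ∀ q : opensOver (F := FQ) Q U, DQ q) m q =
        𝔼.smulQ 0 (sectionValue (FDQ := FDQ) (0 : ∀ q : opensOver (F := FQ) Q U, DQ q) m q) := by
      intro q
      simp [DoubleBundleSquare.smulQ, sectionValue]
    rw [key q, key q', 𝔼.metric_smulQ, zero_mul]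
    rw [hl.projB, hl.projB]
  smul_mem' := by
    rintro f χ ⟨hχ, h⟩
    refine ⟨Submodule.smul_mem _ f hχ, fun m q q' => ?_⟩
    obtain ⟨-, b, -, hl⟩ := hχ
    have key : ∀ (q : Q m), sectionValue (FDQ := FDQ) (f • χ) m q =
        𝔼.smulQ (f m) (sectionValue χ m q) := by
      intro q
      simp [sectionValue, DoubleBundleSquare.smulQ]
    rw [key, key, 𝔼.metric_smulQ, h, mul_zero]
    rw [hl.projB, hl.projB]

theorem isotropicSections_le (U : Opens M) : 𝔼.isotropicSections U ≤ 𝔼.linearSections U :=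
  fun _ h => h.1

/-- The map `Γ^ℓ_Q(𝔼) → Γ(B)` over `U` that sends a linear section to its base section. -/
def baseSection (U : Opens M) :
    𝔼.linearSections U →ₗ[SmoothFun 𝓘(ℝ, E) U] smoothSections 𝓘(ℝ, E) FB B U where
  toFun χ := ⟨χ.2.2.choose, χ.2.2.choose_spec.1⟩
  map_add' χ χ' := by
    have key := 𝔼.base_unique (χ + χ').2.2.choose_spec.2
      (𝔼.isLinearOver_add χ.2.2.choose_spec.2 χ'.2.2.choose_spec.2)
    exact Subtype.ext key
  map_smul' f χ := by
    have key := 𝔼.base_unique (f • χ).2.2.choose_spec.2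
      (𝔼.isLinearOver_smul f χ.2.2.choose_spec.2)
    exact Subtype.ext key

/-- The map `𝒞(𝔼) → Γ(B)` over `U`, the restriction of `baseSection` to isotropic sections. -/
def isotropicBase (U : Opens M) :
    𝔼.isotropicSections U →ₗ[SmoothFun 𝓘(ℝ, E) U] smoothSections 𝓘(ℝ, E) FB B U :=
  𝔼.baseSection U ∘ₗ Submodule.inclusion (𝔼.isotropicSections_le U)

theorem projB_sectionValue {U : Opens M} (χ : 𝔼.isotropicSections U) (m : U) (q : Q m) :
    𝔼.projB (sectionValue χ.1 m q) = ⟨m, (𝔼.isotropicBase U χ).1 m⟩ :=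
  (𝔼.isotropicSections_le U χ.2).2.choose_spec.2.projB m q

/-- Restriction of isotropic linear sections to a smaller open set. -/
def isotropicRes {U W : Opens M} (h : W ≤ U) :
    𝔼.isotropicSections U →ₛₗ[SmoothFun.res 𝓘(ℝ, E) h] 𝔼.isotropicSections W where
  toFun χ := ⟨fun q => χ.1 ⟨q.1, h q.2⟩,
    by
      obtain ⟨χ, ⟨hs, b, hb, hl⟩, hi⟩ := χ
      have hle : opensOver (F := FQ) Q W ≤ opensOver Q U := fun _ hq => h hq
      exact ⟨⟨(smoothSections.res (𝓘(ℝ, E).prod 𝓘(ℝ, FQ)) FDQ hle ⟨χ, hs⟩).2,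
        _, (smoothSections.res 𝓘(ℝ, E) FB h ⟨b, hb⟩).2,
        ⟨fun m => hl.projB (Set.inclusion h m), fun m => hl.map_add (Set.inclusion h m),
          fun m => hl.map_smul (Set.inclusion h m)⟩⟩,
        fun m => hi (Set.inclusion h m)⟩⟩
  map_add' _ _ := rfl
  map_smul' _ _ := rfl

/-- `c` is the element `τ̄` of the core over `m` that corresponds to the covector `τ` on `Q_m` under
the identification of the core with `Q^*` given by the metric: `⟨e, τ^†(π_B e)⟩ = τ(π_Q e)`, where
`τ^†(b) = 0_b +_Q τ̄` is the core section over `B`. -/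
structure IsCoreElement (m : M) (τ : Q m → ℝ) (c : TotalSpace FDQ DQ) : Prop where
  projQ : 𝔼.projQ c = ⟨m, 0⟩
  projB : 𝔼.projB c = ⟨m, 0⟩
  pairing : ∀ (q : Q m) (e : TotalSpace FDQ DQ), 𝔼.projQ e = ⟨m, q⟩ →
    𝔼.pairing 𝔼.metric e (𝔼.addQ (𝔼.zeroB (𝔼.projB e)) c) = τ q

end MetricDoubleVectorBundle

/-- `Ω²(Q)` over `U`: smooth sections over `U` of `Q^* ∧ Q^*`, the bundle of alternating bilinear
forms on the fibres of `Q`. -/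
abbrev twoForms (E : Type*) [NormedAddCommGroup E] [NormedSpace ℝ E]
    {M : Type*} [TopologicalSpace M] [ChartedSpace E M]
    (FQ : Type*) [NormedAddCommGroup FQ] [NormedSpace ℝ FQ]
    (Q : M → Type*) [∀ m, AddCommGroup (Q m)] [∀ m, Module ℝ (Q m)]
    [TopologicalSpace (TotalSpace FQ Q)] [∀ m, TopologicalSpace (Q m)]
    [FiberBundle FQ Q] [VectorBundle ℝ FQ Q] (U : Opens M) :=
  smoothSections 𝓘(ℝ, E) (FQ [⋀^Fin 2]→L[ℝ] ℝ) (fun m => Q m [⋀^Fin 2]→L[ℝ] Bundle.Trivial M ℝ m) U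

/-- Restriction of two-forms to a smaller open set. -/
abbrev twoForms.res {U W : Opens M} (h : W ≤ U) :
    twoForms E FQ Q U →ₛₗ[SmoothFun.res 𝓘(ℝ, E) h] twoForms E FQ Q W :=
  smoothSections.res 𝓘(ℝ, E) (FQ [⋀^Fin 2]→L[ℝ] ℝ)
    (V := fun m => Q m [⋀^Fin 2]→L[ℝ] Bundle.Trivial M ℝ m) h

/-- `χ` is the core-linear section `α̃` of `D → Q` given by `α ∈ Ω²(Q)`:
`α̃(q) = 0_q +_B τ̄` with `τ = α(q, ·)`. -/
def MetricDoubleVectorBundle.IsCoreLinear (𝔼 : MetricDoubleVectorBundle E FQ Q FB B FDQ DQ FDB DB)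
    {U : Opens M} (α : twoForms E FQ Q U) (χ : ∀ q : opensOver (F := FQ) Q U, DQ q) : Prop :=
  ∀ (m : U) (q : Q m), ∃ c, 𝔼.IsCoreElement m (fun q' => α.1 m ![q, q']) c ∧
    sectionValue χ m q = 𝔼.addB (𝔼.zeroQ ⟨m, q⟩) c

/-- A linear splitting of `(D; Q, B; M)`: a morphism of double vector bundles `Q ×_M B → D` over the
identities of `Q` and `B` (hence injective). The fibre of `Q ×_M B` over `q ∈ Q_m` is `B_m`, its
fibre over `b ∈ B_m` is `Q_m`. -/
structure LinearSplitting (S : DoubleBundleSquare E FQ Q FB B FDQ DQ FDB DB) where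
  toFun : ∀ m : M, Q m → B m → TotalSpace FDQ DQ
  smooth : ContMDiff (𝓘(ℝ, E).prod 𝓘(ℝ, FQ × FB)) ((𝓘(ℝ, E).prod 𝓘(ℝ, FQ)).prod 𝓘(ℝ, FDQ)) ∞
    (fun x : TotalSpace (FQ × FB) (Q ×ᵇ B) => toFun x.proj x.2.1 x.2.2)
  projQ : ∀ m q b, S.projQ (toFun m q b) = ⟨m, q⟩
  projB : ∀ m q b, S.projB (toFun m q b) = ⟨m, b⟩
  add_right : ∀ m q b b', toFun m q (b + b') = S.addQ (toFun m q b) (toFun m q b')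
  smul_right : ∀ m (r : ℝ) q b, toFun m q (r • b) = S.smulQ r (toFun m q b)
  add_left : ∀ m q q' b, toFun m (q + q') b = S.addB (toFun m q b) (toFun m q' b)
  smul_left : ∀ m (r : ℝ) q b, toFun m (r • q) b = S.smulB r (toFun m q b)

namespace MetricDoubleVectorBundle

variable (𝔼 : MetricDoubleVectorBundle E FQ Q FB B FDQ DQ FDB DB)

/-- Linear splittings with isotropic image in `D → B`. (The image is then maximal isotropic, as its
rank is half the rank of `D → B`.) -/
def LagrangianSplitting : Type _ :=
  {σ : LinearSplitting 𝔼.toDoubleBundleSquare //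
    ∀ m q q' b, 𝔼.pairing 𝔼.metric (σ.toFun m q b) (σ.toFun m q' b) = 0}

/-- Splittings of the sequence `0 → Ω²(Q) → 𝒞(𝔼) → Γ(B) → 0` of sheaves of `C^∞`-modules, given as
right inverses of the last map. -/
structure SheafSplitting where
  toFun : ∀ U : Opens M,
    smoothSections 𝓘(ℝ, E) FB B U →ₗ[SmoothFun 𝓘(ℝ, E) U] 𝔼.isotropicSections U
  res_toFun : ∀ (U W : Opens M) (h : W ≤ U) (b : smoothSections 𝓘(ℝ, E) FB B U),
    𝔼.isotropicRes h (toFun U b) = toFun W (smoothSections.res 𝓘(ℝ, E) FB h b)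
  base_toFun : ∀ (U : Opens M) (b : smoothSections 𝓘(ℝ, E) FB B U),
    𝔼.isotropicBase U (toFun U b) = b

end MetricDoubleVectorBundle

end DVB

end

/-! Everything rests on linear algebra in the fibres of 𝔼 → B. Over b ∈ B_m the projection to Q_m is
linear, and its kernel is isotropic (`metric_ker`): a kernel element is 0_b +_Q c with c in the
core, the metric is linear over Q, and on the core the two additions agree, so that 4⟨c, c'⟩ = 2⟨c,
c'⟩. The zeros 0_q form an isotropic subspace of dimension rank Q in the fibre over 0_m. As an
isotropic subspace for a nondegenerate form has at most half the dimension, rank-nullity forces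
rank(𝔼 → B) = 2 rank Q. Hence the projection to Q_m is onto and its kernel is its own orthogonal
(`finrank_ker_fiberQ`, `orthogonal_ker_fiberQ`). So the vector representing the pullback of a
covector on Q_m lies in this kernel (`coreVec`, `fiberQ_coreVec`), which identifies the core with
Q^*.

Isotropic lifts of a section of B exist locally: choose a smooth right inverse f of the projection
to Q and subtract half of the core vector of the Gram form ⟨f(q), f(·)⟩ (`exists_local_lift`).
Lifting a local frame of B and extending linearly gives local Lagrangian splittings. The metric is
linear over Q, so isotropic linear maps over varying base vectors form a vector space
(`isotropicFiber`), and a partition of unity yields a global Lagrangian splitting S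
(`exists_isLagrangianAt`).

An isotropic section χ over the zero section of B differs from q ↦ 0_q by kernel vectors, so it is
determined by the form ⟨χ(q), 0_{q'}⟩. Isotropy makes this form alternating, and every alternating
form occurs (`exists_eq_coreSection`). This is exactness at Ω²(Q) and 𝒞(𝔼); S provides surjectivity
onto Γ(B). Moreover S identifies 𝒞(𝔼) with Ω²(Q) ⊕ Γ(B), the sections of (Q^* ∧ Q^*) ⊕ B
(`splitEquiv`), from which local freeness and the vector bundle B̂ with its exact sequence are read
off.

A sheaf splitting is C^∞-linear and compatible with restriction, so its value at a point depends
only on the value of the section there (`SheafSplitting.toFun_apply`). This makes it a fibrewise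
map, and local frames show that this map is smooth. -/

noncomputable section

/-! ### Smooth families of linear maps and of alternating forms in finite dimension. -/

section SmoothFamilies

variable {EN : Type*} [NormedAddCommGroup EN] [NormedSpace ℝ EN]
  {HN : Type*} [TopologicalSpace HN] {IN : ModelWithCorners ℝ EN HN}
  {N : Type*} [TopologicalSpace N] [ChartedSpace HN N] {x₀ : N}
  {F : Type*} [NormedAddCommGroup F] [NormedSpace ℝ F]
  {F' : Type*} [NormedAddCommGroup F'] [NormedSpace ℝ F']

/-- A family of continuous linear maps on a finite-dimensional space is smooth as soon as it is
pointwise smooth. -/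
theorem contMDiffAt_clm_of_apply [FiniteDimensional ℝ F] {f : N → F →L[ℝ] F'}
    (h : ∀ v, ContMDiffAt IN 𝓘(ℝ, F') ∞ (fun x => f x v) x₀) :
    ContMDiffAt IN 𝓘(ℝ, F →L[ℝ] F') ∞ f x₀ := by
  let b := Module.finBasis ℝ F
  let L : Fin (Module.finrank ℝ F) → F' →L[ℝ] F →L[ℝ] F' := fun i =>
    ContinuousLinearMap.smulRightL ℝ F F' (LinearMap.toContinuousLinearMap (b.coord i))
  have hf : f = fun x => ∑ i, L i (f x (b i)) := by
    funext x
    ext v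
    have hv := congrArg (f x) (b.sum_repr v)
    rw [map_sum] at hv
    simp [L, ← hv]
  rw [hf]
  exact ContMDiffAt.sum fun i _ => (L i).contMDiff.contMDiffAt.comp x₀ (h (b i))

/-- Invertibility is needed at `x₀` only: inversion is smooth near an isomorphism, and `inverse` is
a total function with the value 0 elsewhere. -/
theorem contMDiffAt_clm_inverse [CompleteSpace F] {f : N → F →L[ℝ] F'}
    (hf : ContMDiffAt IN 𝓘(ℝ, F →L[ℝ] F') ∞ f x₀) (e : F ≃L[ℝ] F') (he : f x₀ = e) :
    ContMDiffAt IN 𝓘(ℝ, F' →L[ℝ] F) ∞ (fun x => (f x).inverse) x₀ := by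
  have h : ContDiffAt ℝ ∞ ContinuousLinearMap.inverse (f x₀) := he ▸ contDiffAt_map_inverse e
  exact h.contMDiffAt.comp x₀ hf

theorem update_cons_zero {A : Type*} (a b c : A) : Function.update ![a, b] 0 c = ![c, b] := by
  funext i
  fin_cases i <;> rfl

theorem update_cons_one {A : Type*} (a b c : A) : Function.update ![a, b] 1 c = ![a, c] := by
  funext i
  fin_cases i <;> rfl

/-- The bilinear map of an alternating form in two variables. -/
def altCurry [FiniteDimensional ℝ F] (η : F [⋀^Fin 2]→L[ℝ] ℝ) : F →L[ℝ] F →L[ℝ] ℝ :=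
  LinearMap.toContinuousLinearMap
    { toFun := fun v => LinearMap.toContinuousLinearMap
        { toFun := fun w => η ![v, w]
          map_add' := fun w w' => by
            have h := η.map_update_add ![v, 0] 1 w w'
            simp only [update_cons_one] at h
            exact h
          map_smul' := fun r w => by
            have h := η.map_update_smul ![v, 0] 1 r w
            simp only [update_cons_one] at h
            exact h }
      map_add' := fun v v' => by
        ext w
        have h := η.map_update_add ![0, w] 0 v v'
        simp only [update_cons_zero] at h
        exact h
      map_smul' := fun r v => by
        ext w
        have h := η.map_update_smul ![0, w] 0 r v
        simp only [update_cons_zero] at h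
        exact h }

theorem alternating_ext_pairs {η η' : F [⋀^Fin 2]→L[ℝ] ℝ} (h : ∀ v w, η ![v, w] = η' ![v, w]) :
    η = η' := by
  ext v
  have hv : v = ![v 0, v 1] := by
    funext i
    fin_cases i <;> rfl
  rw [hv, h]

/-- The coefficients of an alternating form in two variables with respect to a basis. -/
def altCoeff [FiniteDimensional ℝ F] : (F [⋀^Fin 2]→L[ℝ] ℝ) →ₗ[ℝ]
    (Fin (Module.finrank ℝ F) → Fin (Module.finrank ℝ F) → ℝ) where
  toFun η i j := η ![Module.finBasis ℝ F i, Module.finBasis ℝ F j]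
  map_add' _ _ := rfl
  map_smul' _ _ := rfl

/-- A bilinear form is determined by its values on pairs of basis vectors. This embedding into
matrices gives finite-dimensionality of the space of forms, and a left inverse of it reconstructs a
form from its coefficients. -/
theorem altCoeff_injective [FiniteDimensional ℝ F] : Function.Injective (altCoeff (F := F)) := by
  intro η η' h
  have h1 : (altCurry η).toLinearMap = (altCurry η').toLinearMap := by
    refine (Module.finBasis ℝ F).ext fun i => ?_
    have h2 : (altCurry η (Module.finBasis ℝ F i)).toLinearMap =
        (altCurry η' (Module.finBasis ℝ F i)).toLinearMap :=
      (Module.finBasis ℝ F).ext fun j => congrFun (congrFun h i) j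
    exact ContinuousLinearMap.coe_injective h2
  exact alternating_ext_pairs fun v w =>
    DFunLike.congr_fun (LinearMap.congr_fun h1 v : altCurry η v = altCurry η' v) w

instance [FiniteDimensional ℝ F] : FiniteDimensional ℝ (F [⋀^Fin 2]→L[ℝ] ℝ) :=
  FiniteDimensional.of_injective altCoeff altCoeff_injective

theorem contMDiffAt_alternating_of_apply [FiniteDimensional ℝ F] {η : N → F [⋀^Fin 2]→L[ℝ] ℝ}
    (h : ∀ v w, ContMDiffAt IN 𝓘(ℝ, ℝ) ∞ (fun x => η x ![v, w]) x₀) :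
    ContMDiffAt IN 𝓘(ℝ, F [⋀^Fin 2]→L[ℝ] ℝ) ∞ η x₀ := by
  obtain ⟨L, hL⟩ := (altCoeff (F := F)).exists_leftInverse_of_injective
    (LinearMap.ker_eq_bot.2 altCoeff_injective)
  have hη : η = fun x => LinearMap.toContinuousLinearMap L (altCoeff (η x)) := by
    funext x
    exact (LinearMap.congr_fun hL (η x)).symm
  rw [hη]
  refine (LinearMap.toContinuousLinearMap L).contMDiff.contMDiffAt.comp x₀ ?_
  exact contMDiffAt_pi_space.2 fun i => contMDiffAt_pi_space.2 fun j => h _ _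

/-- Evaluation of alternating forms at a pair of vectors. -/
def altEval (v w : F) : (F [⋀^Fin 2]→L[ℝ] ℝ) →ₗ[ℝ] ℝ where
  toFun η := η ![v, w]
  map_add' _ _ := rfl
  map_smul' _ _ := rfl

/-- Form and arguments vary together, so the form is first curried; two applications of linear maps
then depend smoothly on everything. -/
theorem contMDiffAt_alternating_apply [FiniteDimensional ℝ F] {η : N → F [⋀^Fin 2]→L[ℝ] ℝ}
    {v w : N → F} (hη : ContMDiffAt IN 𝓘(ℝ, F [⋀^Fin 2]→L[ℝ] ℝ) ∞ η x₀)
    (hv : ContMDiffAt IN 𝓘(ℝ, F) ∞ v x₀) (hw : ContMDiffAt IN 𝓘(ℝ, F) ∞ w x₀) :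
    ContMDiffAt IN 𝓘(ℝ, ℝ) ∞ (fun x => η x ![v x, w x]) x₀ := by
  have h : ContMDiffAt IN 𝓘(ℝ, F →L[ℝ] F →L[ℝ] ℝ) ∞ (fun x => altCurry (η x)) x₀ :=
    contMDiffAt_clm_of_apply fun v => contMDiffAt_clm_of_apply fun w =>
      (LinearMap.toContinuousLinearMap (altEval v w)).contMDiff.contMDiffAt.comp x₀ hη
  exact (h.clm_apply hv).clm_apply hw

end SmoothFamilies

/-! ### Smooth sections along a map, read in trivializations, and local frames. -/

section BundleSections

variable {EX : Type*} [NormedAddCommGroup EX] [NormedSpace ℝ EX]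
  {HX : Type*} [TopologicalSpace HX] {IX : ModelWithCorners ℝ EX HX}
  {X : Type*} [TopologicalSpace X] [ChartedSpace HX X]
  {F : Type*} [NormedAddCommGroup F] [NormedSpace ℝ F]
  {V : X → Type*} [∀ x, AddCommGroup (V x)] [∀ x, Module ℝ (V x)]
  [TopologicalSpace (TotalSpace F V)] [∀ x, TopologicalSpace (V x)]
  [FiberBundle F V] [VectorBundle ℝ F V]
  {EN : Type*} [NormedAddCommGroup EN] [NormedSpace ℝ EN]
  {HN : Type*} [TopologicalSpace HN] {IN : ModelWithCorners ℝ EN HN}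
  {N : Type*} [TopologicalSpace N] [ChartedSpace HN N] {p : N → X} {x₀ : N}

theorem contMDiffAt_add_along {s t : ∀ y, V (p y)}
    (hs : ContMDiffAt IN (IX.prod 𝓘(ℝ, F)) ∞ (fun y => (⟨p y, s y⟩ : TotalSpace F V)) x₀)
    (ht : ContMDiffAt IN (IX.prod 𝓘(ℝ, F)) ∞ (fun y => (⟨p y, t y⟩ : TotalSpace F V)) x₀) :
    ContMDiffAt IN (IX.prod 𝓘(ℝ, F)) ∞ (fun y => (⟨p y, s y + t y⟩ : TotalSpace F V)) x₀ := by
  have h1 := contMDiffAt_totalSpace.1 hs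
  have h2 := contMDiffAt_totalSpace.1 ht
  refine contMDiffAt_totalSpace.2 ⟨h1.1, (h1.2.add h2.2).congr_of_eventuallyEq ?_⟩
  set e := trivializationAt F V (p x₀)
  have hc : ContinuousAt p x₀ := h1.1.continuousAt
  filter_upwards [hc.preimage_mem_nhds
    (e.open_baseSet.mem_nhds (mem_baseSet_trivializationAt F V (p x₀)))] with y hy
  exact (e.linear ℝ hy).map_add _ _

theorem contMDiffAt_smul_along {f : N → ℝ} {s : ∀ y, V (p y)}
    (hf : ContMDiffAt IN 𝓘(ℝ, ℝ) ∞ f x₀)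
    (hs : ContMDiffAt IN (IX.prod 𝓘(ℝ, F)) ∞ (fun y => (⟨p y, s y⟩ : TotalSpace F V)) x₀) :
    ContMDiffAt IN (IX.prod 𝓘(ℝ, F)) ∞ (fun y => (⟨p y, f y • s y⟩ : TotalSpace F V)) x₀ := by
  have h1 := contMDiffAt_totalSpace.1 hs
  refine contMDiffAt_totalSpace.2 ⟨h1.1, (hf.smul h1.2).congr_of_eventuallyEq ?_⟩
  set e := trivializationAt F V (p x₀)
  have hc : ContinuousAt p x₀ := h1.1.continuousAt
  filter_upwards [hc.preimage_mem_nhds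
    (e.open_baseSet.mem_nhds (mem_baseSet_trivializationAt F V (p x₀)))] with y hy
  exact (e.linear ℝ hy).map_smul _ _

theorem contMDiffAt_zero_along (hp : ContMDiffAt IN IX ∞ p x₀) :
    ContMDiffAt IN (IX.prod 𝓘(ℝ, F)) ∞ (fun y => (⟨p y, 0⟩ : TotalSpace F V)) x₀ := by
  exact (contMDiff_zeroSection ℝ V).contMDiffAt.comp x₀ hp

theorem contMDiffAt_sum_along {κ : Type*} (A : Finset κ) {s : κ → ∀ y, V (p y)}
    (hp : ContMDiffAt IN IX ∞ p x₀)
    (hs : ∀ i ∈ A,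
      ContMDiffAt IN (IX.prod 𝓘(ℝ, F)) ∞ (fun y => (⟨p y, s i y⟩ : TotalSpace F V)) x₀) :
    ContMDiffAt IN (IX.prod 𝓘(ℝ, F)) ∞ (fun y => (⟨p y, ∑ i ∈ A, s i y⟩ : TotalSpace F V)) x₀ := by
  classical
  induction A using Finset.induction_on with
  | empty => simpa using contMDiffAt_zero_along hp
  | insert a A ha ih =>
    simp only [Finset.sum_insert ha]
    exact contMDiffAt_add_along (hs a (Finset.mem_insert_self a A))
      (ih fun i hi => hs i (Finset.mem_insert_of_mem hi))

variable [ContMDiffVectorBundle ∞ F V IX]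

theorem contMDiffAt_symm_along (e : Trivialization F (π F V)) [MemTrivializationAtlas e]
    {v : N → F} (hp : ContMDiffAt IN IX ∞ p x₀) (hv : ContMDiffAt IN 𝓘(ℝ, F) ∞ v x₀)
    (he : p x₀ ∈ e.baseSet) :
    ContMDiffAt IN (IX.prod 𝓘(ℝ, F)) ∞
      (fun y => (⟨p y, e.symm (p y) (v y)⟩ : TotalSpace F V)) x₀ := by
  refine (e.contMDiffAt_iff (by simpa [e.mem_source] using he)).2
    ⟨hp, hv.congr_of_eventuallyEq ?_⟩
  filter_upwards [hp.continuousAt.preimage_mem_nhds (e.open_baseSet.mem_nhds he)] with y hy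
  simp [e.apply_mk_symm hy]

theorem contMDiffAt_coord_along (e : Trivialization F (π F V)) [MemTrivializationAtlas e]
    {s : ∀ y, V (p y)}
    (hs : ContMDiffAt IN (IX.prod 𝓘(ℝ, F)) ∞ (fun y => (⟨p y, s y⟩ : TotalSpace F V)) x₀)
    (he : p x₀ ∈ e.baseSet) :
    ContMDiffAt IN 𝓘(ℝ, F) ∞ (fun y => (e ⟨p y, s y⟩).2) x₀ :=
  ((e.contMDiffAt_iff (f := fun y => (⟨p y, s y⟩ : TotalSpace F V))
    (by simpa [e.mem_source] using he)).1 hs).2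

theorem contMDiffAt_proj_along {s : ∀ y, V (p y)}
    (hs : ContMDiffAt IN (IX.prod 𝓘(ℝ, F)) ∞ (fun y => (⟨p y, s y⟩ : TotalSpace F V)) x₀) :
    ContMDiffAt IN IX ∞ p x₀ :=
  (contMDiffAt_totalSpace.1 hs).1

/-- Over an open subset of the base set of a trivialization the smooth sections form a free module
with a basis that is compatible with restrictions. -/
theorem smoothSections.exists_basis {n : ℕ} (b : Module.Basis (Fin n) ℝ F)
    (e : Trivialization F (π F V)) [MemTrivializationAtlas e] (U : Opens X)
    (hU : (U : Set X) ⊆ e.baseSet) :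
    ∃ s : Fin n → smoothSections IX F V U,
      (∀ i (x : U), (s i).1 x = e.symm x (b i)) ∧
      ∀ (W : Opens X) (h : W ≤ U),
        ∃ β : Module.Basis (Fin n) (SmoothFun IX W) (smoothSections IX F V W),
          ∀ i, β i = smoothSections.res IX F h (s i) := by
  have hs : ∀ (W : Opens X) (_ : W ≤ U) (v : W → F) (_ : ContMDiff IX 𝓘(ℝ, F) ∞ v),
      (fun x : W => e.symm (x : X) (v x)) ∈ smoothSections IX F V W := fun W h v hv x =>
    contMDiffAt_symm_along e contMDiff_subtype_val.contMDiffAt hv.contMDiffAt (hU (h x.2))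
  refine ⟨fun i => ⟨_, hs U le_rfl (fun _ => b i) contMDiff_const⟩, fun i x => rfl, fun W h => ?_⟩
  have hb : ∀ x : W, (x : X) ∈ e.baseSet := fun x => hU (h x.2)
  let c : Fin n → F →L[ℝ] ℝ := fun i =>
    haveI : FiniteDimensional ℝ F := b.finiteDimensional_of_finite
    LinearMap.toContinuousLinearMap (b.coord i)
  have hc : ∀ i v, c i v = b.repr v i := fun i v => rfl
  -- Coordinates in the frame `e.symm x (b i)` identify the sections over `W` with n-tuples of
  -- functions; the basis is the preimage of the standard one.
  let φ : smoothSections IX F V W ≃ₗ[SmoothFun IX W] (Fin n → SmoothFun IX W) :=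
    { toFun := fun t i => ⟨fun x => c i (e ⟨x, t.1 x⟩).2, fun x =>
        (c i).contMDiff.contMDiffAt.comp x (contMDiffAt_coord_along e (t.2 x) (hb x))⟩
      map_add' := fun t t' => by
        funext i
        ext x
        change c i (e ⟨x, t.1 x + t'.1 x⟩).2 = c i (e ⟨x, t.1 x⟩).2 + c i (e ⟨x, t'.1 x⟩).2
        rw [(e.linear ℝ (hb x)).map_add, map_add]
      map_smul' := fun f t => by
        funext i
        ext x
        change c i (e ⟨x, f x • t.1 x⟩).2 = f x * c i (e ⟨x, t.1 x⟩).2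
        rw [(e.linear ℝ (hb x)).map_smul, map_smul, smul_eq_mul]
      invFun := fun f => ⟨fun x => e.symm (x : X) (∑ i, f i x • b i), hs W h _
        (contMDiff_finsetSum fun i _ => (f i).contMDiff.smul contMDiff_const)⟩
      left_inv := fun t => by
        refine Subtype.ext (funext fun x => ?_)
        change e.symm (x : X) (∑ i, b.repr (e ⟨x, t.1 x⟩).2 i • b i) = t.1 x
        rw [b.sum_repr]
        exact e.symm_apply_apply_mk (hb x) _
      right_inv := fun f => by
        funext i
        ext x
        change b.repr (e ⟨x, e.symm (x : X) (∑ i, f i x • b i)⟩).2 i = f i x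
        rw [e.apply_mk_symm (hb x), b.repr_sum_self] }
  refine ⟨Module.Basis.ofEquivFun φ, fun i => Subtype.ext (funext fun x => ?_)⟩
  rw [Module.Basis.coe_ofEquivFun]
  change e.symm (x : X) (∑ j, (Pi.single (M := fun _ => SmoothFun IX W) i 1 j) x • b j) = e.symm (x : X) (b i)
  congr 1
  rw [Finset.sum_eq_single i]
  · simp
  · intro j _ hj
    simp [hj]
  · simp

end BundleSections
end

noncomputable section

/-! ### The smooth vector bundle of alternating two-forms. -/

section AlternatingBundle

variable {EX : Type*} [NormedAddCommGroup EX] [NormedSpace ℝ EX]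
  {HX : Type*} [TopologicalSpace HX] {IX : ModelWithCorners ℝ EX HX}
  {X : Type*} [TopologicalSpace X] [ChartedSpace HX X]
  {F : Type*} [NormedAddCommGroup F] [NormedSpace ℝ F] [FiniteDimensional ℝ F]
  {V : X → Type*} [∀ x, AddCommGroup (V x)] [∀ x, Module ℝ (V x)]
  [TopologicalSpace (TotalSpace F V)] [∀ x, TopologicalSpace (V x)]
  [FiberBundle F V] [VectorBundle ℝ F V] [ContMDiffVectorBundle ∞ F V IX]
  {EN : Type*} [NormedAddCommGroup EN] [NormedSpace ℝ EN]
  {HN : Type*} [TopologicalSpace HN] {IN : ModelWithCorners ℝ EN HN}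
  {N : Type*} [TopologicalSpace N] [ChartedSpace HN N] {p : N → X} {x₀ : N}

/-- A coordinate change of forms is pullback along the reverse coordinate change of `V`. In finite
dimension its smoothness can be tested on a fixed form and two fixed vectors, where it reduces to
that of the coordinate changes of `V`. -/
instance : (Bundle.ContinuousAlternatingMap.vectorPrebundle ℝ (Fin 2) F V ℝ
    (Bundle.Trivial X ℝ)).IsContMDiff IX ∞ where
  exists_contMDiffCoordChange := by
    rintro _ ⟨e₁, e₂, he₁, he₂, rfl⟩ _ ⟨e₁', e₂', he₁', he₂', rfl⟩
    refine ⟨Pretrivialization.continuousAlternatingMapCoordChange ℝ (Fin 2) e₁ e₁' e₂ e₂', ?_,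
      Pretrivialization.continuousAlternatingMapCoordChange_apply⟩
    rintro x ⟨⟨h₁, h₂⟩, ⟨h₁', h₂'⟩⟩
    refine ContMDiffAt.contMDiffWithinAt (contMDiffAt_clm_of_apply fun η =>
      contMDiffAt_alternating_of_apply fun v w => ?_)
    have hA := contMDiffAt_coordChangeL (n := ∞) (IB := IX) h₁' h₁
    have hB := contMDiffAt_coordChangeL (n := ∞) (IB := IX) h₂ h₂'
    refine (hB.clm_apply (contMDiffAt_alternating_apply (contMDiffAt_const (c := η))
      (hA.clm_apply (contMDiffAt_const (c := v)))
      (hA.clm_apply (contMDiffAt_const (c := w))))).congr_of_eventuallyEq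
        (Filter.Eventually.of_forall fun y => ?_)
    simp only [Pretrivialization.continuousAlternatingMapCoordChange]
    change (e₂.coordChangeL ℝ e₂' y) (η _) = (e₂.coordChangeL ℝ e₂' y) (η _)
    congr 2
    funext i
    fin_cases i <;> rfl

instance : ContMDiffVectorBundle ∞ (F [⋀^Fin 2]→L[ℝ] ℝ)
    (fun x => V x [⋀^Fin 2]→L[ℝ] Bundle.Trivial X ℝ x) IX :=
  (Bundle.ContinuousAlternatingMap.vectorPrebundle ℝ (Fin 2) F V ℝ
    (Bundle.Trivial X ℝ)).contMDiffVectorBundle IX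

/-- The coordinates of an alternating form on a fibre are its values on the local frame. -/
theorem alternating_coord_apply (y₀ y : X) (η : V y [⋀^Fin 2]→L[ℝ] Bundle.Trivial X ℝ y)
    (hy : y ∈ (trivializationAt F V y₀).baseSet) (v w : F) :
    (trivializationAt (F [⋀^Fin 2]→L[ℝ] ℝ)
      (fun x => V x [⋀^Fin 2]→L[ℝ] Bundle.Trivial X ℝ x) y₀ ⟨y, η⟩).2 ![v, w] =
    η ![(trivializationAt F V y₀).symm y v, (trivializationAt F V y₀).symm y w] := by
  rw [FiberBundle.trivializationAt_continuousAlternatingMap_apply]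
  simp only [ContinuousAlternatingMap.inCoordinates]
  change ((trivializationAt ℝ (Bundle.Trivial X ℝ) y₀).continuousLinearMapAt ℝ y) (η _) = _
  have h : ((trivializationAt F V y₀).symmL ℝ y ∘ ![v, w]) =
      ![(trivializationAt F V y₀).symm y v, (trivializationAt F V y₀).symm y w] := by
    funext i
    fin_cases i <;> simp [Trivialization.symmL_apply _ hy]
  change ((trivializationAt ℝ (Bundle.Trivial X ℝ) y₀).continuousLinearMapAt ℝ y)
    (η ((trivializationAt F V y₀).symmL ℝ y ∘ ![v, w])) = _
  rw [h]
  exact DFunLike.congr_fun (Bundle.Trivial.continuousLinearMapAt_trivialization ℝ X ℝ y) _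

theorem contMDiffAt_twoForm_apply {η : ∀ y, V (p y) [⋀^Fin 2]→L[ℝ] Bundle.Trivial X ℝ (p y)}
    {s t : ∀ y, V (p y)}
    (hη : ContMDiffAt IN (IX.prod 𝓘(ℝ, F [⋀^Fin 2]→L[ℝ] ℝ)) ∞ (fun y => (⟨p y, η y⟩ :
      TotalSpace (F [⋀^Fin 2]→L[ℝ] ℝ) (fun x => V x [⋀^Fin 2]→L[ℝ] Bundle.Trivial X ℝ x))) x₀)
    (hs : ContMDiffAt IN (IX.prod 𝓘(ℝ, F)) ∞ (fun y => (⟨p y, s y⟩ : TotalSpace F V)) x₀)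
    (ht : ContMDiffAt IN (IX.prod 𝓘(ℝ, F)) ∞ (fun y => (⟨p y, t y⟩ : TotalSpace F V)) x₀) :
    ContMDiffAt IN 𝓘(ℝ, ℝ) ∞ (fun y => (η y ![s y, t y] : ℝ)) x₀ := by
  have hb := mem_baseSet_trivializationAt F V (p x₀)
  refine (contMDiffAt_alternating_apply (contMDiffAt_totalSpace.1 hη).2
    (contMDiffAt_coord_along _ hs hb) (contMDiffAt_coord_along _ ht hb)).congr_of_eventuallyEq ?_
  filter_upwards [(contMDiffAt_proj_along hs).continuousAt.preimage_mem_nhds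
    ((trivializationAt F V (p x₀)).open_baseSet.mem_nhds hb)] with y hy
  rw [alternating_coord_apply _ _ _ hy]
  rw [Trivialization.symm_apply_apply_mk _ hy, Trivialization.symm_apply_apply_mk _ hy]

/-- The values on pairs of vectors of the preferred frame are the values of the form in coordinates,
and in finite dimension they control smoothness. -/
theorem contMDiffAt_twoForm_of_apply {η : ∀ y, V (p y) [⋀^Fin 2]→L[ℝ] Bundle.Trivial X ℝ (p y)}
    (hp : ContMDiffAt IN IX ∞ p x₀)
    (h : ∀ v w, ContMDiffAt IN 𝓘(ℝ, ℝ) ∞ (fun y => (η y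
      ![(trivializationAt F V (p x₀)).symm (p y) v, (trivializationAt F V (p x₀)).symm (p y) w] :
        ℝ)) x₀) :
    ContMDiffAt IN (IX.prod 𝓘(ℝ, F [⋀^Fin 2]→L[ℝ] ℝ)) ∞ (fun y => (⟨p y, η y⟩ :
      TotalSpace (F [⋀^Fin 2]→L[ℝ] ℝ)
        (fun x => V x [⋀^Fin 2]→L[ℝ] Bundle.Trivial X ℝ x))) x₀ := by
  have hb := mem_baseSet_trivializationAt F V (p x₀)
  refine contMDiffAt_totalSpace.2 ⟨hp, contMDiffAt_alternating_of_apply fun v w =>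
    (h v w).congr_of_eventuallyEq ?_⟩
  filter_upwards [hp.continuousAt.preimage_mem_nhds
    ((trivializationAt F V (p x₀)).open_baseSet.mem_nhds hb)] with y hy
  exact alternating_coord_apply _ _ _ hy _ _

/-- An alternating bilinear form on a fibre of a bundle of finite rank as a continuous alternating
map. -/
def alternatingOfBilin (x : X) (a : V x →ₗ[ℝ] V x →ₗ[ℝ] ℝ) (ha : ∀ v, a v v = 0) :
    V x [⋀^Fin 2]→L[ℝ] ℝ where
  toFun v := a (v 0) (v 1)
  map_update_add' := by
    intro _ v i y z
    fin_cases i <;> simp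
  map_update_smul' := by
    intro _ v i r y
    fin_cases i <;> simp
  map_eq_zero_of_eq' := by
    intro v i j h hij
    have h01 : v 0 = v 1 := by
      fin_cases i <;> fin_cases j <;> simp_all
    rw [h01, ha]
  cont := by
    -- The fibre carries no norm, so continuity is transported from `F`, where every bilinear form
    -- is continuous.
    let L := VectorBundle.continuousLinearEquivAt ℝ F V x
    let a' : F →L[ℝ] F →L[ℝ] ℝ := LinearMap.toContinuousLinearMap
      ((LinearMap.toContinuousLinearMap (𝕜 := ℝ) (E := F) (F' := ℝ)).toLinearMap ∘ₗ
        (a.compl₁₂ L.symm.toLinearEquiv.toLinearMap L.symm.toLinearEquiv.toLinearMap))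
    have h : (fun v : Fin 2 → V x => a (v 0) (v 1)) = fun v => a' (L (v 0)) (L (v 1)) := by
      funext v
      simp [a']
    change Continuous (fun v : Fin 2 → V x => a (v 0) (v 1))
    rw [h]
    have h0 : Continuous fun v : Fin 2 → V x => L (v 0) := L.continuous.comp (continuous_apply 0)
    have h1 : Continuous fun v : Fin 2 → V x => L (v 1) := L.continuous.comp (continuous_apply 1)
    exact (a'.continuous.comp h0).clm_apply h1

end AlternatingBundle

/-! ### Transport of a vector bundle to another model fibre. -/

section ModelBundle

variable {EX : Type*} [NormedAddCommGroup EX] [NormedSpace ℝ EX]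
  {HX : Type*} [TopologicalSpace HX] (IX : ModelWithCorners ℝ EX HX)
  {X : Type*} [TopologicalSpace X] [ChartedSpace HX X]
  (F : Type*) [NormedAddCommGroup F] [NormedSpace ℝ F]
  (V : X → Type*) [∀ x, AddCommGroup (V x)] [∀ x, Module ℝ (V x)]
  [TopologicalSpace (TotalSpace F V)] [∀ x, TopologicalSpace (V x)]
  [FiberBundle F V] [VectorBundle ℝ F V]
  {F' : Type*} [NormedAddCommGroup F'] [NormedSpace ℝ F'] (L : F ≃L[ℝ] F')

/-- The vector bundle core with fibre `F'` that is obtained from a vector bundle with fibre `F` and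
an isomorphism `F ≃ F'`. -/
def modelCore : VectorBundleCore ℝ X F' X where
  baseSet x := (trivializationAt F V x).baseSet
  isOpen_baseSet x := (trivializationAt F V x).open_baseSet
  indexAt x := x
  mem_baseSet_at x := mem_baseSet_trivializationAt F V x
  coordChange i j x := L.toContinuousLinearMap ∘L
    ((trivializationAt F V i).coordChangeL ℝ (trivializationAt F V j) x : F →L[ℝ] F) ∘L
      L.symm.toContinuousLinearMap
  coordChange_self i x hx v := by
    simp [Trivialization.coordChangeL_apply _ _ (And.intro hx hx),
      Trivialization.apply_mk_symm _ hx]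
  continuousOn_coordChange _ _ :=
    continuousOn_const.clm_comp ((continuousOn_coordChange ℝ _ _).clm_comp continuousOn_const)
  coordChange_comp _ _ _ x hx v := by
    simp [Trivialization.coordChangeL_apply _ _ (And.intro hx.1.1 hx.1.2),
      Trivialization.coordChangeL_apply _ _ (And.intro hx.1.2 hx.2),
      Trivialization.coordChangeL_apply _ _ (And.intro hx.1.1 hx.2),
      Trivialization.symm_apply_apply_mk _ hx.1.2]

instance [ContMDiffVectorBundle ∞ F V IX] : (modelCore F V L).IsContMDiff IX ∞ where
  contMDiffOn_coordChange _ _ :=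
    contMDiffOn_const.clm_comp ((contMDiffOn_coordChangeL _ _).clm_comp contMDiffOn_const)

/-- The fibrewise isomorphism of a vector bundle with its model. -/
def toModel (x : X) : V x ≃ₗ[ℝ] (modelCore F V L).Fiber x :=
  ((VectorBundle.continuousLinearEquivAt ℝ F V x).trans L).toLinearEquiv

variable {F V}

/-- The model fibre at `x` records coordinates in the trivialization preferred at `x`; the
coordinate change to the one at `x₀` cancels this choice. -/
theorem coord_toModel (x₀ x : X) (v : V x) (hx : x ∈ (trivializationAt F V x₀).baseSet) :
    (trivializationAt F' (modelCore F V L).Fiber x₀ ⟨x, toModel F V L x v⟩).2 =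
      L (trivializationAt F V x₀ ⟨x, v⟩).2 := by
  change L ((trivializationAt F V x).coordChangeL ℝ (trivializationAt F V x₀) x
    (L.symm (L (trivializationAt F V x ⟨x, v⟩).2))) = _
  have hxx := mem_baseSet_trivializationAt F V x
  simp [Trivialization.coordChangeL_apply _ _ (And.intro hxx hx),
    Trivialization.symm_apply_apply_mk _ hxx]

variable {EN : Type*} [NormedAddCommGroup EN] [NormedSpace ℝ EN]
  {HN : Type*} [TopologicalSpace HN] {IN : ModelWithCorners ℝ EN HN}
  {N : Type*} [TopologicalSpace N] [ChartedSpace HN N] {p : N → X} {x₀ : N} {IX}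

/-- The coordinates on the two sides differ by the constant isomorphism `L`. -/
theorem contMDiffAt_toModel_iff {s : ∀ y, V (p y)} :
    ContMDiffAt IN (IX.prod 𝓘(ℝ, F')) ∞
      (fun y => (⟨p y, toModel F V L (p y) (s y)⟩ : TotalSpace F' (modelCore F V L).Fiber)) x₀ ↔
    ContMDiffAt IN (IX.prod 𝓘(ℝ, F)) ∞ (fun y => (⟨p y, s y⟩ : TotalSpace F V)) x₀ := by
  have hb := mem_baseSet_trivializationAt F V (p x₀)
  rw [contMDiffAt_totalSpace, contMDiffAt_totalSpace]
  refine and_congr_right fun hp => ?_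
  have h : (fun y => (trivializationAt F' (modelCore F V L).Fiber (p x₀)
        ⟨p y, toModel F V L (p y) (s y)⟩).2) =ᶠ[nhds x₀]
      fun y => L (trivializationAt F V (p x₀) ⟨p y, s y⟩).2 := by
    filter_upwards [hp.continuousAt.preimage_mem_nhds
      ((trivializationAt F V (p x₀)).open_baseSet.mem_nhds hb)] with y hy
    exact coord_toModel L _ _ _ hy
  refine h.contMDiffAt_iff.trans ⟨fun h => ?_, fun h =>
    L.toContinuousLinearMap.contMDiff.contMDiffAt.comp x₀ h⟩
  have h' := L.symm.toContinuousLinearMap.contMDiff.contMDiffAt.comp x₀ h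
  simpa [Function.comp_def] using h'

end ModelBundle
end

noncomputable section
-- Linear algebra in a metric double vector bundle: zeros, core and kernel.
section DoubleBundleAlgebra

variable {E : Type*} [NormedAddCommGroup E] [NormedSpace ℝ E]
  {M : Type*} [TopologicalSpace M] [ChartedSpace E M]
  {FQ : Type*} [NormedAddCommGroup FQ] [NormedSpace ℝ FQ]
  {Q : M → Type*} [∀ m, AddCommGroup (Q m)] [∀ m, Module ℝ (Q m)]
  [TopologicalSpace (TotalSpace FQ Q)] [∀ m, TopologicalSpace (Q m)]
  [FiberBundle FQ Q] [VectorBundle ℝ FQ Q]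
  {FB : Type*} [NormedAddCommGroup FB] [NormedSpace ℝ FB]
  {B : M → Type*} [∀ m, AddCommGroup (B m)] [∀ m, Module ℝ (B m)]
  [TopologicalSpace (TotalSpace FB B)] [∀ m, TopologicalSpace (B m)]
  [FiberBundle FB B] [VectorBundle ℝ FB B]
  {FDQ : Type*} [NormedAddCommGroup FDQ] [NormedSpace ℝ FDQ]
  {DQ : TotalSpace FQ Q → Type*} [∀ q, AddCommGroup (DQ q)] [∀ q, Module ℝ (DQ q)]
  [TopologicalSpace (TotalSpace FDQ DQ)] [∀ q, TopologicalSpace (DQ q)]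
  [FiberBundle FDQ DQ] [VectorBundle ℝ FDQ DQ]
  {FDB : Type*} [NormedAddCommGroup FDB] [NormedSpace ℝ FDB]
  {DB : TotalSpace FB B → Type*} [∀ b, AddCommGroup (DB b)] [∀ b, Module ℝ (DB b)]
  [TopologicalSpace (TotalSpace FDB DB)] [∀ b, TopologicalSpace (DB b)]
  [FiberBundle FDB DB] [VectorBundle ℝ FDB DB]

/-- Trades an equation between base points for a vector of the fibre, so that later arguments avoid
casts. -/
theorem Bundle.TotalSpace.exists_eq_mk {X F : Type*} {V : X → Type*} {d : TotalSpace F V} {x : X}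
    (h : d.proj = x) : ∃ v : V x, d = ⟨x, v⟩ := by
  subst h
  exact ⟨d.2, rfl⟩

namespace DoubleBundleSquare

variable (S : DoubleBundleSquare E FQ Q FB B FDQ DQ FDB DB)

/-- The point of `D` given by a vector of the fibre of `D → B` over `b`. -/
def inB (b : TotalSpace FB B) (x : DB b) : TotalSpace FDQ DQ := S.swap.symm ⟨b, x⟩

@[simp] theorem swap_inB (b : TotalSpace FB B) (x : DB b) : S.swap (S.inB b x) = ⟨b, x⟩ :=
  S.swap.apply_symm_apply _

@[simp] theorem projB_inB (b : TotalSpace FB B) (x : DB b) : S.projB (S.inB b x) = b := by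
  simp [projB]

theorem exists_inB {d : TotalSpace FDQ DQ} {b : TotalSpace FB B} (h : S.projB d = b) :
    ∃ x : DB b, d = S.inB b x := by
  obtain ⟨x, hx⟩ := Bundle.TotalSpace.exists_eq_mk h
  exact ⟨x, by rw [inB, ← hx]; exact (S.swap.symm_apply_apply d).symm⟩

theorem inB_injective (b : TotalSpace FB B) : Function.Injective (S.inB b) := by
  intro x y h
  have h' := congrArg S.swap h
  simpa using h'

@[simp] theorem addB_inB (b : TotalSpace FB B) (x y : DB b) :
    S.addB (S.inB b x) (S.inB b y) = S.inB b (x + y) := by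
  simp [addB, inB]

@[simp] theorem smulB_inB (r : ℝ) (b : TotalSpace FB B) (x : DB b) :
    S.smulB r (S.inB b x) = S.inB b (r • x) := by
  simp [smulB, inB]

theorem zeroB_eq_inB (b : TotalSpace FB B) : S.zeroB b = S.inB b 0 := rfl

open Classical in
@[simp] theorem pairing_inB (g : ∀ b : TotalSpace FB B, DB b →L[ℝ] DB b →L[ℝ] ℝ)
    (b : TotalSpace FB B) (x y : DB b) : S.pairing g (S.inB b x) (S.inB b y) = g b x y := by
  have key : ∀ u v : TotalSpace FDB DB, u = ⟨b, x⟩ → v = ⟨b, y⟩ →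
      (if h : u.proj = v.proj then g v.proj (h ▸ u.2) v.2 else 0) = g b x y := by
    rintro u v rfl rfl
    simp
  exact key _ _ (S.swap_inB b x) (S.swap_inB b y)

@[simp] theorem addQ_mk (q : TotalSpace FQ Q) (x y : DQ q) :
    S.addQ ⟨q, x⟩ ⟨q, y⟩ = ⟨q, x + y⟩ := Bundle.TotalSpace.fadd_mk q x y

@[simp] theorem smulQ_mk (r : ℝ) (q : TotalSpace FQ Q) (x : DQ q) :
    S.smulQ r ⟨q, x⟩ = ⟨q, r • x⟩ := rfl

namespace IsDoubleVectorBundle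

variable {S} (H : S.IsDoubleVectorBundle)
include H

/-- A zero of D → Q is 0 times itself, and the projection to B is homogeneous. -/
theorem projB_zeroQ (m : M) (q : Q m) : S.projB (S.zeroQ ⟨m, q⟩) = ⟨m, 0⟩ := by
  have h1 : S.zeroQ ⟨m, q⟩ = S.smulQ 0 (S.zeroQ ⟨m, q⟩) := by simp [zeroQ]
  obtain ⟨b, hb⟩ := Bundle.TotalSpace.exists_eq_mk (H.proj_comm (S.zeroQ ⟨m, q⟩)).symm
  rw [h1, H.projB_smulQ, hb, Bundle.TotalSpace.fsmul_mk, zero_smul]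
  rfl

theorem projQ_zeroB (m : M) (b : B m) : S.projQ (S.zeroB ⟨m, b⟩) = ⟨m, 0⟩ := by
  have h1 : S.zeroB ⟨m, b⟩ = S.smulB 0 (S.zeroB ⟨m, b⟩) := by simp [zeroB_eq_inB]
  have h2 := H.proj_comm (S.zeroB ⟨m, b⟩)
  rw [zeroB_eq_inB, projB_inB] at h2
  obtain ⟨q, hq⟩ := Bundle.TotalSpace.exists_eq_mk h2
  rw [h1, H.projQ_smulB, zeroB_eq_inB, hq]
  simp

/-- The two multiplications by 0 commute; applied to the zero over 0_m, one order gives the zero of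
D → B and the other the zero of D → Q. -/
theorem zeroQ_zero (m : M) : S.zeroQ ⟨m, 0⟩ = S.zeroB ⟨m, 0⟩ := by
  obtain ⟨x, hx⟩ := S.exists_inB (H.projB_zeroQ m 0)
  have h := H.smulB_smulQ 0 0 (S.zeroQ ⟨m, 0⟩)
  have h1 : S.smulQ 0 (S.zeroQ ⟨m, (0 : Q m)⟩) = S.zeroQ ⟨m, 0⟩ := by simp [zeroQ]
  have h2 : S.smulB 0 (S.zeroQ ⟨m, (0 : Q m)⟩) = S.zeroB ⟨m, 0⟩ := by
    rw [hx, smulB_inB, zero_smul, zeroB_eq_inB]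
  obtain ⟨y, hy⟩ := Bundle.TotalSpace.exists_eq_mk (H.projQ_zeroB m (0 : B m))
  rw [h1, h2, hy, smulQ_mk, zero_smul] at h
  rw [hy, h]
  rfl

/-- On the core the two additions agree. -/
theorem addB_eq_addQ_of_core {m : M} {c c' : TotalSpace FDQ DQ} (hc : S.projQ c = ⟨m, 0⟩)
    (hc' : S.projQ c' = ⟨m, 0⟩) (hb : S.projB c = ⟨m, 0⟩) (hb' : S.projB c' = ⟨m, 0⟩) :
    S.addB c c' = S.addQ c c' := by
  have h0 := H.projB_zeroQ m 0
  -- The Eckmann–Hilton argument: the interchange law with the common zero of both structures in two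
  -- of the four places.
  have h := H.addB_addQ c (S.zeroQ ⟨m, 0⟩) (S.zeroQ ⟨m, 0⟩) c' hc hc'.symm
    (hb.trans h0.symm) (h0.trans hb'.symm)
  obtain ⟨u, rfl⟩ := Bundle.TotalSpace.exists_eq_mk hc
  obtain ⟨u', rfl⟩ := Bundle.TotalSpace.exists_eq_mk hc'
  have e1 : S.addQ ⟨⟨m, 0⟩, u⟩ (S.zeroQ ⟨m, 0⟩) = ⟨⟨m, 0⟩, u⟩ := by simp [zeroQ]
  have e2 : S.addQ (S.zeroQ ⟨m, 0⟩) ⟨⟨m, 0⟩, u'⟩ = ⟨⟨m, 0⟩, u'⟩ := by simp [zeroQ]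
  rw [e1, e2, H.zeroQ_zero] at h
  rw [h]
  obtain ⟨x, hx⟩ := S.exists_inB hb
  obtain ⟨x', hx'⟩ := S.exists_inB hb'
  rw [hx, hx', zeroB_eq_inB]
  simp

theorem exists_projQ_inB (b : TotalSpace FB B) (x : DB b) :
    ∃ q : Q b.proj, S.projQ (S.inB b x) = ⟨b.proj, q⟩ := by
  refine Bundle.TotalSpace.exists_eq_mk ?_
  rw [H.proj_comm, projB_inB]

end IsDoubleVectorBundle

end DoubleBundleSquare

namespace MetricDoubleVectorBundle

variable (𝔼 : MetricDoubleVectorBundle E FQ Q FB B FDQ DQ FDB DB)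

/-- The projection `D → Q` on the fibre of `D → B` over `b`, as a function. -/
def fiberQFun (b : TotalSpace FB B) (x : DB b) : Q b.proj :=
  (𝔼.isDoubleVectorBundle.exists_projQ_inB b x).choose

theorem projQ_inB_fun (b : TotalSpace FB B) (x : DB b) :
    𝔼.projQ (𝔼.inB b x) = ⟨b.proj, 𝔼.fiberQFun b x⟩ :=
  (𝔼.isDoubleVectorBundle.exists_projQ_inB b x).choose_spec

/-- The projection `D → Q` on the fibre of `D → B` over `b`. -/
def fiberQ (b : TotalSpace FB B) : DB b →ₗ[ℝ] Q b.proj where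
  toFun := 𝔼.fiberQFun b
  map_add' x y := by
    have h := 𝔼.projQ_inB_fun b (x + y)
    rw [← 𝔼.addB_inB, 𝔼.isDoubleVectorBundle.projQ_addB _ _ (by simp), projQ_inB_fun,
      projQ_inB_fun, Bundle.TotalSpace.fadd_mk] at h
    exact (eq_of_heq (Bundle.TotalSpace.mk.inj h).2).symm
  map_smul' r x := by
    have h := 𝔼.projQ_inB_fun b (r • x)
    rw [← 𝔼.smulB_inB, 𝔼.isDoubleVectorBundle.projQ_smulB, projQ_inB_fun,
      Bundle.TotalSpace.fsmul_mk] at h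
    exact (eq_of_heq (Bundle.TotalSpace.mk.inj h).2).symm

@[simp] theorem projQ_inB (b : TotalSpace FB B) (x : DB b) :
    𝔼.projQ (𝔼.inB b x) = ⟨b.proj, 𝔼.fiberQ b x⟩ := 𝔼.projQ_inB_fun b x

theorem fiberQ_eq_iff {m : M} {b : B m} {x : DB ⟨m, b⟩} {q : Q m} :
    𝔼.fiberQ ⟨m, b⟩ x = q ↔ 𝔼.projQ (𝔼.inB ⟨m, b⟩ x) = ⟨m, q⟩ := by
  rw [projQ_inB]
  simp

/-- The zero of the fibre of `D → Q` over `q`, as a vector of the fibre of `D → B` over zero. -/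
def zeroVec (m : M) (q : Q m) : DB ⟨m, 0⟩ :=
  (𝔼.exists_inB (𝔼.isDoubleVectorBundle.projB_zeroQ m q)).choose

theorem inB_zeroVec (m : M) (q : Q m) : 𝔼.inB ⟨m, 0⟩ (𝔼.zeroVec m q) = 𝔼.zeroQ ⟨m, q⟩ :=
  (𝔼.exists_inB (𝔼.isDoubleVectorBundle.projB_zeroQ m q)).choose_spec.symm

@[simp] theorem fiberQ_zeroVec (m : M) (q : Q m) :
    𝔼.fiberQ ⟨m, 0⟩ (𝔼.zeroVec m q) = q := by
  rw [fiberQ_eq_iff, inB_zeroVec]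
  rfl

/-- Multiplication by 0 over Q is additive for the structure over B, and its values are the zeros of
D → Q; so a sum over B of such zeros is again one, and its foot is q + q'. -/
theorem zeroVec_add (m : M) (q q' : Q m) :
    𝔼.zeroVec m (q + q') = 𝔼.zeroVec m q + 𝔼.zeroVec m q' := by
  have H := 𝔼.isDoubleVectorBundle
  have hp : 𝔼.projB (𝔼.zeroQ ⟨m, q⟩) = 𝔼.projB (𝔼.zeroQ ⟨m, q'⟩) := by
    rw [H.projB_zeroQ, H.projB_zeroQ]
  apply 𝔼.inB_injective
  rw [← 𝔼.addB_inB, inB_zeroVec, inB_zeroVec, inB_zeroVec]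
  have h := H.addB_smulQ 0 _ _ hp
  have e : ∀ d : TotalSpace FDQ DQ, 𝔼.smulQ 0 d = 𝔼.zeroQ d.proj := fun d => by
    simp [DoubleBundleSquare.smulQ, DoubleBundleSquare.zeroQ, Bundle.TotalSpace.fsmul]
  rw [e, e, e] at h
  refine (h.trans ?_).symm
  congr 1
  change 𝔼.projQ _ = _
  rw [H.projQ_addB _ _ hp]
  exact Bundle.TotalSpace.fadd_mk m q q'

theorem zeroVec_smul (m : M) (r : ℝ) (q : Q m) :
    𝔼.zeroVec m (r • q) = r • 𝔼.zeroVec m q := by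
  have H := 𝔼.isDoubleVectorBundle
  apply 𝔼.inB_injective
  rw [← 𝔼.smulB_inB, inB_zeroVec, inB_zeroVec]
  have h := H.smulB_smulQ r 0 (𝔼.zeroQ ⟨m, q⟩)
  have e : ∀ d : TotalSpace FDQ DQ, 𝔼.smulQ 0 d = 𝔼.zeroQ d.proj := fun d => by
    simp [DoubleBundleSquare.smulQ, DoubleBundleSquare.zeroQ, Bundle.TotalSpace.fsmul]
  rw [e, e] at h
  refine (h.trans ?_).symm
  congr 1
  change 𝔼.projQ _ = _
  rw [H.projQ_smulB]
  rfl

/-- `zeroVec` as a linear map. -/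
def zeroVecₗ (m : M) : Q m →ₗ[ℝ] DB ⟨m, 0⟩ where
  toFun := 𝔼.zeroVec m
  map_add' := 𝔼.zeroVec_add m
  map_smul' := 𝔼.zeroVec_smul m

/-- Homogeneity of the metric over Q with the scalar 0: both arguments are 0 times themselves. -/
theorem metric_zeroVec (m : M) (q q' : Q m) :
    𝔼.metric ⟨m, 0⟩ (𝔼.zeroVec m q) (𝔼.zeroVec m q') = 0 := by
  have H := 𝔼.isDoubleVectorBundle
  rw [← 𝔼.pairing_inB, inB_zeroVec, inB_zeroVec]
  have h := 𝔼.metric_smulQ 0 (𝔼.zeroQ ⟨m, q⟩) (𝔼.zeroQ ⟨m, q'⟩)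
    (by rw [H.projB_zeroQ, H.projB_zeroQ])
  simpa [DoubleBundleSquare.zeroQ] using h

/-- The kernel of `D → Q` on the fibres of `D → B` is isotropic. -/
theorem metric_ker {m : M} {b : B m} {k k' : DB ⟨m, b⟩} (hk : 𝔼.fiberQ ⟨m, b⟩ k = 0)
    (hk' : 𝔼.fiberQ ⟨m, b⟩ k' = 0) : 𝔼.metric ⟨m, b⟩ k k' = 0 := by
  have H := 𝔼.isDoubleVectorBundle
  rw [fiberQ_eq_iff] at hk hk'
  obtain ⟨z, hz⟩ := Bundle.TotalSpace.exists_eq_mk (H.projQ_zeroB m b)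
  have hzB : 𝔼.projB (⟨⟨m, 0⟩, z⟩ : TotalSpace FDQ DQ) = ⟨m, b⟩ := by
    rw [← hz, 𝔼.zeroB_eq_inB, 𝔼.projB_inB]
  -- A kernel vector and 0_b lie in the same fibre of D → Q, and their difference there projects to
  -- b − b = 0 in B, hence is a core element.
  have aux : ∀ x : DB ⟨m, b⟩, 𝔼.projQ (𝔼.inB ⟨m, b⟩ x) = ⟨m, 0⟩ → ∃ u : DQ ⟨m, 0⟩,
      𝔼.inB ⟨m, b⟩ x = 𝔼.addQ (𝔼.zeroB ⟨m, b⟩) ⟨⟨m, 0⟩, u⟩ ∧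
      𝔼.projB (⟨⟨m, 0⟩, u⟩ : TotalSpace FDQ DQ) = ⟨m, 0⟩ := by
    intro x hx
    obtain ⟨v, hv⟩ := Bundle.TotalSpace.exists_eq_mk hx
    refine ⟨v + (-1 : ℝ) • z, ?_, ?_⟩
    · rw [hv, hz]
      simp
    · rw [← 𝔼.addQ_mk, H.projB_addQ (⟨⟨m, 0⟩, v⟩ : TotalSpace FDQ DQ) ⟨⟨m, 0⟩, (-1 : ℝ) • z⟩ rfl,
        ← 𝔼.smulQ_mk, H.projB_smulQ, ← hv, hzB, 𝔼.projB_inB, Bundle.TotalSpace.fsmul_mk,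
        Bundle.TotalSpace.fadd_mk]
      simp
  obtain ⟨u, hu, huB⟩ := aux k hk
  obtain ⟨u', hu', huB'⟩ := aux k' hk'
  rw [← 𝔼.pairing_inB, hu, hu', 𝔼.metric_addQ _ _ _ _
    (H.projQ_zeroB m b) (H.projQ_zeroB m b) rfl (huB.trans huB'.symm),
    𝔼.zeroB_eq_inB, 𝔼.pairing_inB]
  -- For core elements u and u', doubling both arguments over B multiplies the pairing by 4,
  -- doubling both over Q multiplies it by 2, and on the core the two doublings coincide. So the
  -- pairing vanishes.
  have h4 := congrArg₂ (𝔼.pairing 𝔼.metric)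
    (H.addB_eq_addQ_of_core (c := ⟨⟨m, 0⟩, u⟩) (c' := ⟨⟨m, 0⟩, u⟩) rfl rfl huB huB)
    (H.addB_eq_addQ_of_core (c := ⟨⟨m, 0⟩, u'⟩) (c' := ⟨⟨m, 0⟩, u'⟩) rfl rfl huB' huB')
  rw [𝔼.metric_addQ (⟨⟨m, 0⟩, u⟩ : TotalSpace FDQ DQ) ⟨⟨m, 0⟩, u⟩ ⟨⟨m, 0⟩, u'⟩ ⟨⟨m, 0⟩, u'⟩
    rfl rfl (huB.trans huB'.symm) (huB.trans huB'.symm)] at h4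
  obtain ⟨x, hx⟩ := 𝔼.exists_inB huB
  obtain ⟨x', hx'⟩ := 𝔼.exists_inB huB'
  rw [hx, hx', 𝔼.addB_inB, 𝔼.addB_inB, 𝔼.pairing_inB, 𝔼.pairing_inB] at h4
  rw [hx, hx', 𝔼.pairing_inB]
  simp only [map_add, add_apply] at h4
  simp only [map_zero]
  linarith

/-- The metric as a bilinear form on a fibre of `D → B`. -/
def bilin (b : TotalSpace FB B) : LinearMap.BilinForm ℝ (DB b) :=
  LinearMap.mk₂ ℝ (fun x y => 𝔼.metric b x y) (by simp) (by simp) (by simp) (by simp)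

theorem bilin_nondegenerate (b : TotalSpace FB B) : (𝔼.bilin b).Nondegenerate := by
  refine ⟨fun x h => 𝔼.metric_nondegenerate b x h, fun x h => 𝔼.metric_nondegenerate b x ?_⟩
  intro y
  rw [𝔼.metric_symm]
  exact h y

end MetricDoubleVectorBundle

end DoubleBundleAlgebra
end

noncomputable section
-- The half-rank count, and core vectors representing covectors on Q.
section CoreVectors

variable {E : Type*} [NormedAddCommGroup E] [NormedSpace ℝ E]
  {M : Type*} [TopologicalSpace M] [ChartedSpace E M]
  {FQ : Type*} [NormedAddCommGroup FQ] [NormedSpace ℝ FQ]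
  {Q : M → Type*} [∀ m, AddCommGroup (Q m)] [∀ m, Module ℝ (Q m)]
  [TopologicalSpace (TotalSpace FQ Q)] [∀ m, TopologicalSpace (Q m)]
  [FiberBundle FQ Q] [VectorBundle ℝ FQ Q]
  {FB : Type*} [NormedAddCommGroup FB] [NormedSpace ℝ FB]
  {B : M → Type*} [∀ m, AddCommGroup (B m)] [∀ m, Module ℝ (B m)]
  [TopologicalSpace (TotalSpace FB B)] [∀ m, TopologicalSpace (B m)]
  [FiberBundle FB B] [VectorBundle ℝ FB B]
  {FDQ : Type*} [NormedAddCommGroup FDQ] [NormedSpace ℝ FDQ]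
  {DQ : TotalSpace FQ Q → Type*} [∀ q, AddCommGroup (DQ q)] [∀ q, Module ℝ (DQ q)]
  [TopologicalSpace (TotalSpace FDQ DQ)] [∀ q, TopologicalSpace (DQ q)]
  [FiberBundle FDQ DQ] [VectorBundle ℝ FDQ DQ]
  {FDB : Type*} [NormedAddCommGroup FDB] [NormedSpace ℝ FDB]
  {DB : TotalSpace FB B → Type*} [∀ b, AddCommGroup (DB b)] [∀ b, Module ℝ (DB b)]
  [TopologicalSpace (TotalSpace FDB DB)] [∀ b, TopologicalSpace (DB b)]
  [FiberBundle FDB DB] [VectorBundle ℝ FDB DB]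

/-- An isotropic subspace lies in its orthogonal, whose dimension is complementary by nondegeneracy.
-/
theorem LinearMap.BilinForm.two_mul_finrank_le_of_isotropic {V : Type*} [AddCommGroup V]
    [Module ℝ V] [FiniteDimensional ℝ V] {b : LinearMap.BilinForm ℝ V} (hb : b.Nondegenerate)
    (W : Submodule ℝ V) (hW : ∀ x ∈ W, ∀ y ∈ W, b x y = 0) :
    2 * Module.finrank ℝ W ≤ Module.finrank ℝ V := by
  have h1 := LinearMap.BilinForm.finrank_orthogonal hb W
  have h2 : W ≤ b.orthogonal W := fun x hx y hy => hW y hy x hx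
  have h3 := Submodule.finrank_mono h2
  have h4 := Submodule.finrank_le W
  omega

namespace MetricDoubleVectorBundle

variable (𝔼 : MetricDoubleVectorBundle E FQ Q FB B FDQ DQ FDB DB)
  [FiniteDimensional ℝ FQ] [FiniteDimensional ℝ FDB]

include 𝔼 in
-- The zeros 0_q embed Q_m as an isotropic subspace of the fibre over 0_m; `fiberQ` is a left
-- inverse of this embedding.
theorem two_mul_finrank_le (m : M) : 2 * Module.finrank ℝ FQ ≤ Module.finrank ℝ FDB := by
  have := VectorBundle.finiteDimensional ℝ FDB DB ⟨m, 0⟩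
  have hi : Function.Injective (𝔼.zeroVecₗ m) := fun q q' h => by
    have h' := congrArg (𝔼.fiberQ ⟨m, 0⟩) h
    simpa [zeroVecₗ] using h'
  have h := LinearMap.BilinForm.two_mul_finrank_le_of_isotropic (𝔼.bilin_nondegenerate ⟨m, 0⟩)
    (LinearMap.range (𝔼.zeroVecₗ m)) (by
      rintro _ ⟨q, rfl⟩ _ ⟨q', rfl⟩
      exact 𝔼.metric_zeroVec m q q')
  rwa [LinearMap.finrank_range_of_inj hi, VectorBundle.finrank_eq ℝ FQ Q,
    VectorBundle.finrank_eq ℝ FDB DB] at h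

/-- A squeeze. The isotropic kernel has at most half the dimension and the image at most rank Q, so
the dimension is at most 2 rank Q by rank-nullity; `two_mul_finrank_le` is the opposite bound, and
all inequalities become equalities. -/
theorem finrank_ker_fiberQ (b : TotalSpace FB B) :
    Module.finrank ℝ (LinearMap.ker (𝔼.fiberQ b)) = Module.finrank ℝ FQ ∧
    Module.finrank ℝ (LinearMap.range (𝔼.fiberQ b)) = Module.finrank ℝ FQ ∧
    2 * Module.finrank ℝ FQ = Module.finrank ℝ FDB := by
  have := VectorBundle.finiteDimensional ℝ FDB DB b
  have := VectorBundle.finiteDimensional ℝ FQ Q b.proj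
  have h := LinearMap.BilinForm.two_mul_finrank_le_of_isotropic (𝔼.bilin_nondegenerate b)
    (LinearMap.ker (𝔼.fiberQ b)) (fun x hx y hy =>
      𝔼.metric_ker (m := b.proj) (b := b.2) hx hy)
  have h1 := LinearMap.finrank_range_add_finrank_ker (𝔼.fiberQ b)
  have h2 := Submodule.finrank_le (LinearMap.range (𝔼.fiberQ b))
  have h3 := 𝔼.two_mul_finrank_le b.proj
  rw [VectorBundle.finrank_eq ℝ FDB DB] at h h1
  rw [VectorBundle.finrank_eq ℝ FQ Q] at h2
  omega

theorem fiberQ_surjective (b : TotalSpace FB B) : Function.Surjective (𝔼.fiberQ b) := by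
  have := VectorBundle.finiteDimensional ℝ FQ Q b.proj
  rw [← LinearMap.range_eq_top]
  apply Submodule.eq_top_of_finrank_eq
  rw [(𝔼.finrank_ker_fiberQ b).2.1, VectorBundle.finrank_eq ℝ FQ Q]

theorem orthogonal_ker_fiberQ (b : TotalSpace FB B) :
    (𝔼.bilin b).orthogonal (LinearMap.ker (𝔼.fiberQ b)) = LinearMap.ker (𝔼.fiberQ b) := by
  have := VectorBundle.finiteDimensional ℝ FDB DB b
  symm
  apply Submodule.eq_of_le_of_finrank_eq
  · exact fun x hx y hy => 𝔼.metric_ker (m := b.proj) (b := b.2) hy hx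
  · have h := 𝔼.finrank_ker_fiberQ b
    rw [LinearMap.BilinForm.finrank_orthogonal (𝔼.bilin_nondegenerate b),
      VectorBundle.finrank_eq ℝ FDB DB]
    omega

open Classical in
/-- The vector of the fibre of `D → B` over `b` that represents the pullback of a linear form on the
fibre of `Q`. -/
def coreVec (b : TotalSpace FB B) : (Q b.proj →ₗ[ℝ] ℝ) →ₗ[ℝ] DB b :=
  haveI := VectorBundle.finiteDimensional ℝ FDB DB b
  ((𝔼.bilin b).toDual (𝔼.bilin_nondegenerate b)).symm.toLinearMap ∘ₗ
    (LinearMap.lcomp ℝ ℝ (𝔼.fiberQ b))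

@[simp] theorem metric_coreVec (b : TotalSpace FB B) (τ : Q b.proj →ₗ[ℝ] ℝ) (x : DB b) :
    𝔼.metric b (𝔼.coreVec b τ) x = τ (𝔼.fiberQ b x) := by
  have := VectorBundle.finiteDimensional ℝ FDB DB b
  exact LinearMap.BilinForm.apply_toDual_symm_apply (hB := 𝔼.bilin_nondegenerate b) _ x

theorem eq_coreVec {b : TotalSpace FB B} {τ : Q b.proj →ₗ[ℝ] ℝ} {k : DB b}
    (h : ∀ x, 𝔼.metric b k x = τ (𝔼.fiberQ b x)) : k = 𝔼.coreVec b τ := by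
  refine sub_eq_zero.1 (𝔼.metric_nondegenerate b _ fun x => ?_)
  simp [h]

@[simp] theorem fiberQ_coreVec (b : TotalSpace FB B) (τ : Q b.proj →ₗ[ℝ] ℝ) :
    𝔼.fiberQ b (𝔼.coreVec b τ) = 0 := by
  have h : 𝔼.coreVec b τ ∈ (𝔼.bilin b).orthogonal (LinearMap.ker (𝔼.fiberQ b)) := by
    intro y hy
    change 𝔼.metric b y _ = 0
    rw [𝔼.metric_symm, metric_coreVec,
      LinearMap.mem_ker.1 hy, map_zero]
  rw [orthogonal_ker_fiberQ] at h
  exact h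

section Smooth

variable {EN : Type*} [NormedAddCommGroup EN] [NormedSpace ℝ EN]
  {HN : Type*} [TopologicalSpace HN] {IN : ModelWithCorners ℝ EN HN}
  {N : Type*} [TopologicalSpace N] [ChartedSpace HN N] {x₀ : N} {β : N → TotalSpace FB B}

theorem contMDiffAt_inB {x : ∀ y, DB (β y)}
    (hx : ContMDiffAt IN ((𝓘(ℝ, E).prod 𝓘(ℝ, FB)).prod 𝓘(ℝ, FDB)) ∞
      (fun y => (⟨β y, x y⟩ : TotalSpace FDB DB)) x₀) :
    ContMDiffAt IN ((𝓘(ℝ, E).prod 𝓘(ℝ, FQ)).prod 𝓘(ℝ, FDQ)) ∞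
      (fun y => 𝔼.inB (β y) (x y)) x₀ :=
  𝔼.swap.symm.contMDiff.contMDiffAt.comp x₀ hx

theorem contMDiffAt_of_inB {x : ∀ y, DB (β y)}
    (hx : ContMDiffAt IN ((𝓘(ℝ, E).prod 𝓘(ℝ, FQ)).prod 𝓘(ℝ, FDQ)) ∞
      (fun y => 𝔼.inB (β y) (x y)) x₀) :
    ContMDiffAt IN ((𝓘(ℝ, E).prod 𝓘(ℝ, FB)).prod 𝓘(ℝ, FDB)) ∞
      (fun y => (⟨β y, x y⟩ : TotalSpace FDB DB)) x₀ := by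
  have h := 𝔼.swap.contMDiff.contMDiffAt.comp x₀ hx
  simpa [Function.comp_def] using h

theorem contMDiffAt_fiberQ {x : ∀ y, DB (β y)}
    (hx : ContMDiffAt IN ((𝓘(ℝ, E).prod 𝓘(ℝ, FB)).prod 𝓘(ℝ, FDB)) ∞
      (fun y => (⟨β y, x y⟩ : TotalSpace FDB DB)) x₀) :
    ContMDiffAt IN (𝓘(ℝ, E).prod 𝓘(ℝ, FQ)) ∞
      (fun y => (⟨(β y).proj, 𝔼.fiberQ (β y) (x y)⟩ : TotalSpace FQ Q)) x₀ := by
  have h := (contMDiff_proj DQ).contMDiffAt.comp x₀ (𝔼.contMDiffAt_inB hx)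
  refine h.congr_of_eventuallyEq (Filter.Eventually.of_forall fun y => ?_)
  exact (𝔼.projQ_inB (β y) (x y)).symm

variable [ContMDiffVectorBundle ∞ FDB DB (𝓘(ℝ, E).prod 𝓘(ℝ, FB))]

theorem contMDiffAt_metric {x x' : ∀ y, DB (β y)}
    (hx : ContMDiffAt IN ((𝓘(ℝ, E).prod 𝓘(ℝ, FB)).prod 𝓘(ℝ, FDB)) ∞
      (fun y => (⟨β y, x y⟩ : TotalSpace FDB DB)) x₀)
    (hx' : ContMDiffAt IN ((𝓘(ℝ, E).prod 𝓘(ℝ, FB)).prod 𝓘(ℝ, FDB)) ∞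
      (fun y => (⟨β y, x' y⟩ : TotalSpace FDB DB)) x₀) :
    ContMDiffAt IN 𝓘(ℝ, ℝ) ∞ (fun y => 𝔼.metric (β y) (x y) (x' y)) x₀ := by
  have hb := contMDiffAt_proj_along hx
  have : ContMDiffAt IN ((𝓘(ℝ, E).prod 𝓘(ℝ, FB)).prod 𝓘(ℝ)) ∞
      (fun y ↦ TotalSpace.mk' ℝ (E := Bundle.Trivial (TotalSpace FB B) ℝ) (β y)
        (𝔼.metric (β y) (x y) (x' y))) x₀ := by
    apply ContMDiffAt.clm_bundle_apply₂ (F₁ := FDB) (F₂ := FDB)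
    · exact ContMDiffAt.comp x₀ 𝔼.metric_smooth.contMDiffAt hb
    · exact hx
    · exact hx'
  simp only [contMDiffAt_totalSpace] at this
  exact this.2

theorem contMDiffAt_symmL_const (hβ : ContMDiffAt IN (𝓘(ℝ, E).prod 𝓘(ℝ, FB)) ∞ β x₀)
    (e : Trivialization FDB (π FDB DB)) [MemTrivializationAtlas e] (he : β x₀ ∈ e.baseSet)
    (v : FDB) :
    ContMDiffAt IN ((𝓘(ℝ, E).prod 𝓘(ℝ, FB)).prod 𝓘(ℝ, FDB)) ∞
      (fun y => (⟨β y, e.symmₗ ℝ (β y) v⟩ : TotalSpace FDB DB)) x₀ := by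
  refine (contMDiffAt_symm_along e hβ (contMDiffAt_const (c := v)) he).congr_of_eventuallyEq ?_
  filter_upwards [hβ.continuousAt.preimage_mem_nhds (e.open_baseSet.mem_nhds he)] with y hy
  rw [e.coe_symmₗ hy]

/-- The metric in a trivialization of `D → B`. -/
def metricCoord (e : Trivialization FDB (π FDB DB)) [MemTrivializationAtlas e]
    (b : TotalSpace FB B) : FDB →L[ℝ] FDB →L[ℝ] ℝ :=
  LinearMap.toContinuousLinearMap ((LinearMap.toContinuousLinearMap (𝕜 := ℝ) (E := FDB)
    (F' := ℝ)).toLinearMap ∘ₗ (𝔼.bilin b).compl₁₂ (e.symmₗ ℝ b) (e.symmₗ ℝ b))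

theorem metricCoord_apply (e : Trivialization FDB (π FDB DB)) [MemTrivializationAtlas e]
    (b : TotalSpace FB B) (v w : FDB) :
    𝔼.metricCoord e b v w = 𝔼.metric b (e.symmₗ ℝ b v) (e.symmₗ ℝ b w) := rfl

theorem metricCoord_bijective (e : Trivialization FDB (π FDB DB)) [MemTrivializationAtlas e]
    {b : TotalSpace FB B} (hb : b ∈ e.baseSet) : Function.Bijective (𝔼.metricCoord e b) := by
  have := VectorBundle.finiteDimensional ℝ FDB DB b
  constructor
  · intro v w h
    have h0 : e.symmₗ ℝ b v - e.symmₗ ℝ b w = 0 := by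
      refine 𝔼.metric_nondegenerate b _ fun x => ?_
      have hx : e.symmₗ ℝ b (e.linearMapAt ℝ b x) = x := e.symmₗ_linearMapAt hb x
      have h' := DFunLike.congr_fun h (e.linearMapAt ℝ b x)
      rw [metricCoord_apply, metricCoord_apply, hx] at h'
      rw [map_sub, sub_apply, h', sub_self]
    have h1 := congrArg (e.linearMapAt ℝ b) (sub_eq_zero.1 h0)
    rwa [e.linearMapAt_symmₗ hb, e.linearMapAt_symmₗ hb] at h1
  · intro θ
    -- The fibre vector that represents `θ` under the metric; its coordinates are the required
    -- preimage.
    let z := ((𝔼.bilin b).toDual (𝔼.bilin_nondegenerate b)).symm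
      (θ.toLinearMap ∘ₗ e.linearMapAt ℝ b)
    refine ⟨e.linearMapAt ℝ b z, ?_⟩
    ext w
    have hz := LinearMap.BilinForm.apply_toDual_symm_apply (hB := 𝔼.bilin_nondegenerate b)
      (θ.toLinearMap ∘ₗ e.linearMapAt ℝ b) (e.symmₗ ℝ b w)
    rw [metricCoord_apply, e.symmₗ_linearMapAt hb]
    refine hz.trans ?_
    simp [e.linearMapAt_symmₗ hb]

/-- In a trivialization the core vector is G⁻¹θ, with G the metric as a map from the model fibre to
its dual and θ the pulled-back covector. Both are smooth because they are so on fixed vectors, and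
inversion is smooth at an isomorphism. The hypothesis on `τ` allows arbitrary test sections because
the projected frame vectors are neither constant nor a frame of Q. -/
theorem contMDiffAt_coreVec (hβ : ContMDiffAt IN (𝓘(ℝ, E).prod 𝓘(ℝ, FB)) ∞ β x₀)
    {τ : ∀ y, Q (β y).proj →ₗ[ℝ] ℝ}
    (hτ : ∀ s : ∀ y, Q (β y).proj, ContMDiffAt IN (𝓘(ℝ, E).prod 𝓘(ℝ, FQ)) ∞
      (fun y => (⟨(β y).proj, s y⟩ : TotalSpace FQ Q)) x₀ →
      ContMDiffAt IN 𝓘(ℝ, ℝ) ∞ (fun y => τ y (s y)) x₀) :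
    ContMDiffAt IN ((𝓘(ℝ, E).prod 𝓘(ℝ, FB)).prod 𝓘(ℝ, FDB)) ∞
      (fun y => (⟨β y, 𝔼.coreVec (β y) (τ y)⟩ : TotalSpace FDB DB)) x₀ := by
  let e := trivializationAt FDB DB (β x₀)
  have he : β x₀ ∈ e.baseSet := mem_baseSet_trivializationAt FDB DB (β x₀)
  let θ : N → FDB →L[ℝ] ℝ := fun y => LinearMap.toContinuousLinearMap
    (τ y ∘ₗ 𝔼.fiberQ (β y) ∘ₗ e.symmₗ ℝ (β y))
  have hθ : ContMDiffAt IN 𝓘(ℝ, FDB →L[ℝ] ℝ) ∞ θ x₀ := contMDiffAt_clm_of_apply fun v =>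
    hτ _ (𝔼.contMDiffAt_fiberQ (contMDiffAt_symmL_const hβ e he v))
  have hG : ContMDiffAt IN 𝓘(ℝ, FDB →L[ℝ] FDB →L[ℝ] ℝ) ∞ (fun y => 𝔼.metricCoord e (β y)) x₀ :=
    contMDiffAt_clm_of_apply fun v => contMDiffAt_clm_of_apply fun w =>
      𝔼.contMDiffAt_metric (contMDiffAt_symmL_const hβ e he v)
        (contMDiffAt_symmL_const hβ e he w)
  have hE : ∀ b ∈ e.baseSet, ∃ L : FDB ≃L[ℝ] (FDB →L[ℝ] ℝ), 𝔼.metricCoord e b = L := by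
    intro b hb
    refine ⟨(LinearEquiv.ofBijective (𝔼.metricCoord e b).toLinearMap
      (𝔼.metricCoord_bijective e hb)).toContinuousLinearEquiv, ?_⟩
    ext v
    rfl
  obtain ⟨L₀, hL₀⟩ := hE _ he
  refine contMDiffAt_totalSpace.2 ⟨hβ, ((contMDiffAt_clm_inverse hG L₀ hL₀).clm_apply
    hθ).congr_of_eventuallyEq ?_⟩
  filter_upwards [hβ.continuousAt.preimage_mem_nhds (e.open_baseSet.mem_nhds he)] with y hy
  obtain ⟨L, hL⟩ := hE _ hy
  rw [hL, ContinuousLinearMap.inverse_equiv]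
  refine (L.symm_apply_eq.2 ?_).symm
  change _ = (L : FDB →L[ℝ] FDB →L[ℝ] ℝ) _
  rw [← hL]
  ext w
  have h1 : e.symmₗ ℝ (β y) (e ⟨β y, 𝔼.coreVec (β y) (τ y)⟩).2 = 𝔼.coreVec (β y) (τ y) := by
    rw [e.coe_symmₗ hy]
    exact e.symm_apply_apply_mk hy _
  change τ y (𝔼.fiberQ (β y) (e.symmₗ ℝ (β y) w)) = 𝔼.metricCoord e (β y) _ w
  rw [metricCoord_apply, h1, metric_coreVec]

end Smooth

end MetricDoubleVectorBundle

end CoreVectors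
end

noncomputable section
-- Isotropic linear maps over one point of M, and their linear structure.
section IsotropicFibres

variable {E : Type*} [NormedAddCommGroup E] [NormedSpace ℝ E]
  {M : Type*} [TopologicalSpace M] [ChartedSpace E M]
  {FQ : Type*} [NormedAddCommGroup FQ] [NormedSpace ℝ FQ]
  {Q : M → Type*} [∀ m, AddCommGroup (Q m)] [∀ m, Module ℝ (Q m)]
  [TopologicalSpace (TotalSpace FQ Q)] [∀ m, TopologicalSpace (Q m)]
  [FiberBundle FQ Q] [VectorBundle ℝ FQ Q]
  {FB : Type*} [NormedAddCommGroup FB] [NormedSpace ℝ FB]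
  {B : M → Type*} [∀ m, AddCommGroup (B m)] [∀ m, Module ℝ (B m)]
  [TopologicalSpace (TotalSpace FB B)] [∀ m, TopologicalSpace (B m)]
  [FiberBundle FB B] [VectorBundle ℝ FB B]
  {FDQ : Type*} [NormedAddCommGroup FDQ] [NormedSpace ℝ FDQ]
  {DQ : TotalSpace FQ Q → Type*} [∀ q, AddCommGroup (DQ q)] [∀ q, Module ℝ (DQ q)]
  [TopologicalSpace (TotalSpace FDQ DQ)] [∀ q, TopologicalSpace (DQ q)]
  [FiberBundle FDQ DQ] [VectorBundle ℝ FDQ DQ]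
  {FDB : Type*} [NormedAddCommGroup FDB] [NormedSpace ℝ FDB]
  {DB : TotalSpace FB B → Type*} [∀ b, AddCommGroup (DB b)] [∀ b, Module ℝ (DB b)]
  [TopologicalSpace (TotalSpace FDB DB)] [∀ b, TopologicalSpace (DB b)]
  [FiberBundle FDB DB] [VectorBundle ℝ FDB DB]

open Classical in
/-- The vector in the fibre of a bundle over `x` given by a point of the total space over `x`. -/
def Bundle.TotalSpace.fiberAt {X F : Type*} {V : X → Type*} [∀ x, AddCommGroup (V x)] (x : X)
    (d : TotalSpace F V) : V x := if h : d.proj = x then h ▸ d.2 else 0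

theorem Bundle.TotalSpace.mk_fiberAt {X F : Type*} {V : X → Type*} [∀ x, AddCommGroup (V x)]
    {x : X} {d : TotalSpace F V} (h : d.proj = x) :
    (⟨x, Bundle.TotalSpace.fiberAt x d⟩ : TotalSpace F V) = d := by
  subst h
  simp [Bundle.TotalSpace.fiberAt]

namespace MetricDoubleVectorBundle

variable (𝔼 : MetricDoubleVectorBundle E FQ Q FB B FDQ DQ FDB DB)

/-- `χ` is a linear isotropic map from `Q_m` to the fibre of `D → B` over `b` that is a right inverse
of the projection to `Q`. -/
structure IsIsotropicAt (m : M) (χ : ∀ q : Q m, DQ ⟨m, q⟩) (b : B m) : Prop where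
  projB : ∀ q, 𝔼.projB ⟨⟨m, q⟩, χ q⟩ = ⟨m, b⟩
  map_add : ∀ q q', (⟨⟨m, q + q'⟩, χ (q + q')⟩ : TotalSpace FDQ DQ) =
    𝔼.addB ⟨⟨m, q⟩, χ q⟩ ⟨⟨m, q'⟩, χ q'⟩
  map_smul : ∀ (r : ℝ) q, (⟨⟨m, r • q⟩, χ (r • q)⟩ : TotalSpace FDQ DQ) =
    𝔼.smulB r ⟨⟨m, q⟩, χ q⟩
  isotropic : ∀ q q', 𝔼.pairing 𝔼.metric ⟨⟨m, q⟩, χ q⟩ ⟨⟨m, q'⟩, χ q'⟩ = 0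

variable {𝔼} {m : M} {χ χ' : ∀ q : Q m, DQ ⟨m, q⟩} {b b' : B m}

theorem IsIsotropicAt.of_linear (h : Q m →ₗ[ℝ] DB ⟨m, b⟩)
    (hχ : ∀ q, (⟨⟨m, q⟩, χ q⟩ : TotalSpace FDQ DQ) = 𝔼.inB ⟨m, b⟩ (h q))
    (hi : ∀ q q', 𝔼.metric ⟨m, b⟩ (h q) (h q') = 0) : 𝔼.IsIsotropicAt m χ b where
  projB q := by rw [hχ, 𝔼.projB_inB]
  map_add q q' := by rw [hχ, hχ, hχ, 𝔼.addB_inB, _root_.map_add]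
  map_smul r q := by rw [hχ, hχ, 𝔼.smulB_inB, _root_.map_smul]
  isotropic q q' := by rw [hχ, hχ, 𝔼.pairing_inB, hi]

/-- With `of_linear`, the dictionary that replaces the operations on D by linear algebra in the
single vector space `DB ⟨m, b⟩`. -/
theorem IsIsotropicAt.exists_linear (h : 𝔼.IsIsotropicAt m χ b) :
    ∃ f : Q m →ₗ[ℝ] DB ⟨m, b⟩,
      (∀ q, (⟨⟨m, q⟩, χ q⟩ : TotalSpace FDQ DQ) = 𝔼.inB ⟨m, b⟩ (f q)) ∧
      (∀ q, 𝔼.fiberQ ⟨m, b⟩ (f q) = q) ∧ ∀ q q', 𝔼.metric ⟨m, b⟩ (f q) (f q') = 0 := by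
  choose f hf using fun q => 𝔼.exists_inB (h.projB q)
  refine ⟨⟨⟨f, fun q q' => 𝔼.inB_injective _ ?_⟩, fun r q => 𝔼.inB_injective _ ?_⟩, hf,
    fun q => ?_, fun q q' => ?_⟩
  · rw [← hf, h.map_add, hf, hf, 𝔼.addB_inB]
  · change 𝔼.inB _ (f (r • q)) = 𝔼.inB _ (r • f q)
    rw [← hf, h.map_smul, hf, 𝔼.smulB_inB]
  · exact 𝔼.fiberQ_eq_iff.2 (by
      change 𝔼.projQ (𝔼.inB _ (f q)) = _
      rw [← hf]
      rfl)
  · have h' := h.isotropic q q'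
    rwa [hf, hf, 𝔼.pairing_inB] at h'

/-- Isotropy, a quadratic condition in a fibre of D → B, is additive here: the sum is taken over Q,
where the metric is additive in both arguments simultaneously, so no cross terms appear. Linearity
survives by the interchange laws. -/
theorem IsIsotropicAt.add (h : 𝔼.IsIsotropicAt m χ b) (h' : 𝔼.IsIsotropicAt m χ' b') :
    𝔼.IsIsotropicAt m (χ + χ') (b + b') := by
  have H := 𝔼.isDoubleVectorBundle
  have key : ∀ q, (⟨⟨m, q⟩, (χ + χ') q⟩ : TotalSpace FDQ DQ) =
      𝔼.addQ ⟨⟨m, q⟩, χ q⟩ ⟨⟨m, q⟩, χ' q⟩ := fun q => (𝔼.addQ_mk _ _ _).symm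
  refine ⟨fun q => ?_, fun q q' => ?_, fun r q => ?_, fun q q' => ?_⟩
  · rw [key, H.projB_addQ (⟨⟨m, q⟩, χ q⟩ : TotalSpace FDQ DQ) ⟨⟨m, q⟩, χ' q⟩ rfl, h.projB,
      h'.projB, Bundle.TotalSpace.fadd_mk]
  · rw [key, key, key, H.addB_addQ (⟨⟨m, q⟩, χ q⟩ : TotalSpace FDQ DQ) ⟨⟨m, q⟩, χ' q⟩
      ⟨⟨m, q'⟩, χ q'⟩ ⟨⟨m, q'⟩, χ' q'⟩ rfl rfl ((h.projB q).trans (h.projB q').symm)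
      ((h'.projB q).trans (h'.projB q').symm), h.map_add, h'.map_add]
  · rw [key, key, H.smulB_addQ r (⟨⟨m, q⟩, χ q⟩ : TotalSpace FDQ DQ) ⟨⟨m, q⟩, χ' q⟩ rfl,
      h.map_smul, h'.map_smul]
  · rw [key, key, 𝔼.metric_addQ (⟨⟨m, q⟩, χ q⟩ : TotalSpace FDQ DQ) ⟨⟨m, q⟩, χ' q⟩
      ⟨⟨m, q'⟩, χ q'⟩ ⟨⟨m, q'⟩, χ' q'⟩ rfl rfl ((h.projB q).trans (h.projB q').symm)
      ((h'.projB q).trans (h'.projB q').symm), h.isotropic, h'.isotropic, add_zero]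

theorem IsIsotropicAt.smul (r : ℝ) (h : 𝔼.IsIsotropicAt m χ b) :
    𝔼.IsIsotropicAt m (r • χ) (r • b) := by
  have H := 𝔼.isDoubleVectorBundle
  have key : ∀ q, (⟨⟨m, q⟩, (r • χ) q⟩ : TotalSpace FDQ DQ) =
      𝔼.smulQ r ⟨⟨m, q⟩, χ q⟩ := fun q => (𝔼.smulQ_mk _ _ _).symm
  refine ⟨fun q => ?_, fun q q' => ?_, fun s q => ?_, fun q q' => ?_⟩
  · rw [key, H.projB_smulQ, h.projB, Bundle.TotalSpace.fsmul_mk]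
  · rw [key, key, key, H.addB_smulQ _ _ _ ((h.projB q).trans (h.projB q').symm), h.map_add]
  · rw [key, key, H.smulB_smulQ, h.map_smul]
  · rw [key, key, 𝔼.metric_smulQ _ _ _ ((h.projB q).trans (h.projB q').symm), h.isotropic,
      mul_zero]

theorem isIsotropicAt_zero : 𝔼.IsIsotropicAt m 0 0 :=
  IsIsotropicAt.of_linear (𝔼.zeroVecₗ m) (fun q => (𝔼.inB_zeroVec m q).symm)
    (𝔼.metric_zeroVec m)

theorem IsIsotropicAt.base_unique (h : 𝔼.IsIsotropicAt m χ b) (h' : 𝔼.IsIsotropicAt m χ b') :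
    b = b' := by
  have h1 := (h.projB 0).symm.trans (h'.projB 0)
  simpa using h1

variable (𝔼 m) in
/-- The pairs of a base vector and an isotropic linear map over it. -/
def isotropicFiber : Submodule ℝ ((∀ q : Q m, DQ ⟨m, q⟩) × B m) where
  carrier := {x | 𝔼.IsIsotropicAt m x.1 x.2}
  add_mem' h h' := h.add h'
  zero_mem' := isIsotropicAt_zero
  smul_mem' r _ h := h.smul r

theorem IsIsotropicAt.sum {κ : Type*} (A : Finset κ) {χ : κ → ∀ q : Q m, DQ ⟨m, q⟩}
    {b : κ → B m} (h : ∀ i ∈ A, 𝔼.IsIsotropicAt m (χ i) (b i)) :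
    𝔼.IsIsotropicAt m (∑ i ∈ A, χ i) (∑ i ∈ A, b i) := by
  have h1 : ∑ i ∈ A, (χ i, b i) ∈ 𝔼.isotropicFiber m := Submodule.sum_mem _ h
  have h2 : ∑ i ∈ A, (χ i, b i) = (∑ i ∈ A, χ i, ∑ i ∈ A, b i) := by
    ext
    · simp [Prod.fst_sum]
    · simp [Prod.snd_sum]
  rwa [h2] at h1

variable (𝔼) in
-- Reduces membership to smoothness and a condition at each point. Smoothness of the base section
-- need not be required: it is the projection to B of χ along the zero section of Q.
theorem mem_isotropicSections_iff {U : Opens M} {χ : ∀ q : opensOver (F := FQ) Q U, DQ q} :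
    χ ∈ 𝔼.isotropicSections U ↔
      χ ∈ smoothSections (𝓘(ℝ, E).prod 𝓘(ℝ, FQ)) FDQ DQ (opensOver Q U) ∧
      ∃ b : ∀ m : U, B m, ∀ m : U, 𝔼.IsIsotropicAt m (fun q => χ ⟨⟨m, q⟩, m.2⟩) (b m) := by
  constructor
  · rintro ⟨⟨hs, b, -, hl⟩, hi⟩
    exact ⟨hs, b, fun m => ⟨hl.projB m, hl.map_add m, hl.map_smul m, hi m⟩⟩
  · rintro ⟨hs, b, hb⟩
    have hz : ContMDiff 𝓘(ℝ, E) (𝓘(ℝ, E).prod 𝓘(ℝ, FQ)) ∞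
        (fun m : U => (⟨⟨m, 0⟩, m.2⟩ : opensOver (F := FQ) Q U)) := by
      rw [← ContMDiff.subtypeVal_comp_iff]
      exact contMDiff_zero_along contMDiff_subtype_val
    have hsmooth : ContMDiff 𝓘(ℝ, E) (𝓘(ℝ, E).prod 𝓘(ℝ, FB)) ∞
        (fun m : U => (⟨m, b m⟩ : TotalSpace FB B)) := by
      have h := (contMDiff_proj (n := ∞) DB).comp (𝔼.swap.contMDiff.comp (hs.comp hz))
      refine h.congr fun m => ?_
      exact ((hb m).projB 0).symm
    exact ⟨⟨hs, b, hsmooth, fun m => (hb m).projB, fun m => (hb m).map_add,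
      fun m => (hb m).map_smul⟩, fun m => (hb m).isotropic⟩

theorem isIsotropicAt_section {U : Opens M} (χ : 𝔼.isotropicSections U) (m : U) :
    𝔼.IsIsotropicAt m (fun q => χ.1 ⟨⟨m, q⟩, m.2⟩) ((𝔼.isotropicBase U χ).1 m) := by
  obtain ⟨-, b, hb⟩ := (𝔼.mem_isotropicSections_iff).1 χ.2
  have h : b m = (𝔼.isotropicBase U χ).1 m := by
    have h' := ((hb m).projB 0).symm.trans (𝔼.projB_sectionValue χ m 0)
    simpa using h'
  exact h ▸ hb m

end MetricDoubleVectorBundle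

end IsotropicFibres

/-! ### Smooth isotropic lifts of local sections of B. -/

section LocalLift

variable {E : Type*} [NormedAddCommGroup E] [NormedSpace ℝ E]
  {M : Type*} [TopologicalSpace M] [ChartedSpace E M]
  {FQ : Type*} [NormedAddCommGroup FQ] [NormedSpace ℝ FQ]
  {Q : M → Type*} [∀ m, AddCommGroup (Q m)] [∀ m, Module ℝ (Q m)]
  [TopologicalSpace (TotalSpace FQ Q)] [∀ m, TopologicalSpace (Q m)]
  [FiberBundle FQ Q] [VectorBundle ℝ FQ Q]
  {FB : Type*} [NormedAddCommGroup FB] [NormedSpace ℝ FB]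
  {B : M → Type*} [∀ m, AddCommGroup (B m)] [∀ m, Module ℝ (B m)]
  [TopologicalSpace (TotalSpace FB B)] [∀ m, TopologicalSpace (B m)]
  [FiberBundle FB B] [VectorBundle ℝ FB B]
  {FDQ : Type*} [NormedAddCommGroup FDQ] [NormedSpace ℝ FDQ]
  {DQ : TotalSpace FQ Q → Type*} [∀ q, AddCommGroup (DQ q)] [∀ q, Module ℝ (DQ q)]
  [TopologicalSpace (TotalSpace FDQ DQ)] [∀ q, TopologicalSpace (DQ q)]
  [FiberBundle FDQ DQ] [VectorBundle ℝ FDQ DQ]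
  {FDB : Type*} [NormedAddCommGroup FDB] [NormedSpace ℝ FDB]
  {DB : TotalSpace FB B → Type*} [∀ b, AddCommGroup (DB b)] [∀ b, Module ℝ (DB b)]
  [TopologicalSpace (TotalSpace FDB DB)] [∀ b, TopologicalSpace (DB b)]
  [FiberBundle FDB DB] [VectorBundle ℝ FDB DB]

variable [FiniteDimensional ℝ FQ] [FiniteDimensional ℝ FDB]
  [ContMDiffVectorBundle ∞ FQ Q 𝓘(ℝ, E)]
  [ContMDiffVectorBundle ∞ FDB DB (𝓘(ℝ, E).prod 𝓘(ℝ, FB))]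

namespace MetricDoubleVectorBundle

variable (𝔼 : MetricDoubleVectorBundle E FQ Q FB B FDQ DQ FDB DB)

/-- A right inverse `f` of `D → Q` on a fibre of `D → B`, made isotropic. -/
def isotropize {m : M} {b : B m} (f : Q m →ₗ[ℝ] DB ⟨m, b⟩) : Q m →ₗ[ℝ] DB ⟨m, b⟩ :=
  f + (-(1 / 2) : ℝ) • (𝔼.coreVec ⟨m, b⟩ ∘ₗ (𝔼.bilin ⟨m, b⟩).compl₁₂ f f)

variable {m : M} {b : B m} {f : Q m →ₗ[ℝ] DB ⟨m, b⟩}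

theorem isotropize_apply (q : Q m) : 𝔼.isotropize f q =
    f q + (-(1 / 2) : ℝ) • 𝔼.coreVec ⟨m, b⟩ ((𝔼.bilin ⟨m, b⟩).compl₁₂ f f q) := rfl

theorem fiberQ_isotropize (hf : ∀ q, 𝔼.fiberQ ⟨m, b⟩ (f q) = q) (q : Q m) :
    𝔼.fiberQ ⟨m, b⟩ (𝔼.isotropize f q) = q := by
  rw [isotropize_apply, map_add, map_smul, fiberQ_coreVec, hf, smul_zero, add_zero]

/-- Let g(q, q') = ⟨f(q), f(q')⟩. Each of the two cross terms with a core vector contributes −g(q,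
q')/2, by symmetry of g, and two core vectors pair to zero, so g is cancelled exactly. -/
theorem metric_isotropize (hf : ∀ q, 𝔼.fiberQ ⟨m, b⟩ (f q) = q) (q q' : Q m) :
    𝔼.metric ⟨m, b⟩ (𝔼.isotropize f q) (𝔼.isotropize f q') = 0 := by
  have h1 : ∀ q q', 𝔼.metric ⟨m, b⟩ (f q) (𝔼.coreVec ⟨m, b⟩
      ((𝔼.bilin ⟨m, b⟩).compl₁₂ f f q')) = 𝔼.metric ⟨m, b⟩ (f q') (f q) := by
    intro q q'
    rw [𝔼.metric_symm, metric_coreVec, hf]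
    rfl
  have h2 : ∀ q q', 𝔼.metric ⟨m, b⟩ (𝔼.coreVec ⟨m, b⟩
      ((𝔼.bilin ⟨m, b⟩).compl₁₂ f f q)) (f q') = 𝔼.metric ⟨m, b⟩ (f q) (f q') := by
    intro q q'
    rw [metric_coreVec, hf]
    rfl
  rw [isotropize_apply, isotropize_apply]
  simp only [map_add, map_smul, add_apply, smul_apply, h1, h2, metric_coreVec, fiberQ_coreVec,
    map_zero, smul_eq_mul]
  rw [𝔼.metric_symm _ (f q') (f q)]
  ring

/-- Surjectivity of the projection to Q at `p` gives a right inverse there. It persists nearby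
because invertible operators form an open set, and `isotropize` then makes it isotropic without
losing smoothness. -/
theorem exists_local_lift (p : M) (s : ∀ m, B m)
    (hs : ∀ᶠ m in nhds p, ContMDiffAt 𝓘(ℝ, E) (𝓘(ℝ, E).prod 𝓘(ℝ, FB)) ∞
      (fun m => (⟨m, s m⟩ : TotalSpace FB B)) m) :
    ∃ χ : ∀ q : TotalSpace FQ Q, DQ q, ∀ᶠ m in nhds p,
      𝔼.IsIsotropicAt m (fun q => χ ⟨m, q⟩) (s m) ∧
      ∀ q : Q m, ContMDiffAt (𝓘(ℝ, E).prod 𝓘(ℝ, FQ)) ((𝓘(ℝ, E).prod 𝓘(ℝ, FQ)).prod 𝓘(ℝ, FDQ)) ∞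
        (fun q => (⟨q, χ q⟩ : TotalSpace FDQ DQ)) ⟨m, q⟩ := by
  have := FiniteDimensional.complete ℝ FQ
  let e := trivializationAt FDB DB ⟨p, s p⟩
  let eQ := trivializationAt FQ Q p
  let P : M → FDB →L[ℝ] FQ := fun m => LinearMap.toContinuousLinearMap
    (eQ.linearMapAt ℝ m ∘ₗ 𝔼.fiberQ ⟨m, s m⟩ ∘ₗ e.symmₗ ℝ ⟨m, s m⟩)
  have hep : (⟨p, s p⟩ : TotalSpace FB B) ∈ e.baseSet := mem_baseSet_trivializationAt FDB DB _
  have heQp : p ∈ eQ.baseSet := mem_baseSet_trivializationAt FQ Q p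
  have hPp : Function.Surjective (P p) := by
    intro v
    obtain ⟨x, hx⟩ := 𝔼.fiberQ_surjective ⟨p, s p⟩ (eQ.symmₗ ℝ p v)
    refine ⟨e.linearMapAt ℝ ⟨p, s p⟩ x, ?_⟩
    change eQ.linearMapAt ℝ p (𝔼.fiberQ ⟨p, s p⟩ (e.symmₗ ℝ ⟨p, s p⟩ _)) = v
    rw [e.symmₗ_linearMapAt hep, hx, eQ.linearMapAt_symmₗ heQp]
  obtain ⟨R, hR⟩ := (P p).toLinearMap.exists_rightInverse_of_surjective
    (LinearMap.range_eq_top.2 hPp)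
  -- The constant map R inverts P on the right only at p. Since A(p) is the identity, A(m) is
  -- invertible for m near p, and there R ∘ A(m)⁻¹ is a right inverse of P(m).
  let A : M → FQ →L[ℝ] FQ := fun m => (P m).comp (LinearMap.toContinuousLinearMap R)
  have hA : ∀ m, ContMDiffAt 𝓘(ℝ, E) (𝓘(ℝ, E).prod 𝓘(ℝ, FB)) ∞
      (fun m => (⟨m, s m⟩ : TotalSpace FB B)) m → m ∈ eQ.baseSet →
      (⟨m, s m⟩ : TotalSpace FB B) ∈ e.baseSet → ContMDiffAt 𝓘(ℝ, E) 𝓘(ℝ, FQ →L[ℝ] FQ) ∞ A m := by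
    intro m hsm hm hem
    have hP : ContMDiffAt 𝓘(ℝ, E) 𝓘(ℝ, FDB →L[ℝ] FQ) ∞ P m := by
      refine contMDiffAt_clm_of_apply fun v => ?_
      refine (contMDiffAt_coord_along eQ (𝔼.contMDiffAt_fiberQ
        (contMDiffAt_symmL_const hsm e hem v)) hm).congr_of_eventuallyEq ?_
      filter_upwards [eQ.open_baseSet.mem_nhds hm] with y hy
      change eQ.linearMapAt ℝ y _ = _
      rw [eQ.coe_linearMapAt_of_mem hy]
      rfl
    exact hP.clm_comp contMDiffAt_const
  have hAp : A p = (ContinuousLinearEquiv.refl ℝ FQ : FQ →L[ℝ] FQ) := by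
    ext v
    exact LinearMap.congr_fun hR v
  let f₀ : ∀ m, Q m →ₗ[ℝ] DB ⟨m, s m⟩ := fun m =>
    e.symmₗ ℝ ⟨m, s m⟩ ∘ₗ R ∘ₗ (A m).inverse.toLinearMap ∘ₗ eQ.linearMapAt ℝ m
  refine ⟨fun q => Bundle.TotalSpace.fiberAt q
    (𝔼.inB ⟨q.proj, s q.proj⟩ (𝔼.isotropize (f₀ q.proj) q.2)), ?_⟩
  have hgood : ∀ᶠ m in nhds p, ContMDiffAt 𝓘(ℝ, E) (𝓘(ℝ, E).prod 𝓘(ℝ, FB)) ∞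
      (fun m => (⟨m, s m⟩ : TotalSpace FB B)) m ∧ m ∈ eQ.baseSet ∧
      (⟨m, s m⟩ : TotalSpace FB B) ∈ e.baseSet ∧
      ∃ L : FQ ≃L[ℝ] FQ, A m = L := by
    have h1 := hs.self_of_nhds
    have h2 := (hA p h1 heQp hep).continuousAt.preimage_mem_nhds
      (hAp ▸ ContinuousLinearEquiv.nhds (ContinuousLinearEquiv.refl ℝ FQ))
    filter_upwards [hs, eQ.open_baseSet.mem_nhds heQp,
      h1.continuousAt.preimage_mem_nhds (e.open_baseSet.mem_nhds hep), h2] with m a b c d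
    obtain ⟨L, hL⟩ := d
    exact ⟨a, b, c, L, hL.symm⟩
  have hf₀ : ∀ m, m ∈ eQ.baseSet → (∃ L : FQ ≃L[ℝ] FQ, A m = L) → ∀ q,
      𝔼.fiberQ ⟨m, s m⟩ (f₀ m q) = q := by
    rintro m hm ⟨L, hL⟩ q
    have h1 : eQ.linearMapAt ℝ m (𝔼.fiberQ ⟨m, s m⟩ (f₀ m q)) =
        A m ((A m).inverse (eQ.linearMapAt ℝ m q)) := rfl
    rw [hL, ContinuousLinearMap.inverse_equiv] at h1
    have h2 := congrArg (eQ.symmₗ ℝ m) (h1.trans (L.apply_symm_apply _))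
    rwa [eQ.symmₗ_linearMapAt hm, eQ.symmₗ_linearMapAt hm] at h2
  -- The good conditions must hold on a neighbourhood of `m`: smoothness at points over `m` uses
  -- formulas that are valid only at good points.
  filter_upwards [hgood.eventually_nhds] with m hm
  have hχ : ∀ m', m' ∈ eQ.baseSet → (∃ L : FQ ≃L[ℝ] FQ, A m' = L) → ∀ q : Q m',
      (⟨⟨m', q⟩, Bundle.TotalSpace.fiberAt ⟨m', q⟩
        (𝔼.inB ⟨m', s m'⟩ (𝔼.isotropize (f₀ m') q))⟩ : TotalSpace FDQ DQ) =
      𝔼.inB ⟨m', s m'⟩ (𝔼.isotropize (f₀ m') q) := fun m' h1 h2 q =>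
    Bundle.TotalSpace.mk_fiberAt (𝔼.fiberQ_eq_iff.1 (𝔼.fiberQ_isotropize (hf₀ m' h1 h2) q))
  obtain ⟨hsm, hmQ, hme, hmA⟩ := hm.self_of_nhds
  refine ⟨IsIsotropicAt.of_linear (𝔼.isotropize (f₀ m)) (hχ m hmQ hmA)
    (𝔼.metric_isotropize (hf₀ m hmQ hmA)), fun q => ?_⟩
  have hpr : ∀ q : Q m, ContMDiffAt (𝓘(ℝ, E).prod 𝓘(ℝ, FQ)) 𝓘(ℝ, E) ∞ (TotalSpace.proj : TotalSpace FQ Q → M)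
    ⟨m, q⟩ := fun q => contMDiffAt_proj Q
  have hβ : ∀ q : Q m, ContMDiffAt (𝓘(ℝ, E).prod 𝓘(ℝ, FQ)) (𝓘(ℝ, E).prod 𝓘(ℝ, FB)) ∞
      (fun x : TotalSpace FQ Q => (⟨x.proj, s x.proj⟩ : TotalSpace FB B)) ⟨m, q⟩ :=
    fun q => ContMDiffAt.comp (⟨m, q⟩ : TotalSpace FQ Q) hsm (hpr q)
  have hpe : ∀ q : Q m, ∀ᶠ x : TotalSpace FQ Q in nhds ⟨m, q⟩, _ := fun q => (hpr q).continuousAt.eventually hm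
  have hAinv : ContMDiffAt 𝓘(ℝ, E) 𝓘(ℝ, FQ →L[ℝ] FQ) ∞ (fun m => (A m).inverse) m := by
    obtain ⟨L, hL⟩ := hmA
    exact contMDiffAt_clm_inverse (hA m hsm hmQ hme) L hL
  -- Needed at every q over m: the Gram form in the correction term evaluates `f₀` also at the value
  -- of a test section.
  have hfs : ∀ q : Q m, ContMDiffAt (𝓘(ℝ, E).prod 𝓘(ℝ, FQ)) ((𝓘(ℝ, E).prod 𝓘(ℝ, FB)).prod 𝓘(ℝ, FDB)) ∞
      (fun x : TotalSpace FQ Q => (⟨⟨x.proj, s x.proj⟩, f₀ x.proj x.2⟩ : TotalSpace FDB DB))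
      ⟨m, q⟩ := by
    intro q
    have hq : ContMDiffAt (𝓘(ℝ, E).prod 𝓘(ℝ, FQ)) 𝓘(ℝ, FQ) ∞
        (fun x : TotalSpace FQ Q => (eQ x).2) ⟨m, q⟩ :=
      contMDiffAt_coord_along eQ (p := TotalSpace.proj) (s := fun x : TotalSpace FQ Q => x.2)
        contMDiffAt_id hmQ
    have hv := (LinearMap.toContinuousLinearMap R).contMDiff.contMDiffAt.comp
      (⟨m, q⟩ : TotalSpace FQ Q)
      ((ContMDiffAt.comp (⟨m, q⟩ : TotalSpace FQ Q) hAinv (hpr q)).clm_apply hq)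
    refine (contMDiffAt_symm_along e (hβ q) hv hme).congr_of_eventuallyEq ?_
    filter_upwards [hpe q] with x hx
    change (⟨_, e.symmₗ ℝ _ (R ((A x.proj).inverse (eQ.linearMapAt ℝ x.proj x.2)))⟩ :
      TotalSpace FDB DB) = _
    rw [e.coe_symmₗ hx.2.2.1, eQ.coe_linearMapAt_of_mem hx.2.1]
    rfl
  have hcs := 𝔼.contMDiffAt_coreVec (hβ q)
    (τ := fun x => (𝔼.bilin ⟨x.proj, s x.proj⟩).compl₁₂ (f₀ x.proj) (f₀ x.proj) x.2) (by
      intro y hy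
      exact 𝔼.contMDiffAt_metric (hfs q) (ContMDiffAt.comp (⟨m, q⟩ : TotalSpace FQ Q) (hfs (y ⟨m, q⟩)) hy))
  refine (𝔼.contMDiffAt_inB (contMDiffAt_add_along (hfs q) (contMDiffAt_smul_along
    (contMDiffAt_const (c := (-(1 / 2) : ℝ))) hcs))).congr_of_eventuallyEq ?_
  filter_upwards [hpe q] with x hx
  exact hχ x.proj hx.2.1 hx.2.2.2 x.2

end MetricDoubleVectorBundle

end LocalLift
end

noncomputable section
-- Existence of a global Lagrangian splitting.
section GlobalSplitting


variable {E : Type*} [NormedAddCommGroup E] [NormedSpace ℝ E]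
  {M : Type*} [TopologicalSpace M] [ChartedSpace E M]
  {FQ : Type*} [NormedAddCommGroup FQ] [NormedSpace ℝ FQ]
  {Q : M → Type*} [∀ m, AddCommGroup (Q m)] [∀ m, Module ℝ (Q m)]
  [TopologicalSpace (TotalSpace FQ Q)] [∀ m, TopologicalSpace (Q m)]
  [FiberBundle FQ Q] [VectorBundle ℝ FQ Q]
  {FB : Type*} [NormedAddCommGroup FB] [NormedSpace ℝ FB]
  {B : M → Type*} [∀ m, AddCommGroup (B m)] [∀ m, Module ℝ (B m)]
  [TopologicalSpace (TotalSpace FB B)] [∀ m, TopologicalSpace (B m)]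
  [FiberBundle FB B] [VectorBundle ℝ FB B]
  {FDQ : Type*} [NormedAddCommGroup FDQ] [NormedSpace ℝ FDQ]
  {DQ : TotalSpace FQ Q → Type*} [∀ q, AddCommGroup (DQ q)] [∀ q, Module ℝ (DQ q)]
  [TopologicalSpace (TotalSpace FDQ DQ)] [∀ q, TopologicalSpace (DQ q)]
  [FiberBundle FDQ DQ] [VectorBundle ℝ FDQ DQ]
  {FDB : Type*} [NormedAddCommGroup FDB] [NormedSpace ℝ FDB]
  {DB : TotalSpace FB B → Type*} [∀ b, AddCommGroup (DB b)] [∀ b, Module ℝ (DB b)]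
  [TopologicalSpace (TotalSpace FDB DB)] [∀ b, TopologicalSpace (DB b)]
  [FiberBundle FDB DB] [VectorBundle ℝ FDB DB]


theorem contMDiffAt_fst_along {x₀ : TotalSpace (FQ × FB) (Q ×ᵇ B)} :
    ContMDiffAt (𝓘(ℝ, E).prod 𝓘(ℝ, FQ × FB)) (𝓘(ℝ, E).prod 𝓘(ℝ, FQ)) ∞
      (fun x : TotalSpace (FQ × FB) (Q ×ᵇ B) => (⟨x.proj, x.2.1⟩ : TotalSpace FQ Q)) x₀ := by
  have h := contMDiffAt_totalSpace.1
    (contMDiffAt_id (I := 𝓘(ℝ, E).prod 𝓘(ℝ, FQ × FB)) (n := ∞) (x := x₀))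
  exact contMDiffAt_totalSpace.2 ⟨h.1,
    (ContinuousLinearMap.fst ℝ FQ FB).contMDiff.contMDiffAt.comp x₀ h.2⟩

theorem contMDiffAt_snd_along {x₀ : TotalSpace (FQ × FB) (Q ×ᵇ B)} :
    ContMDiffAt (𝓘(ℝ, E).prod 𝓘(ℝ, FQ × FB)) (𝓘(ℝ, E).prod 𝓘(ℝ, FB)) ∞
      (fun x : TotalSpace (FQ × FB) (Q ×ᵇ B) => (⟨x.proj, x.2.2⟩ : TotalSpace FB B)) x₀ := by
  have h := contMDiffAt_totalSpace.1
    (contMDiffAt_id (I := 𝓘(ℝ, E).prod 𝓘(ℝ, FQ × FB)) (n := ∞) (x := x₀))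
  exact contMDiffAt_totalSpace.2 ⟨h.1,
    (ContinuousLinearMap.snd ℝ FQ FB).contMDiff.contMDiffAt.comp x₀ h.2⟩

theorem contMDiffAt_prod_along {EN : Type*} [NormedAddCommGroup EN] [NormedSpace ℝ EN]
    {HN : Type*} [TopologicalSpace HN] {IN : ModelWithCorners ℝ EN HN}
    {N : Type*} [TopologicalSpace N] [ChartedSpace HN N] {x₀ : N} {p : N → M}
    {s : ∀ y, Q (p y)} {t : ∀ y, B (p y)}
    (hs : ContMDiffAt IN (𝓘(ℝ, E).prod 𝓘(ℝ, FQ)) ∞ (fun y => (⟨p y, s y⟩ : TotalSpace FQ Q)) x₀)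
    (ht : ContMDiffAt IN (𝓘(ℝ, E).prod 𝓘(ℝ, FB)) ∞ (fun y => (⟨p y, t y⟩ : TotalSpace FB B)) x₀) :
    ContMDiffAt IN (𝓘(ℝ, E).prod 𝓘(ℝ, FQ × FB)) ∞
      (fun y => (⟨p y, (s y, t y)⟩ : TotalSpace (FQ × FB) (Q ×ᵇ B))) x₀ := by
  have h1 := contMDiffAt_totalSpace.1 hs
  have h2 := contMDiffAt_totalSpace.1 ht
  exact contMDiffAt_totalSpace.2 ⟨h1.1, h1.2.prodMk_space h2.2⟩

namespace MetricDoubleVectorBundle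

variable (𝔼 : MetricDoubleVectorBundle E FQ Q FB B FDQ DQ FDB DB)

/-- The family `S` of linear maps is a Lagrangian splitting over the point `m`, smooth at the points
over `m`. -/
structure IsLagrangianAt (S : ∀ (m : M) (q : Q m), B m →ₗ[ℝ] DQ ⟨m, q⟩) (m : M) : Prop where
  isotropic : ∀ b, 𝔼.IsIsotropicAt m (fun q => S m q b) b
  smooth : ∀ q b, ContMDiffAt (𝓘(ℝ, E).prod 𝓘(ℝ, FQ × FB))
    ((𝓘(ℝ, E).prod 𝓘(ℝ, FQ)).prod 𝓘(ℝ, FDQ)) ∞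
    (fun x : TotalSpace (FQ × FB) (Q ×ᵇ B) =>
      (⟨⟨x.proj, x.2.1⟩, S x.proj x.2.1 x.2.2⟩ : TotalSpace FDQ DQ)) ⟨m, (q, b)⟩

variable {𝔼} in
/-- The Lagrangian splitting given by a family of linear maps. -/
def IsLagrangianAt.splitting {S : ∀ (m : M) (q : Q m), B m →ₗ[ℝ] DQ ⟨m, q⟩}
    (h : ∀ m, 𝔼.IsLagrangianAt S m) : 𝔼.LagrangianSplitting :=
  ⟨{  toFun := fun m q b => ⟨⟨m, q⟩, S m q b⟩
      smooth := fun x => (h x.proj).smooth x.2.1 x.2.2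
      projQ := fun _ _ _ => rfl
      projB := fun m q b => ((h m).isotropic b).projB q
      add_right := fun m q b b' => by rw [(S m q).map_add, 𝔼.addQ_mk]
      smul_right := fun m r q b => by rw [(S m q).map_smul, 𝔼.smulQ_mk]
      add_left := fun m q q' b => ((h m).isotropic b).map_add q q'
      smul_left := fun m r q b => ((h m).isotropic b).map_smul r q },
    fun m q q' b => ((h m).isotropic b).isotropic q q'⟩

/-- Lift each member of a local frame of B isotropically and extend linearly in b; linear
combinations of isotropic maps are isotropic over the combined base vector. -/
theorem exists_isLagrangianAt_nhds [FiniteDimensional ℝ FQ] [FiniteDimensional ℝ FB]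
    [FiniteDimensional ℝ FDB] [ContMDiffVectorBundle ∞ FQ Q 𝓘(ℝ, E)]
    [ContMDiffVectorBundle ∞ FB B 𝓘(ℝ, E)]
    [ContMDiffVectorBundle ∞ FDQ DQ (𝓘(ℝ, E).prod 𝓘(ℝ, FQ))]
    [ContMDiffVectorBundle ∞ FDB DB (𝓘(ℝ, E).prod 𝓘(ℝ, FB))] (p : M) :
    ∃ S : ∀ (m : M) (q : Q m), B m →ₗ[ℝ] DQ ⟨m, q⟩, ∀ᶠ m in nhds p, 𝔼.IsLagrangianAt S m := by
  let e := trivializationAt FB B p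
  have hp : p ∈ e.baseSet := mem_baseSet_trivializationAt FB B p
  let v := Module.finBasis ℝ FB
  have hs : ∀ i, ∃ χ : ∀ q : TotalSpace FQ Q, DQ q, ∀ᶠ m in nhds p,
      𝔼.IsIsotropicAt m (fun q => χ ⟨m, q⟩) (e.symmₗ ℝ m (v i)) ∧ ∀ q : Q m,
      ContMDiffAt (𝓘(ℝ, E).prod 𝓘(ℝ, FQ)) ((𝓘(ℝ, E).prod 𝓘(ℝ, FQ)).prod 𝓘(ℝ, FDQ)) ∞
        (fun q => (⟨q, χ q⟩ : TotalSpace FDQ DQ)) ⟨m, q⟩ := by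
    intro i
    refine 𝔼.exists_local_lift p _ ?_
    filter_upwards [e.open_baseSet.mem_nhds hp] with m hm
    refine (contMDiffAt_symm_along e contMDiffAt_id (contMDiffAt_const (c := v i))
      hm).congr_of_eventuallyEq ?_
    filter_upwards [e.open_baseSet.mem_nhds hm] with y hy
    rw [e.coe_symmₗ hy]
    rfl
  choose χ hχ using hs
  refine ⟨fun m q => ∑ i, (v.coord i ∘ₗ e.linearMapAt ℝ m).smulRight (χ i ⟨m, q⟩), ?_⟩
  filter_upwards [e.open_baseSet.mem_nhds hp, Filter.eventually_all.2 hχ] with m hm hχm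
  refine ⟨fun b => ?_, fun q b => ?_⟩
  · have h := IsIsotropicAt.sum (𝔼 := 𝔼) Finset.univ
      (fun i _ => ((hχm i).1).smul (v.coord i (e.linearMapAt ℝ m b)))
    have hb : ∑ i, v.coord i (e.linearMapAt ℝ m b) • e.symmₗ ℝ m (v i) = b := by
      simp only [← map_smul, ← map_sum]
      simp only [Module.Basis.coord_apply, v.sum_repr]
      exact e.symmₗ_linearMapAt hm b
    rw [hb] at h
    convert h using 1
    ext q
    simp
  · have hc := contMDiffAt_coord_along e
      (contMDiffAt_snd_along (E := E) (FQ := FQ) (x₀ := ⟨m, (q, b)⟩)) hm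
    have h := contMDiffAt_sum_along (κ := Fin (Module.finrank ℝ FB)) Finset.univ
      (contMDiffAt_fst_along (E := E) (FB := FB) (x₀ := ⟨m, (q, b)⟩)) (fun i _ =>
      contMDiffAt_smul_along (((v.coord i).toContinuousLinearMap).contMDiff.contMDiffAt.comp _ hc)
        (ContMDiffAt.comp (⟨m, (q, b)⟩ : TotalSpace (FQ × FB) (Q ×ᵇ B)) ((hχm i).2 q)
          contMDiffAt_fst_along))
    refine h.congr_of_eventuallyEq ?_
    have hpr : ContinuousAt (TotalSpace.proj : TotalSpace (FQ × FB) (Q ×ᵇ B) → M) ⟨m, (q, b)⟩ :=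
      (FiberBundle.continuous_proj (FQ × FB) (Q ×ᵇ B)).continuousAt
    filter_upwards [hpr.preimage_mem_nhds (e.open_baseSet.mem_nhds hm)] with y hy
    simp only [LinearMap.sum_apply, LinearMap.smulRight_apply, LinearMap.comp_apply,
      e.coe_linearMapAt_of_mem hy]
    rfl

/-- Local splittings are averaged with a partition of unity. Isotropy is preserved because it is
linear over Q, and the base vector is Σ ρ_i b = b because the weights sum to 1. -/
theorem exists_isLagrangianAt [FiniteDimensional ℝ E] [T2Space M] [SecondCountableTopology M]
    [IsManifold 𝓘(ℝ, E) ∞ M] [FiniteDimensional ℝ FQ] [FiniteDimensional ℝ FB]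
    [FiniteDimensional ℝ FDB] [ContMDiffVectorBundle ∞ FQ Q 𝓘(ℝ, E)]
    [ContMDiffVectorBundle ∞ FB B 𝓘(ℝ, E)]
    [ContMDiffVectorBundle ∞ FDQ DQ (𝓘(ℝ, E).prod 𝓘(ℝ, FQ))]
    [ContMDiffVectorBundle ∞ FDB DB (𝓘(ℝ, E).prod 𝓘(ℝ, FB))] :
    ∃ S : ∀ (m : M) (q : Q m), B m →ₗ[ℝ] DQ ⟨m, q⟩, ∀ m, 𝔼.IsLagrangianAt S m := by
  have := Manifold.locallyCompact_of_finiteDimensional 𝓘(ℝ, E) (M := M)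
  choose S hS using 𝔼.exists_isLagrangianAt_nhds
  simp only [Filter.Eventually, mem_nhds_iff] at hS
  choose U hUS hUo hU using hS
  obtain ⟨ρ, hρ⟩ := SmoothPartitionOfUnity.exists_isSubordinate 𝓘(ℝ, E) isClosed_univ U hUo
    (fun p _ => Set.mem_iUnion.2 ⟨p, hU p⟩)
  refine ⟨fun m q => ∑ i ∈ ρ.finsupport m, ρ i m • S i m q, fun m => ⟨fun b => ?_, fun q b => ?_⟩⟩
  · have h := IsIsotropicAt.sum (𝔼 := 𝔼) (ρ.finsupport m) (fun i hi =>
      ((hUS i (hρ i (subset_tsupport _ ((ρ.mem_finsupport m).1 hi)))).isotropic b).smul (ρ i m))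
    rw [← Finset.sum_smul, ρ.sum_finsupport m (Set.mem_univ m), one_smul] at h
    convert h using 1
    ext q
    simp
  -- For smoothness the index set must not vary with the point. The indices whose closed support
  -- contains `m` form a finite set that contains `finsupport` at all nearby points; the additional
  -- terms have weight 0.
  · have h := contMDiffAt_sum_along (ρ.fintsupport m)
      (contMDiffAt_fst_along (E := E) (FB := FB) (x₀ := ⟨m, (q, b)⟩)) (fun i hi =>
      contMDiffAt_smul_along (ContMDiffAt.comp (⟨m, (q, b)⟩ : TotalSpace (FQ × FB) (Q ×ᵇ B))
        (ρ i).contMDiff.contMDiffAt (contMDiffAt_proj (Q ×ᵇ B)))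
        ((hUS i (hρ i ((ρ.mem_fintsupport_iff m i).1 hi))).smooth q b))
    refine h.congr_of_eventuallyEq ?_
    have hpr : ContinuousAt (TotalSpace.proj : TotalSpace (FQ × FB) (Q ×ᵇ B) → M) ⟨m, (q, b)⟩ :=
      (FiberBundle.continuous_proj (FQ × FB) (Q ×ᵇ B)).continuousAt
    filter_upwards [hpr.eventually (ρ.eventually_finsupport_subset m)] with y hy
    simp only [LinearMap.sum_apply, LinearMap.smul_apply]
    congr 1
    refine Finset.sum_subset hy fun i _ hi => ?_
    rw [ρ.mem_finsupport, Function.notMem_support] at hi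
    rw [hi, zero_smul]

end MetricDoubleVectorBundle

end GlobalSplitting
end

noncomputable section
-- Two-forms on Q as isotropic sections over the zero section of B.
section CoreSections


variable {E : Type*} [NormedAddCommGroup E] [NormedSpace ℝ E]
  {M : Type*} [TopologicalSpace M] [ChartedSpace E M]
  {FQ : Type*} [NormedAddCommGroup FQ] [NormedSpace ℝ FQ]
  {Q : M → Type*} [∀ m, AddCommGroup (Q m)] [∀ m, Module ℝ (Q m)]
  [TopologicalSpace (TotalSpace FQ Q)] [∀ m, TopologicalSpace (Q m)]
  [FiberBundle FQ Q] [VectorBundle ℝ FQ Q]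
  {FB : Type*} [NormedAddCommGroup FB] [NormedSpace ℝ FB]
  {B : M → Type*} [∀ m, AddCommGroup (B m)] [∀ m, Module ℝ (B m)]
  [TopologicalSpace (TotalSpace FB B)] [∀ m, TopologicalSpace (B m)]
  [FiberBundle FB B] [VectorBundle ℝ FB B]
  {FDQ : Type*} [NormedAddCommGroup FDQ] [NormedSpace ℝ FDQ]
  {DQ : TotalSpace FQ Q → Type*} [∀ q, AddCommGroup (DQ q)] [∀ q, Module ℝ (DQ q)]
  [TopologicalSpace (TotalSpace FDQ DQ)] [∀ q, TopologicalSpace (DQ q)]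
  [FiberBundle FDQ DQ] [VectorBundle ℝ FDQ DQ]
  {FDB : Type*} [NormedAddCommGroup FDB] [NormedSpace ℝ FDB]
  {DB : TotalSpace FB B → Type*} [∀ b, AddCommGroup (DB b)] [∀ b, Module ℝ (DB b)]
  [TopologicalSpace (TotalSpace FDB DB)] [∀ b, TopologicalSpace (DB b)]
  [FiberBundle FDB DB] [VectorBundle ℝ FDB DB]


/-- The bilinear form given by an element of the fibre of `Q^* ∧ Q^*`. -/
def twoFormBilin {m : M} (η : Q m [⋀^Fin 2]→L[ℝ] Bundle.Trivial M ℝ m) : Q m →ₗ[ℝ] Q m →ₗ[ℝ] ℝ :=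
  LinearMap.mk₂ ℝ (fun q q' => (η ![q, q'] : ℝ))
    (fun q₁ q₂ q' => by
      have h := η.map_update_add ![q₁, q'] 0 q₁ q₂
      simpa only [update_cons_zero] using h)
    (fun r q q' => by
      have h := η.map_update_smul ![q, q'] 0 r q
      simpa only [update_cons_zero] using h)
    (fun q q₁ q₂ => by
      have h := η.map_update_add ![q, q₁] 1 q₁ q₂
      simpa only [update_cons_one] using h)
    (fun r q q' => by
      have h := η.map_update_smul ![q, q'] 1 r q'
      simpa only [update_cons_one] using h)

theorem twoFormBilin_self {m : M} (η : Q m [⋀^Fin 2]→L[ℝ] Bundle.Trivial M ℝ m) (q : Q m) :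
    twoFormBilin η q q = 0 :=
  η.map_eq_zero_of_eq ![q, q] (i := 0) (j := 1) rfl zero_ne_one

theorem twoFormBilin_swap {m : M} (η : Q m [⋀^Fin 2]→L[ℝ] Bundle.Trivial M ℝ m) (q q' : Q m) :
    twoFormBilin η q q' + twoFormBilin η q' q = 0 := by
  have h := twoFormBilin_self η (q + q')
  simpa [twoFormBilin_self] using h

theorem twoFormBilin_injective {m : M}
    {η η' : Q m [⋀^Fin 2]→L[ℝ] Bundle.Trivial M ℝ m} (h : twoFormBilin η = twoFormBilin η') :
    η = η' := by
  ext v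
  have hv : v = ![v 0, v 1] := by
    funext i
    fin_cases i <;> rfl
  rw [hv]
  exact LinearMap.congr_fun₂ h (v 0) (v 1)

namespace MetricDoubleVectorBundle

variable (𝔼 : MetricDoubleVectorBundle E FQ Q FB B FDQ DQ FDB DB)

/-- The bilinear form on `Q_m` given by a map from `Q_m` to the kernel of `D → B`. -/
def coreForm {m : M} (χ : ∀ q : Q m, DQ ⟨m, q⟩) (q q' : Q m) : ℝ :=
  𝔼.pairing 𝔼.metric ⟨⟨m, q⟩, χ q⟩ (𝔼.zeroQ ⟨m, q'⟩)

variable {𝔼} in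
-- Write the second argument as 0_{q'} = 0_{q'} +_Q 0_{q'} and use additivity of the metric over Q.
theorem coreForm_add {m : M} {χ χ' : ∀ q : Q m, DQ ⟨m, q⟩} (h : 𝔼.IsIsotropicAt m χ 0)
    (h' : 𝔼.IsIsotropicAt m χ' 0) (q q' : Q m) :
    𝔼.coreForm (χ + χ') q q' = 𝔼.coreForm χ q q' + 𝔼.coreForm χ' q q' := by
  have H := 𝔼.isDoubleVectorBundle
  have h1 := 𝔼.metric_addQ (⟨⟨m, q⟩, χ q⟩ : TotalSpace FDQ DQ) ⟨⟨m, q⟩, χ' q⟩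
    (𝔼.zeroQ ⟨m, q'⟩) (𝔼.zeroQ ⟨m, q'⟩) rfl rfl ((h.projB q).trans (H.projB_zeroQ m q').symm)
    ((h'.projB q).trans (H.projB_zeroQ m q').symm)
  simpa [coreForm, DoubleBundleSquare.zeroQ] using h1

variable {𝔼} in
theorem coreForm_smul {m : M} {χ : ∀ q : Q m, DQ ⟨m, q⟩} (h : 𝔼.IsIsotropicAt m χ 0) (r : ℝ)
    (q q' : Q m) : 𝔼.coreForm (r • χ) q q' = r * 𝔼.coreForm χ q q' := by
  have H := 𝔼.isDoubleVectorBundle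
  have h1 := 𝔼.metric_smulQ r (⟨⟨m, q⟩, χ q⟩ : TotalSpace FDQ DQ)
    (𝔼.zeroQ ⟨m, q'⟩) ((h.projB q).trans (H.projB_zeroQ m q').symm)
  simpa [coreForm, DoubleBundleSquare.zeroQ] using h1

variable [FiniteDimensional ℝ FQ] [FiniteDimensional ℝ FDB]

theorem metric_zeroVec_coreVec {m : M} (q : Q m) (τ : Q m →ₗ[ℝ] ℝ) :
    𝔼.metric ⟨m, 0⟩ (𝔼.zeroVec m q) (𝔼.coreVec ⟨m, 0⟩ τ) = τ q := by
  rw [𝔼.metric_symm, metric_coreVec, fiberQ_zeroVec]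

/-- The map `q ↦ 0_q +_B τ̄` with `τ = η(q, ·)`, for a two-form `η` on `Q_m`. -/
def coreSection {m : M} (η : Q m [⋀^Fin 2]→L[ℝ] Bundle.Trivial M ℝ m) (q : Q m) : DQ ⟨m, q⟩ :=
  Bundle.TotalSpace.fiberAt ⟨m, q⟩
    (𝔼.inB ⟨m, 0⟩ (𝔼.zeroVec m q + 𝔼.coreVec ⟨m, 0⟩ (twoFormBilin η q)))

theorem mk_coreSection {m : M} (η : Q m [⋀^Fin 2]→L[ℝ] Bundle.Trivial M ℝ m) (q : Q m) :
    (⟨⟨m, q⟩, 𝔼.coreSection η q⟩ : TotalSpace FDQ DQ) =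
      𝔼.inB ⟨m, 0⟩ (𝔼.zeroVec m q + 𝔼.coreVec ⟨m, 0⟩ (twoFormBilin η q)) :=
  Bundle.TotalSpace.mk_fiberAt (𝔼.fiberQ_eq_iff.1 (by
    rw [map_add, fiberQ_zeroVec, fiberQ_coreVec, add_zero]))

/-- Zeros pair to zero and so do core vectors, so only the cross terms η(q, q') + η(q', q) remain;
they cancel by antisymmetry. -/
theorem isIsotropicAt_coreSection {m : M} (η : Q m [⋀^Fin 2]→L[ℝ] Bundle.Trivial M ℝ m) :
    𝔼.IsIsotropicAt m (𝔼.coreSection η) 0 := by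
  refine IsIsotropicAt.of_linear (𝔼.zeroVecₗ m + 𝔼.coreVec ⟨m, 0⟩ ∘ₗ twoFormBilin η)
    (𝔼.mk_coreSection η) fun q q' => ?_
  change 𝔼.metric ⟨m, 0⟩ (𝔼.zeroVec m q + 𝔼.coreVec ⟨m, 0⟩ (twoFormBilin η q))
    (𝔼.zeroVec m q' + 𝔼.coreVec ⟨m, 0⟩ (twoFormBilin η q')) = 0
  rw [map_add, map_add, add_apply, add_apply, 𝔼.metric_zeroVec, metric_coreVec, metric_coreVec,
    metric_zeroVec_coreVec, fiberQ_zeroVec, fiberQ_coreVec, map_zero, zero_add, add_zero]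
  exact twoFormBilin_swap η q q'

@[simp] theorem coreForm_coreSection {m : M} (η : Q m [⋀^Fin 2]→L[ℝ] Bundle.Trivial M ℝ m)
    (q q' : Q m) : 𝔼.coreForm (𝔼.coreSection η) q q' = twoFormBilin η q q' := by
  rw [coreForm, mk_coreSection, ← inB_zeroVec, 𝔼.pairing_inB, map_add, add_apply,
    𝔼.metric_zeroVec, metric_coreVec, fiberQ_zeroVec, zero_add]

variable {𝔼} in
-- The vector χ(q) − 0_q lies in the isotropic kernel of the projection to Q. Its pairing with x
-- therefore depends only on the projection q' of x and may be computed at x = 0_{q'}, where it is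
-- the core form.
theorem IsIsotropicAt.eq_coreSection {m : M} {χ : ∀ q : Q m, DQ ⟨m, q⟩}
    {η : Q m [⋀^Fin 2]→L[ℝ] Bundle.Trivial M ℝ m} (h : 𝔼.IsIsotropicAt m χ 0)
    (hη : ∀ q q', 𝔼.coreForm χ q q' = twoFormBilin η q q') : χ = 𝔼.coreSection η := by
  obtain ⟨f, hf, hfQ, -⟩ := h.exists_linear
  funext q
  have key : f q - 𝔼.zeroVec m q = 𝔼.coreVec ⟨m, 0⟩ (twoFormBilin η q) := by
    refine 𝔼.eq_coreVec fun x => ?_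
    let q' : Q m := 𝔼.fiberQ ⟨m, 0⟩ x
    have h1 := hη q q'
    rw [coreForm, hf, ← inB_zeroVec, 𝔼.pairing_inB] at h1
    have h2 : 𝔼.metric ⟨m, 0⟩ (f q - 𝔼.zeroVec m q) (x - 𝔼.zeroVec m q') = 0 := by
      refine 𝔼.metric_ker ?_ ?_
      · rw [map_sub, hfQ, fiberQ_zeroVec, sub_self]
      · rw [map_sub, fiberQ_zeroVec, sub_self]
    rw [map_sub, sub_eq_zero] at h2
    rw [h2, map_sub, sub_apply, h1, 𝔼.metric_zeroVec, sub_zero]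
  have h3 : (⟨⟨m, q⟩, χ q⟩ : TotalSpace FDQ DQ) = ⟨⟨m, q⟩, 𝔼.coreSection η q⟩ := by
    rw [hf, mk_coreSection, ← key, add_sub_cancel]
  simpa using h3

/-- `coreSection` as a linear map. -/
def coreSectionₗ (m : M) :
    (Q m [⋀^Fin 2]→L[ℝ] Bundle.Trivial M ℝ m) →ₗ[ℝ] ∀ q : Q m, DQ ⟨m, q⟩ where
  toFun := 𝔼.coreSection
  map_add' η η' := by
    -- Linearity in η comes from uniqueness: the sum of the two sections is isotropic over zero, and
    -- the core form identifies it.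
    have h := 𝔼.isIsotropicAt_coreSection η
    have h' := 𝔼.isIsotropicAt_coreSection η'
    have hs := h.add h'
    rw [add_zero] at hs
    refine (hs.eq_coreSection fun q q' => ?_).symm
    rw [coreForm_add h h', coreForm_coreSection, coreForm_coreSection]
    rfl
  map_smul' r η := by
    have h := 𝔼.isIsotropicAt_coreSection η
    have hs := h.smul r
    rw [smul_zero] at hs
    refine (hs.eq_coreSection fun q q' => ?_).symm
    rw [coreForm_smul h, coreForm_coreSection]
    rfl

theorem coreSection_injective {m : M} {η η' : Q m [⋀^Fin 2]→L[ℝ] Bundle.Trivial M ℝ m}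
    (h : 𝔼.coreSection η = 𝔼.coreSection η') : η = η' := by
  refine twoFormBilin_injective (LinearMap.ext₂ fun q q' => ?_)
  rw [← 𝔼.coreForm_coreSection, h, coreForm_coreSection]

variable {𝔼} in
-- The core form is alternating: χ(q) − 0_q lies in the isotropic kernel, while χ(q) and 0_q are
-- isotropic themselves, so expanding its square leaves −2⟨χ(q), 0_q⟩ = 0.
theorem IsIsotropicAt.exists_eq_coreSection {m : M} {χ : ∀ q : Q m, DQ ⟨m, q⟩}
    (h : 𝔼.IsIsotropicAt m χ 0) :
    ∃ η : Q m [⋀^Fin 2]→L[ℝ] Bundle.Trivial M ℝ m, χ = 𝔼.coreSection η := by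
  obtain ⟨f, hf, hfQ, hi⟩ := h.exists_linear
  let a : Q m →ₗ[ℝ] Q m →ₗ[ℝ] ℝ := (𝔼.bilin ⟨m, 0⟩).compl₁₂ f (𝔼.zeroVecₗ m)
  have ha : ∀ q, a q q = 0 := by
    intro q
    change 𝔼.metric ⟨m, 0⟩ (f q) (𝔼.zeroVec m q) = 0
    have h2 : 𝔼.metric ⟨m, 0⟩ (f q - 𝔼.zeroVec m q) (f q - 𝔼.zeroVec m q) = 0 := by
      refine 𝔼.metric_ker ?_ ?_ <;> rw [map_sub, hfQ, fiberQ_zeroVec, sub_self]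
    simp only [map_sub, sub_apply, hi, 𝔼.metric_zeroVec, 𝔼.metric_symm _ (𝔼.zeroVec m q)] at h2
    linarith
  refine ⟨alternatingOfBilin (F := FQ) m a ha, h.eq_coreSection fun q q' => ?_⟩
  rw [coreForm, hf, ← inB_zeroVec, 𝔼.pairing_inB]
  rfl

/-- Write e = e +_Q 0_q. Additivity over Q splits the pairing with 0_b +_Q c into ⟨e, 0_b⟩ = 0 and
⟨0_q, c⟩ = τ(q). -/
theorem isCoreElement_coreVec (m : M) (τ : Q m →ₗ[ℝ] ℝ) :
    𝔼.IsCoreElement m τ (𝔼.inB ⟨m, 0⟩ (𝔼.coreVec ⟨m, 0⟩ τ)) where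
  projQ := 𝔼.fiberQ_eq_iff.1 (𝔼.fiberQ_coreVec ⟨m, 0⟩ τ)
  projB := 𝔼.projB_inB _ _
  pairing q e he := by
    have H := 𝔼.isDoubleVectorBundle
    obtain ⟨u, rfl⟩ := Bundle.TotalSpace.exists_eq_mk he
    obtain ⟨b, hb⟩ := Bundle.TotalSpace.exists_eq_mk
      (H.proj_comm (⟨⟨m, q⟩, u⟩ : TotalSpace FDQ DQ)).symm
    change 𝔼.projB _ = ⟨m, b⟩ at hb
    obtain ⟨x, hx⟩ := 𝔼.exists_inB hb
    have h1 := 𝔼.metric_addQ (⟨⟨m, q⟩, u⟩ : TotalSpace FDQ DQ) (𝔼.zeroQ ⟨m, q⟩)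
      (𝔼.zeroB ⟨m, b⟩) (𝔼.inB ⟨m, 0⟩ (𝔼.coreVec ⟨m, 0⟩ τ)) rfl
      ((H.projQ_zeroB m b).trans (𝔼.fiberQ_eq_iff.1 (𝔼.fiberQ_coreVec ⟨m, 0⟩ τ)).symm)
      (hb.trans (𝔼.projB_inB _ _).symm) ((H.projB_zeroQ m q).trans (𝔼.projB_inB _ _).symm)
    have h2 : 𝔼.addQ (⟨⟨m, q⟩, u⟩ : TotalSpace FDQ DQ) (𝔼.zeroQ ⟨m, q⟩) = ⟨⟨m, q⟩, u⟩ := by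
      simp [DoubleBundleSquare.zeroQ]
    rw [h2] at h1
    rw [hb, h1, hx, 𝔼.zeroB_eq_inB, 𝔼.pairing_inB, map_zero, ← inB_zeroVec, 𝔼.pairing_inB,
      metric_zeroVec_coreVec, zero_add]

section Smooth

variable {EN : Type*} [NormedAddCommGroup EN] [NormedSpace ℝ EN]
  {HN : Type*} [TopologicalSpace HN] {IN : ModelWithCorners ℝ EN HN}
  {N : Type*} [TopologicalSpace N] [ChartedSpace HN N] {x₀ : N}
  [ContMDiffVectorBundle ∞ FQ Q 𝓘(ℝ, E)]
  [ContMDiffVectorBundle ∞ FDQ DQ (𝓘(ℝ, E).prod 𝓘(ℝ, FQ))]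
  [ContMDiffVectorBundle ∞ FDB DB (𝓘(ℝ, E).prod 𝓘(ℝ, FB))]

theorem contMDiffAt_zeroVec {p : N → M} {s : ∀ y, Q (p y)}
    (hs : ContMDiffAt IN (𝓘(ℝ, E).prod 𝓘(ℝ, FQ)) ∞ (fun y => (⟨p y, s y⟩ : TotalSpace FQ Q)) x₀) :
    ContMDiffAt IN ((𝓘(ℝ, E).prod 𝓘(ℝ, FB)).prod 𝓘(ℝ, FDB)) ∞
      (fun y => (⟨⟨p y, 0⟩, 𝔼.zeroVec (p y) (s y)⟩ : TotalSpace FDB DB)) x₀ := by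
  refine 𝔼.contMDiffAt_of_inB ?_
  simp only [inB_zeroVec]
  exact contMDiffAt_zero_along hs

theorem contMDiffAt_coreSection {p : N → M} {s : ∀ y, Q (p y)}
    {η : ∀ y, Q (p y) [⋀^Fin 2]→L[ℝ] Bundle.Trivial M ℝ (p y)}
    (hs : ContMDiffAt IN (𝓘(ℝ, E).prod 𝓘(ℝ, FQ)) ∞ (fun y => (⟨p y, s y⟩ : TotalSpace FQ Q)) x₀)
    (hη : ContMDiffAt IN (𝓘(ℝ, E).prod 𝓘(ℝ, FQ [⋀^Fin 2]→L[ℝ] ℝ)) ∞ (fun y => (⟨p y, η y⟩ :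
      TotalSpace (FQ [⋀^Fin 2]→L[ℝ] ℝ) (fun m => Q m [⋀^Fin 2]→L[ℝ] Bundle.Trivial M ℝ m))) x₀) :
    ContMDiffAt IN ((𝓘(ℝ, E).prod 𝓘(ℝ, FQ)).prod 𝓘(ℝ, FDQ)) ∞
      (fun y => (⟨⟨p y, s y⟩, 𝔼.coreSection (η y) (s y)⟩ : TotalSpace FDQ DQ)) x₀ := by
  simp only [mk_coreSection]
  have hβ : ContMDiffAt IN (𝓘(ℝ, E).prod 𝓘(ℝ, FB)) ∞
      (fun y => (⟨p y, 0⟩ : TotalSpace FB B)) x₀ := contMDiffAt_zero_along (contMDiffAt_proj_along hs)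
  exact 𝔼.contMDiffAt_inB (contMDiffAt_add_along (𝔼.contMDiffAt_zeroVec hs)
    (𝔼.contMDiffAt_coreVec hβ (τ := fun y => twoFormBilin (η y) (s y))
      fun t ht => contMDiffAt_twoForm_apply hη hs ht))

/-- The coefficients of η in a local frame are pairings of the section, evaluated on frame vectors,
with zeros of D → Q; both are smooth. -/
theorem contMDiffAt_of_coreSection {p : N → M}
    {η : ∀ y, Q (p y) [⋀^Fin 2]→L[ℝ] Bundle.Trivial M ℝ (p y)}
    (hp : ContMDiffAt IN 𝓘(ℝ, E) ∞ p x₀)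
    (h : ∀ s : ∀ y, Q (p y), ContMDiffAt IN (𝓘(ℝ, E).prod 𝓘(ℝ, FQ)) ∞
        (fun y => (⟨p y, s y⟩ : TotalSpace FQ Q)) x₀ →
      ContMDiffAt IN ((𝓘(ℝ, E).prod 𝓘(ℝ, FQ)).prod 𝓘(ℝ, FDQ)) ∞
        (fun y => (⟨⟨p y, s y⟩, 𝔼.coreSection (η y) (s y)⟩ : TotalSpace FDQ DQ)) x₀) :
    ContMDiffAt IN (𝓘(ℝ, E).prod 𝓘(ℝ, FQ [⋀^Fin 2]→L[ℝ] ℝ)) ∞ (fun y => (⟨p y, η y⟩ :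
      TotalSpace (FQ [⋀^Fin 2]→L[ℝ] ℝ)
        (fun m => Q m [⋀^Fin 2]→L[ℝ] Bundle.Trivial M ℝ m))) x₀ := by
  have hb := mem_baseSet_trivializationAt FQ Q (p x₀)
  have hfr : ∀ v : FQ, ContMDiffAt IN (𝓘(ℝ, E).prod 𝓘(ℝ, FQ)) ∞
      (fun y => (⟨p y, (trivializationAt FQ Q (p x₀)).symm (p y) v⟩ : TotalSpace FQ Q)) x₀ :=
    fun v => contMDiffAt_symm_along _ hp contMDiffAt_const hb
  refine contMDiffAt_twoForm_of_apply hp fun v w => ?_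
  have h1 := h _ (hfr v)
  simp only [mk_coreSection] at h1
  have h2 := 𝔼.contMDiffAt_metric (𝔼.contMDiffAt_of_inB h1) (𝔼.contMDiffAt_zeroVec (hfr w))
  refine h2.congr_of_eventuallyEq (Filter.Eventually.of_forall fun y => ?_)
  dsimp only
  rw [map_add, add_apply, 𝔼.metric_zeroVec, metric_coreVec, fiberQ_zeroVec, zero_add]
  rfl

end Smooth

end MetricDoubleVectorBundle

end CoreSections
end

noncomputable section
-- Gluing, exactness, and the decomposition of 𝒞(𝔼) by a Lagrangian splitting.
section SheafSequence


variable {E : Type*} [NormedAddCommGroup E] [NormedSpace ℝ E]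
  {M : Type*} [TopologicalSpace M] [ChartedSpace E M]
  {FQ : Type*} [NormedAddCommGroup FQ] [NormedSpace ℝ FQ]
  {Q : M → Type*} [∀ m, AddCommGroup (Q m)] [∀ m, Module ℝ (Q m)]
  [TopologicalSpace (TotalSpace FQ Q)] [∀ m, TopologicalSpace (Q m)]
  [FiberBundle FQ Q] [VectorBundle ℝ FQ Q]
  {FB : Type*} [NormedAddCommGroup FB] [NormedSpace ℝ FB]
  {B : M → Type*} [∀ m, AddCommGroup (B m)] [∀ m, Module ℝ (B m)]
  [TopologicalSpace (TotalSpace FB B)] [∀ m, TopologicalSpace (B m)]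
  [FiberBundle FB B] [VectorBundle ℝ FB B]
  {FDQ : Type*} [NormedAddCommGroup FDQ] [NormedSpace ℝ FDQ]
  {DQ : TotalSpace FQ Q → Type*} [∀ q, AddCommGroup (DQ q)] [∀ q, Module ℝ (DQ q)]
  [TopologicalSpace (TotalSpace FDQ DQ)] [∀ q, TopologicalSpace (DQ q)]
  [FiberBundle FDQ DQ] [VectorBundle ℝ FDQ DQ]
  {FDB : Type*} [NormedAddCommGroup FDB] [NormedSpace ℝ FDB]
  {DB : TotalSpace FB B → Type*} [∀ b, AddCommGroup (DB b)] [∀ b, Module ℝ (DB b)]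
  [TopologicalSpace (TotalSpace FDB DB)] [∀ b, TopologicalSpace (DB b)]
  [FiberBundle FDB DB] [VectorBundle ℝ FDB DB]


theorem mem_smoothSections_opens_iff {U : Opens (TotalSpace FQ Q)}
    {χ : ∀ q : TotalSpace FQ Q, DQ q} :
    (fun q : U => χ q) ∈ smoothSections (𝓘(ℝ, E).prod 𝓘(ℝ, FQ)) FDQ DQ U ↔
      ∀ q ∈ U, ContMDiffAt (𝓘(ℝ, E).prod 𝓘(ℝ, FQ)) ((𝓘(ℝ, E).prod 𝓘(ℝ, FQ)).prod 𝓘(ℝ, FDQ)) ∞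
        (fun q => (⟨q, χ q⟩ : TotalSpace FDQ DQ)) q := by
  have h : ∀ q : U, ContMDiffAt (𝓘(ℝ, E).prod 𝓘(ℝ, FQ))
      ((𝓘(ℝ, E).prod 𝓘(ℝ, FQ)).prod 𝓘(ℝ, FDQ)) ∞
      (fun q : U => (⟨q, χ q⟩ : TotalSpace FDQ DQ)) q ↔ ContMDiffAt (𝓘(ℝ, E).prod 𝓘(ℝ, FQ))
      ((𝓘(ℝ, E).prod 𝓘(ℝ, FQ)).prod 𝓘(ℝ, FDQ)) ∞
      (fun q => (⟨q, χ q⟩ : TotalSpace FDQ DQ)) q.1 := fun q =>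
    contMDiffAt_subtype_iff (f := fun q : TotalSpace FQ Q => (⟨q, χ q⟩ : TotalSpace FDQ DQ))
  exact ⟨fun hs q hq => (h ⟨q, hq⟩).1 (hs ⟨q, hq⟩), fun hs q => (h q).2 (hs q q.2)⟩

namespace MetricDoubleVectorBundle

variable (𝔼 : MetricDoubleVectorBundle E FQ Q FB B FDQ DQ FDB DB)

variable {𝔼} in
-- The base section is defined by choice; its uniqueness lets it be computed from any pointwise
-- description.
theorem isotropicBase_eq {U : Opens M} {χ : 𝔼.isotropicSections U}
    {b : smoothSections 𝓘(ℝ, E) FB B U}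
    (h : ∀ m : U, 𝔼.IsIsotropicAt m (fun q => χ.1 ⟨⟨m, q⟩, m.2⟩) (b.1 m)) :
    𝔼.isotropicBase U χ = b :=
  Subtype.ext (funext fun m => (isIsotropicAt_section χ m).base_unique (h m))

theorem isotropicBase_res {U W : Opens M} (h : W ≤ U) (χ : 𝔼.isotropicSections U) :
    𝔼.isotropicBase W (𝔼.isotropicRes h χ) =
      smoothSections.res 𝓘(ℝ, E) FB h (𝔼.isotropicBase U χ) :=
  isotropicBase_eq fun m => isIsotropicAt_section χ (Set.inclusion h m)

/-- Compatible isotropic linear sections over the members of an open cover glue. -/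
theorem existsUnique_glue {κ : Type*} (𝒰 : κ → Opens M) (χ : ∀ i, 𝔼.isotropicSections (𝒰 i))
    (hχ : ∀ i j, 𝔼.isotropicRes (inf_le_left : 𝒰 i ⊓ 𝒰 j ≤ 𝒰 i) (χ i) =
      𝔼.isotropicRes (inf_le_right : 𝒰 i ⊓ 𝒰 j ≤ 𝒰 j) (χ j)) :
    ∃! s : 𝔼.isotropicSections (⨆ i, 𝒰 i), ∀ i, 𝔼.isotropicRes (le_iSup 𝒰 i) s = χ i := by
  classical
  -- The value is taken from an arbitrary member of the cover; compatibility makes the choice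
  -- irrelevant. The value 0 off the union plays no role.
  let t : ∀ q : TotalSpace FQ Q, DQ q := fun q =>
    if h : ∃ i, q.proj ∈ 𝒰 i then (χ h.choose).1 ⟨q, h.choose_spec⟩ else 0
  have ht : ∀ i (q : opensOver (F := FQ) Q (𝒰 i)), t q = (χ i).1 q := by
    intro i q
    have h : ∃ i, q.1.proj ∈ 𝒰 i := ⟨i, q.2⟩
    refine (dif_pos h).trans ?_
    exact congrFun (congrArg Subtype.val (hχ h.choose i)) ⟨q.1, h.choose_spec, q.2⟩
  have hcov : ∀ m ∈ ⨆ i, 𝒰 i, ∃ i, m ∈ 𝒰 i := fun m hm => Opens.mem_iSup.1 hm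
  have hmem : (fun q : opensOver (F := FQ) Q (⨆ i, 𝒰 i) => t q) ∈
      𝔼.isotropicSections (⨆ i, 𝒰 i) := by
    refine 𝔼.mem_isotropicSections_iff.2 ⟨mem_smoothSections_opens_iff.2 fun q hq => ?_, ?_⟩
    · obtain ⟨i, hi⟩ := hcov q.proj hq
      refine (mem_smoothSections_opens_iff (U := opensOver Q (𝒰 i)) (χ := t)).1 ?_ q hi
      rw [funext (ht i)]
      exact (𝔼.mem_isotropicSections_iff.1 (χ i).2).1
    · have hb : ∀ m : (⨆ i, 𝒰 i : Opens M), ∃ b : B m,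
          𝔼.IsIsotropicAt (m : M) (fun q => t ⟨m, q⟩) b := by
        intro m
        obtain ⟨i, hi⟩ := hcov m m.2
        refine ⟨(𝔼.isotropicBase (𝒰 i) (χ i)).1 ⟨m, hi⟩, ?_⟩
        have h := isIsotropicAt_section (χ i) ⟨m, hi⟩
        rwa [show (fun q : Q m => t ⟨m, q⟩) = fun q => (χ i).1 ⟨⟨m, q⟩, hi⟩ from
          funext fun q => ht i ⟨⟨m, q⟩, hi⟩]
      choose b hb using hb
      exact ⟨b, hb⟩
  refine ⟨⟨_, hmem⟩, fun i => Subtype.ext (funext (ht i)), fun s hs => ?_⟩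
  refine Subtype.ext (funext fun q => ?_)
  obtain ⟨i, hi⟩ := hcov q.1.proj q.2
  exact (congrFun (congrArg Subtype.val (hs i)) ⟨q.1, hi⟩).trans (ht i ⟨q.1, hi⟩).symm

/-- The map `Γ(B) → 𝒞(𝔼)` over `U` given by a Lagrangian splitting. -/
def splitSection {S : ∀ (m : M) (q : Q m), B m →ₗ[ℝ] DQ ⟨m, q⟩} (hS : ∀ m, 𝔼.IsLagrangianAt S m)
    (U : Opens M) :
    smoothSections 𝓘(ℝ, E) FB B U →ₗ[SmoothFun 𝓘(ℝ, E) U] 𝔼.isotropicSections U where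
  toFun b := ⟨fun q => S q.1.proj q.1.2 (b.1 ⟨q.1.proj, q.2⟩),
    𝔼.mem_isotropicSections_iff.2 ⟨fun q => ContMDiffAt.comp q
      ((hS q.1.proj).smooth q.1.2 (b.1 ⟨q.1.proj, q.2⟩))
      (contMDiffAt_prod_along (p := fun q : opensOver (F := FQ) Q U => q.1.proj)
        (s := fun q => q.1.2) (t := fun q => b.1 ⟨q.1.proj, q.2⟩)
        contMDiff_subtype_val.contMDiffAt
        ((b.2.comp (contMDiff_restrictProj U)).contMDiffAt)),
      b.1, fun m => (hS m).isotropic (b.1 m)⟩⟩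
  map_add' _ _ := Subtype.ext (funext fun q => (S q.1.proj q.1.2).map_add _ _)
  map_smul' _ _ := Subtype.ext (funext fun q => (S q.1.proj q.1.2).map_smul _ _)

theorem isotropicBase_splitSection {S : ∀ (m : M) (q : Q m), B m →ₗ[ℝ] DQ ⟨m, q⟩}
    (hS : ∀ m, 𝔼.IsLagrangianAt S m) (U : Opens M) (b : smoothSections 𝓘(ℝ, E) FB B U) :
    𝔼.isotropicBase U (𝔼.splitSection hS U b) = b :=
  isotropicBase_eq fun m => (hS m).isotropic (b.1 m)

variable [FiniteDimensional ℝ FQ] [FiniteDimensional ℝ FDB]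
  [ContMDiffVectorBundle ∞ FQ Q 𝓘(ℝ, E)] [ContMDiffVectorBundle ∞ FB B 𝓘(ℝ, E)]
  [ContMDiffVectorBundle ∞ FDQ DQ (𝓘(ℝ, E).prod 𝓘(ℝ, FQ))]
  [ContMDiffVectorBundle ∞ FDB DB (𝓘(ℝ, E).prod 𝓘(ℝ, FB))]

/-- The map `Ω²(Q) → 𝒞(𝔼)` over `U`. -/
def coreLinear (U : Opens M) :
    twoForms E FQ Q U →ₗ[SmoothFun 𝓘(ℝ, E) U] 𝔼.isotropicSections U where
  toFun α := ⟨fun q => 𝔼.coreSection (α.1 ⟨q.1.proj, q.2⟩) q.1.2,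
    𝔼.mem_isotropicSections_iff.2 ⟨fun _ =>
      𝔼.contMDiffAt_coreSection (p := fun q : opensOver (F := FQ) Q U => q.1.proj)
        (s := fun q => q.1.2) (η := fun q => α.1 ⟨q.1.proj, q.2⟩)
        contMDiff_subtype_val.contMDiffAt
        ((α.2.comp (contMDiff_restrictProj U)).contMDiffAt),
      fun _ => 0, fun m => 𝔼.isIsotropicAt_coreSection (α.1 m)⟩⟩
  map_add' _ _ := Subtype.ext (funext fun q =>
    congrFun ((𝔼.coreSectionₗ q.1.proj).map_add _ _) q.1.2)
  map_smul' _ _ := Subtype.ext (funext fun q =>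
    congrFun ((𝔼.coreSectionₗ q.1.proj).map_smul _ _) q.1.2)

theorem isCoreLinear_coreLinear (U : Opens M) (α : twoForms E FQ Q U) :
    𝔼.IsCoreLinear α (𝔼.coreLinear U α).1 := by
  intro m q
  refine ⟨_, 𝔼.isCoreElement_coreVec m (twoFormBilin (α.1 m) q), ?_⟩
  refine (𝔼.mk_coreSection (α.1 m) q).trans ?_
  rw [← inB_zeroVec, 𝔼.addB_inB]

theorem coreLinear_injective (U : Opens M) : Function.Injective (𝔼.coreLinear U) := by
  intro α α' h
  refine Subtype.ext (funext fun m => 𝔼.coreSection_injective (funext fun q => ?_))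
  exact congrFun (congrArg Subtype.val h) ⟨⟨m, q⟩, m.2⟩

/-- A section with zero base is at each point the core section of some two-form;
`contMDiffAt_of_coreSection` makes these forms vary smoothly. -/
theorem exact_coreLinear (U : Opens M) :
    Function.Exact (𝔼.coreLinear U) (𝔼.isotropicBase U) := by
  intro χ
  constructor
  · intro h
    have h0 : ∀ m : U, 𝔼.IsIsotropicAt m (fun q => χ.1 ⟨⟨m, q⟩, m.2⟩) 0 := by
      intro m
      have h' := isIsotropicAt_section χ m
      rwa [h] at h'
    choose η hη using fun m => (h0 m).exists_eq_coreSection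
    have hηs : η ∈ twoForms E FQ Q U := fun m =>
      𝔼.contMDiffAt_of_coreSection (p := fun m : U => m.1) contMDiff_subtype_val.contMDiffAt
        fun s hs => by
          have hs' : ContMDiffAt 𝓘(ℝ, E) (𝓘(ℝ, E).prod 𝓘(ℝ, FQ)) ∞
              (fun x : U => (⟨⟨x, s x⟩, x.2⟩ : opensOver (F := FQ) Q U)) m := by
            rw [← ContMDiffAt.subtypeVal_comp_iff]
            exact hs
          have h1 := ContMDiffAt.comp m
            ((𝔼.mem_isotropicSections_iff.1 χ.2).1 ⟨⟨m, s m⟩, m.2⟩) hs'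
          refine h1.congr_of_eventuallyEq (Filter.Eventually.of_forall fun x => ?_)
          exact (congrArg (TotalSpace.mk (⟨x, s x⟩ : TotalSpace FQ Q))
            (congrFun (hη x) (s x))).symm
    exact ⟨⟨η, hηs⟩, Subtype.ext (funext fun q =>
      (congrFun (hη ⟨q.1.proj, q.2⟩) q.1.2).symm)⟩
  · rintro ⟨α, rfl⟩
    exact isotropicBase_eq fun m => 𝔼.isIsotropicAt_coreSection (α.1 m)

/-- A Lagrangian splitting identifies `𝒞(𝔼)` with `Ω²(Q) ⊕ Γ(B)`. -/
def splitEquiv {S : ∀ (m : M) (q : Q m), B m →ₗ[ℝ] DQ ⟨m, q⟩} (hS : ∀ m, 𝔼.IsLagrangianAt S m)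
    (U : Opens M) : (twoForms E FQ Q U × smoothSections 𝓘(ℝ, E) FB B U)
      ≃ₗ[SmoothFun 𝓘(ℝ, E) U] 𝔼.isotropicSections U :=
  LinearEquiv.ofBijective ((𝔼.coreLinear U).coprod (𝔼.splitSection hS U)) (by
    have hb : ∀ x : twoForms E FQ Q U × smoothSections 𝓘(ℝ, E) FB B U,
        𝔼.isotropicBase U ((𝔼.coreLinear U).coprod (𝔼.splitSection hS U) x) = x.2 := by
      intro x
      rw [LinearMap.coprod_apply, map_add, (𝔼.exact_coreLinear U).apply_apply_eq_zero,
        isotropicBase_splitSection, zero_add]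
    constructor
    · intro x y h
      have h2 : x.2 = y.2 := by rw [← hb x, h, hb]
      rw [LinearMap.coprod_apply, LinearMap.coprod_apply, h2] at h
      exact Prod.ext (𝔼.coreLinear_injective U (add_right_cancel h)) h2
    · intro χ
      -- Subtracting the lift of the base section leaves a section over zero, which exactness
      -- identifies as a two-form.
      obtain ⟨α, hα⟩ := (𝔼.exact_coreLinear U
        (χ - 𝔼.splitSection hS U (𝔼.isotropicBase U χ))).1 (by
          rw [map_sub, isotropicBase_splitSection, sub_self])
      exact ⟨(α, 𝔼.isotropicBase U χ), by
        rw [LinearMap.coprod_apply, hα, sub_add_cancel]⟩)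

theorem splitEquiv_apply {S : ∀ (m : M) (q : Q m), B m →ₗ[ℝ] DQ ⟨m, q⟩}
    (hS : ∀ m, 𝔼.IsLagrangianAt S m) (U : Opens M)
    (x : twoForms E FQ Q U × smoothSections 𝓘(ℝ, E) FB B U) :
    𝔼.splitEquiv hS U x = 𝔼.coreLinear U x.1 + 𝔼.splitSection hS U x.2 := rfl

theorem isotropicBase_splitEquiv {S : ∀ (m : M) (q : Q m), B m →ₗ[ℝ] DQ ⟨m, q⟩}
    (hS : ∀ m, 𝔼.IsLagrangianAt S m) (U : Opens M)
    (x : twoForms E FQ Q U × smoothSections 𝓘(ℝ, E) FB B U) :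
    𝔼.isotropicBase U (𝔼.splitEquiv hS U x) = x.2 := by
  rw [splitEquiv_apply, map_add, (𝔼.exact_coreLinear U).apply_apply_eq_zero,
    isotropicBase_splitSection, zero_add]

end MetricDoubleVectorBundle

end SheafSequence
end

noncomputable section
-- Lagrangian splittings and sheaf splittings.
section Splittings


variable {E : Type*} [NormedAddCommGroup E] [NormedSpace ℝ E]
  {M : Type*} [TopologicalSpace M] [ChartedSpace E M]
  {FQ : Type*} [NormedAddCommGroup FQ] [NormedSpace ℝ FQ]
  {Q : M → Type*} [∀ m, AddCommGroup (Q m)] [∀ m, Module ℝ (Q m)]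
  [TopologicalSpace (TotalSpace FQ Q)] [∀ m, TopologicalSpace (Q m)]
  [FiberBundle FQ Q] [VectorBundle ℝ FQ Q]
  {FB : Type*} [NormedAddCommGroup FB] [NormedSpace ℝ FB]
  {B : M → Type*} [∀ m, AddCommGroup (B m)] [∀ m, Module ℝ (B m)]
  [TopologicalSpace (TotalSpace FB B)] [∀ m, TopologicalSpace (B m)]
  [FiberBundle FB B] [VectorBundle ℝ FB B]
  {FDQ : Type*} [NormedAddCommGroup FDQ] [NormedSpace ℝ FDQ]
  {DQ : TotalSpace FQ Q → Type*} [∀ q, AddCommGroup (DQ q)] [∀ q, Module ℝ (DQ q)]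
  [TopologicalSpace (TotalSpace FDQ DQ)] [∀ q, TopologicalSpace (DQ q)]
  [FiberBundle FDQ DQ] [VectorBundle ℝ FDQ DQ]
  {FDB : Type*} [NormedAddCommGroup FDB] [NormedSpace ℝ FDB]
  {DB : TotalSpace FB B → Type*} [∀ b, AddCommGroup (DB b)] [∀ b, Module ℝ (DB b)]
  [TopologicalSpace (TotalSpace FDB DB)] [∀ b, TopologicalSpace (DB b)]
  [FiberBundle FDB DB] [VectorBundle ℝ FDB DB]


namespace MetricDoubleVectorBundle

variable {𝔼 : MetricDoubleVectorBundle E FQ Q FB B FDQ DQ FDB DB}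

/-- The family of linear maps of a Lagrangian splitting. -/
def LagrangianSplitting.linear (σ : 𝔼.LagrangianSplitting) (m : M) (q : Q m) :
    B m →ₗ[ℝ] DQ ⟨m, q⟩ where
  toFun b := Bundle.TotalSpace.fiberAt ⟨m, q⟩ (σ.1.toFun m q b)
  map_add' b b' := by
    have h : ∀ b, (⟨⟨m, q⟩, Bundle.TotalSpace.fiberAt ⟨m, q⟩ (σ.1.toFun m q b)⟩ :
        TotalSpace FDQ DQ) = σ.1.toFun m q b :=
      fun b => Bundle.TotalSpace.mk_fiberAt (σ.1.projQ m q b)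
    have h1 := σ.1.add_right m q b b'
    rw [← h, ← h b, ← h b', 𝔼.addQ_mk] at h1
    simpa using h1
  map_smul' r b := by
    have h : ∀ b, (⟨⟨m, q⟩, Bundle.TotalSpace.fiberAt ⟨m, q⟩ (σ.1.toFun m q b)⟩ :
        TotalSpace FDQ DQ) = σ.1.toFun m q b :=
      fun b => Bundle.TotalSpace.mk_fiberAt (σ.1.projQ m q b)
    have h1 := σ.1.smul_right m r q b
    rw [← h, ← h b, 𝔼.smulQ_mk] at h1
    simpa using h1

theorem LagrangianSplitting.mk_linear (σ : 𝔼.LagrangianSplitting) (m : M) (q : Q m) (b : B m) :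
    (⟨⟨m, q⟩, σ.linear m q b⟩ : TotalSpace FDQ DQ) = σ.1.toFun m q b :=
  Bundle.TotalSpace.mk_fiberAt (σ.1.projQ m q b)

theorem LagrangianSplitting.isLagrangianAt (σ : 𝔼.LagrangianSplitting) (m : M) :
    𝔼.IsLagrangianAt σ.linear m where
  isotropic b :=
    { projB := fun q => by rw [mk_linear, ← σ.1.projB m q b]
      map_add := fun q q' => by rw [mk_linear, mk_linear, mk_linear, σ.1.add_left]
      map_smul := fun r q => by rw [mk_linear, mk_linear, σ.1.smul_left]
      isotropic := fun q q' => by rw [mk_linear, mk_linear, σ.2] }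
  smooth q b := by
    simp only [mk_linear]
    exact σ.1.smooth _

theorem LagrangianSplitting.ext_toFun {σ σ' : 𝔼.LagrangianSplitting}
    (h : ∀ m q b, σ.1.toFun m q b = σ'.1.toFun m q b) : σ = σ' := by
  obtain ⟨⟨f, _, _, _, _, _, _, _⟩, _⟩ := σ
  obtain ⟨⟨f', _, _, _, _, _, _, _⟩, _⟩ := σ'
  obtain rfl : f = f' := funext fun m => funext fun q => funext fun b => h m q b
  rfl

theorem SheafSplitting.ext_toFun {τ τ' : 𝔼.SheafSplitting}
    (h : ∀ U b, τ.toFun U b = τ'.toFun U b) : τ = τ' := by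
  obtain ⟨f, _, _⟩ := τ
  obtain ⟨f', _, _⟩ := τ'
  obtain rfl : f = f' := funext fun U => LinearMap.ext (h U)
  rfl

/-- The splitting of sheaves given by a Lagrangian splitting. -/
def LagrangianSplitting.toSheafSplitting (σ : 𝔼.LagrangianSplitting) : 𝔼.SheafSplitting where
  toFun := 𝔼.splitSection σ.isLagrangianAt
  res_toFun _ _ _ _ := rfl
  base_toFun := 𝔼.isotropicBase_splitSection σ.isLagrangianAt

variable (FB B) in
/-- The base set of the preferred trivialization at `m`. -/
def frameOpens (m : M) : Opens M :=
  ⟨(trivializationAt FB B m).baseSet, (trivializationAt FB B m).open_baseSet⟩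

variable (FB B) in
theorem mem_frameOpens (m : M) : m ∈ frameOpens FB B m := mem_baseSet_trivializationAt FB B m

section Frame

variable [ContMDiffVectorBundle ∞ FB B 𝓘(ℝ, E)]

variable (E FB B) in
/-- The section through `b` that is constant in the preferred trivialization at `m`. -/
def frameSection (m : M) (b : B m) : smoothSections 𝓘(ℝ, E) FB B (frameOpens FB B m) :=
  ⟨fun x => (trivializationAt FB B m).symm x (trivializationAt FB B m ⟨m, b⟩).2, fun x =>
    contMDiffAt_symm_along _ contMDiff_subtype_val.contMDiffAt contMDiffAt_const x.2⟩

theorem frameSection_self (m : M) (b : B m) :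
    (frameSection E FB B m b).1 ⟨m, mem_frameOpens FB B m⟩ = b :=
  (trivializationAt FB B m).symm_apply_apply_mk (mem_frameOpens FB B m) b

theorem frameSection_add (m : M) (b b' : B m) :
    frameSection E FB B m (b + b') = frameSection E FB B m b + frameSection E FB B m b' := by
  refine Subtype.ext (funext fun x => ?_)
  change (trivializationAt FB B m).symm x (trivializationAt FB B m ⟨m, b + b'⟩).2 =
    (trivializationAt FB B m).symm x (trivializationAt FB B m ⟨m, b⟩).2 +
    (trivializationAt FB B m).symm x (trivializationAt FB B m ⟨m, b'⟩).2
  rw [((trivializationAt FB B m).linear ℝ (mem_frameOpens FB B m)).map_add]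
  simp only [← (trivializationAt FB B m).coe_symmₗ (R := ℝ) x.2, map_add]

theorem frameSection_smul (m : M) (r : ℝ) (b : B m) :
    frameSection E FB B m (r • b) =
      (ContMDiffMap.const r : SmoothFun 𝓘(ℝ, E) (frameOpens FB B m)) •
        frameSection E FB B m b := by
  refine Subtype.ext (funext fun x => ?_)
  change (trivializationAt FB B m).symm x (trivializationAt FB B m ⟨m, r • b⟩).2 =
    r • (trivializationAt FB B m).symm x (trivializationAt FB B m ⟨m, b⟩).2
  rw [((trivializationAt FB B m).linear ℝ (mem_frameOpens FB B m)).map_smul]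
  simp only [← (trivializationAt FB B m).coe_symmₗ (R := ℝ) x.2, map_smul]

/-- The family of linear maps given by a splitting of sheaves. -/
def SheafSplitting.linear (τ : 𝔼.SheafSplitting) (m : M) (q : Q m) : B m →ₗ[ℝ] DQ ⟨m, q⟩ where
  toFun b := (τ.toFun _ (frameSection E FB B m b)).1 ⟨⟨m, q⟩, mem_frameOpens FB B m⟩
  map_add' b b' := by
    rw [frameSection_add, map_add]
    rfl
  map_smul' r b := by
    rw [frameSection_smul, map_smul]
    rfl

theorem smoothSections_sum_apply {EX HX X F : Type*} [NormedAddCommGroup EX] [NormedSpace ℝ EX]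
    [TopologicalSpace HX] {IX : ModelWithCorners ℝ EX HX} [TopologicalSpace X] [ChartedSpace HX X]
    [NormedAddCommGroup F] [NormedSpace ℝ F] {V : X → Type*} [∀ x, AddCommGroup (V x)]
    [∀ x, Module ℝ (V x)] [TopologicalSpace (TotalSpace F V)] [∀ x, TopologicalSpace (V x)]
    [FiberBundle F V] [VectorBundle ℝ F V] {U : Opens X} {κ : Type*} (A : Finset κ)
    (s : κ → smoothSections IX F V U) (x : U) : (∑ i ∈ A, s i).1 x = ∑ i ∈ A, (s i).1 x := by
  rw [AddSubmonoidClass.coe_finsetSum, Finset.sum_apply]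

theorem isotropicSections_sum_apply {U : Opens M} {κ : Type*} (A : Finset κ)
    (s : κ → 𝔼.isotropicSections U) (q : opensOver (F := FQ) Q U) :
    (∑ i ∈ A, s i).1 q = ∑ i ∈ A, (s i).1 q := by
  rw [AddSubmonoidClass.coe_finsetSum, Finset.sum_apply]

/-- The value of a splitting of sheaves on a section depends only on the values of the section. -/
theorem SheafSplitting.toFun_apply [FiniteDimensional ℝ FB] (τ : 𝔼.SheafSplitting) (U : Opens M)
    (b : smoothSections 𝓘(ℝ, E) FB B U) (q : opensOver (F := FQ) Q U) :
    (τ.toFun U b).1 q = τ.linear q.1.proj q.1.2 (b.1 ⟨q.1.proj, q.2⟩) := by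
  obtain ⟨⟨m, q⟩, hm⟩ := q
  change m ∈ U at hm
  let v := Module.finBasis ℝ FB
  let e := trivializationAt FB B m
  obtain ⟨s, hs, hβ⟩ := smoothSections.exists_basis (IX := 𝓘(ℝ, E)) v e (frameOpens FB B m)
    (le_refl _)
  -- The frame sections are themselves constant in the trivialization at m, so on them the claim
  -- holds by the definition of `SheafSplitting.linear`.
  have hfr : ∀ i, frameSection E FB B m ((s i).1 ⟨m, mem_frameOpens FB B m⟩) = s i := by
    intro i
    refine Subtype.ext (funext fun x => ?_)
    rw [hs, hs]
    change e.symm x (e ⟨m, e.symm m (v i)⟩).2 = _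
    rw [e.apply_mk_symm (mem_frameOpens FB B m)]
  -- Compatibility with restriction allows passing to a neighbourhood with a frame. There the
  -- section is a combination of frame sections, and C^∞-linearity replaces its coefficients by
  -- their values at m.
  let W := U ⊓ frameOpens FB B m
  have hmW : m ∈ W := ⟨hm, mem_frameOpens FB B m⟩
  obtain ⟨β, hβ⟩ := hβ W inf_le_right
  have h1 := congrFun (congrArg Subtype.val (τ.res_toFun U W inf_le_left b)) ⟨⟨m, q⟩, hmW⟩
  change (τ.toFun U b).1 ⟨⟨m, q⟩, hm⟩ = _ at h1
  rw [h1]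
  set b' := smoothSections.res 𝓘(ℝ, E) FB (inf_le_left : W ≤ U) b with hb'
  have hbm : b.1 ⟨m, hm⟩ = b'.1 ⟨m, hmW⟩ := rfl
  change _ = τ.linear m q (b.1 ⟨m, hm⟩)
  rw [hbm, ← β.sum_repr b', map_sum, isotropicSections_sum_apply, smoothSections_sum_apply,
    map_sum]
  refine Finset.sum_congr rfl fun i _ => ?_
  rw [map_smul, hβ i]
  change (β.repr b' i) ⟨m, hmW⟩ • _ = τ.linear m q ((β.repr b' i) ⟨m, hmW⟩ •
    (s i).1 ⟨m, mem_frameOpens FB B m⟩)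
  rw [map_smul, ← τ.res_toFun]
  congr 1
  change (τ.toFun _ (s i)).1 ⟨⟨m, q⟩, mem_frameOpens FB B m⟩ =
    (τ.toFun _ (frameSection E FB B m ((s i).1 ⟨m, mem_frameOpens FB B m⟩))).1
      ⟨⟨m, q⟩, mem_frameOpens FB B m⟩
  rw [hfr]

/-- Isotropy at m is that of the image of a section with prescribed value there. For smoothness in
(q, b), expand b in a local frame: the map is a finite sum of smooth coordinates of b times the
smooth images of the frame sections. -/
theorem SheafSplitting.isLagrangianAt [FiniteDimensional ℝ FB] [ContMDiffVectorBundle ∞ FQ Q 𝓘(ℝ, E)]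
    [ContMDiffVectorBundle ∞ FDQ DQ (𝓘(ℝ, E).prod 𝓘(ℝ, FQ))] (τ : 𝔼.SheafSplitting) (m : M) :
    𝔼.IsLagrangianAt τ.linear m where
  isotropic b := by
    have h := isIsotropicAt_section (τ.toFun _ (frameSection E FB B m b))
      ⟨m, mem_frameOpens FB B m⟩
    rw [τ.base_toFun, frameSection_self] at h
    exact h
  smooth q b := by
    let v := Module.finBasis ℝ FB
    let e := trivializationAt FB B m
    have hm : m ∈ e.baseSet := mem_frameOpens FB B m
    obtain ⟨s, hs, -⟩ := smoothSections.exists_basis (IX := 𝓘(ℝ, E)) v e (frameOpens FB B m)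
      (le_refl _)
    have hχ : ∀ i, ContMDiffAt (𝓘(ℝ, E).prod 𝓘(ℝ, FQ)) ((𝓘(ℝ, E).prod 𝓘(ℝ, FQ)).prod 𝓘(ℝ, FDQ)) ∞
        (fun q : TotalSpace FQ Q => (⟨q, τ.linear q.proj q.2 (e.symm q.proj (v i))⟩ :
          TotalSpace FDQ DQ)) ⟨m, q⟩ := by
      intro i
      refine (mem_smoothSections_opens_iff (U := opensOver Q (frameOpens FB B m))
        (χ := fun q => τ.linear q.proj q.2 (e.symm q.proj (v i)))).1 ?_ ⟨m, q⟩ hm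
      have h : (fun q : opensOver (F := FQ) Q (frameOpens FB B m) =>
          τ.linear q.1.proj q.1.2 (e.symm q.1.proj (v i))) = (τ.toFun _ (s i)).1 := by
        funext q
        rw [τ.toFun_apply, hs]
      exact h ▸ (𝔼.mem_isotropicSections_iff.1 (τ.toFun _ (s i)).2).1
    have hc := contMDiffAt_coord_along e
      (contMDiffAt_snd_along (E := E) (FQ := FQ) (x₀ := ⟨m, (q, b)⟩)) hm
    have h := contMDiffAt_sum_along (κ := Fin (Module.finrank ℝ FB)) Finset.univ
      (contMDiffAt_fst_along (E := E) (FB := FB) (x₀ := ⟨m, (q, b)⟩)) (fun i _ =>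
      contMDiffAt_smul_along (((v.coord i).toContinuousLinearMap).contMDiff.contMDiffAt.comp _ hc)
        (ContMDiffAt.comp (⟨m, (q, b)⟩ : TotalSpace (FQ × FB) (Q ×ᵇ B)) (hχ i)
          contMDiffAt_fst_along))
    refine h.congr_of_eventuallyEq ?_
    have hpr : ContinuousAt (TotalSpace.proj : TotalSpace (FQ × FB) (Q ×ᵇ B) → M) ⟨m, (q, b)⟩ :=
      (FiberBundle.continuous_proj (FQ × FB) (Q ×ᵇ B)).continuousAt
    filter_upwards [hpr.preimage_mem_nhds (e.open_baseSet.mem_nhds hm)] with y hy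
    refine congrArg (TotalSpace.mk (⟨y.proj, y.2.1⟩ : TotalSpace FQ Q)) ?_
    have hy' : y.2.2 = ∑ i, v.coord i (e ⟨y.proj, y.2.2⟩).2 • e.symm y.proj (v i) := by
      simp only [← e.coe_symmₗ (R := ℝ) hy, ← map_smul, ← map_sum, Module.Basis.coord_apply,
        v.sum_repr]
      rw [e.coe_symmₗ hy]
      exact (e.symm_apply_apply_mk hy _).symm
    conv_lhs => rw [hy', map_sum]
    simp only [map_smul]
    rfl

/-- Lagrangian splittings are the same as splittings of sheaves. -/
def splittingEquiv [FiniteDimensional ℝ FB] [ContMDiffVectorBundle ∞ FQ Q 𝓘(ℝ, E)]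
    [ContMDiffVectorBundle ∞ FDQ DQ (𝓘(ℝ, E).prod 𝓘(ℝ, FQ))] :
    𝔼.LagrangianSplitting ≃ 𝔼.SheafSplitting where
  toFun σ := σ.toSheafSplitting
  invFun τ := IsLagrangianAt.splitting τ.isLagrangianAt
  left_inv σ := LagrangianSplitting.ext_toFun fun m q b => by
    refine Eq.trans ?_ (σ.mk_linear m q b)
    change (⟨⟨m, q⟩, σ.linear m q ((frameSection E FB B m b).1 ⟨m, mem_frameOpens FB B m⟩)⟩ :
      TotalSpace FDQ DQ) = _
    rw [frameSection_self]
  right_inv τ := SheafSplitting.ext_toFun fun U b => Subtype.ext (funext fun q => by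
    rw [τ.toFun_apply]
    change (IsLagrangianAt.splitting τ.isLagrangianAt).linear _ _ _ = _
    have h : (⟨⟨q.1.proj, q.1.2⟩, (IsLagrangianAt.splitting τ.isLagrangianAt).linear _ _
        (b.1 ⟨q.1.proj, q.2⟩)⟩ : TotalSpace FDQ DQ) =
        ⟨⟨q.1.proj, q.1.2⟩, τ.linear _ _ (b.1 ⟨q.1.proj, q.2⟩)⟩ :=
      (IsLagrangianAt.splitting τ.isLagrangianAt).mk_linear q.1.proj q.1.2 (b.1 ⟨q.1.proj, q.2⟩)
    simpa using h)

end Frame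

end MetricDoubleVectorBundle

end Splittings
end

noncomputable section
-- Sections of a direct sum, and its model with Euclidean fibre.
section SectionEquivalences

variable {EX : Type*} [NormedAddCommGroup EX] [NormedSpace ℝ EX]
  {HX : Type*} [TopologicalSpace HX] {IX : ModelWithCorners ℝ EX HX}
  {X : Type*} [TopologicalSpace X] [ChartedSpace HX X]
  {F : Type*} [NormedAddCommGroup F] [NormedSpace ℝ F]
  {V : X → Type*} [∀ x, AddCommGroup (V x)] [∀ x, Module ℝ (V x)]
  [TopologicalSpace (TotalSpace F V)] [∀ x, TopologicalSpace (V x)]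
  [FiberBundle F V] [VectorBundle ℝ F V]
  {F' : Type*} [NormedAddCommGroup F'] [NormedSpace ℝ F']
  {V' : X → Type*} [∀ x, AddCommGroup (V' x)] [∀ x, Module ℝ (V' x)]
  [TopologicalSpace (TotalSpace F' V')] [∀ x, TopologicalSpace (V' x)]
  [FiberBundle F' V'] [VectorBundle ℝ F' V']

/-- The sections of a vector bundle are those of its model. -/
def smoothSectionsModelEquiv (L : F ≃L[ℝ] F') (U : Opens X) :
    smoothSections IX F V U ≃ₗ[SmoothFun IX U] smoothSections IX F' (modelCore F V L).Fiber U where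
  toFun s := ⟨fun x => toModel F V L x (s.1 x), fun x => (contMDiffAt_toModel_iff L).2 (s.2 x)⟩
  map_add' _ _ := Subtype.ext (funext fun x => (toModel F V L x).map_add _ _)
  map_smul' _ _ := Subtype.ext (funext fun x => (toModel F V L x).map_smul _ _)
  invFun t := ⟨fun x => (toModel F V L x).symm (t.1 x), fun x =>
    (contMDiffAt_toModel_iff L).1 (by
      simp only [LinearEquiv.apply_symm_apply]
      exact t.2 x)⟩
  left_inv _ := Subtype.ext (funext fun x => (toModel F V L x).symm_apply_apply _)
  right_inv _ := Subtype.ext (funext fun x => (toModel F V L x).apply_symm_apply _)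

/-- The sections of a direct sum of vector bundles over a manifold without boundary are the pairs of
sections. -/
def smoothSectionsProdEquiv {M : Type*} [TopologicalSpace M] [ChartedSpace EX M]
    {V : M → Type*} [∀ x, AddCommGroup (V x)] [∀ x, Module ℝ (V x)]
    [TopologicalSpace (TotalSpace F V)] [∀ x, TopologicalSpace (V x)]
    [FiberBundle F V] [VectorBundle ℝ F V]
    {V' : M → Type*} [∀ x, AddCommGroup (V' x)] [∀ x, Module ℝ (V' x)]
    [TopologicalSpace (TotalSpace F' V')] [∀ x, TopologicalSpace (V' x)]
    [FiberBundle F' V'] [VectorBundle ℝ F' V'] (U : Opens M) :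
    smoothSections 𝓘(ℝ, EX) (F × F') (V ×ᵇ V') U ≃ₗ[SmoothFun 𝓘(ℝ, EX) U]
      (smoothSections 𝓘(ℝ, EX) F V U × smoothSections 𝓘(ℝ, EX) F' V' U) where
  toFun s := (⟨fun x => (s.1 x).1, fun x =>
      ContMDiffAt.comp x (contMDiffAt_fst_along (E := EX) (FB := F')) (s.2 x)⟩,
    ⟨fun x => (s.1 x).2, fun x =>
      ContMDiffAt.comp x (contMDiffAt_snd_along (E := EX) (FQ := F)) (s.2 x)⟩)
  map_add' _ _ := rfl
  map_smul' _ _ := rfl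
  invFun t := ⟨fun x => (t.1.1 x, t.2.1 x), fun x => contMDiffAt_prod_along (t.1.2 x) (t.2.2 x)⟩
  left_inv _ := rfl
  right_inv _ := rfl

section ModelSum

variable {M : Type*} [TopologicalSpace M] [ChartedSpace EX M]
  {V : M → Type*} [∀ x, AddCommGroup (V x)] [∀ x, Module ℝ (V x)]
  [TopologicalSpace (TotalSpace F V)] [∀ x, TopologicalSpace (V x)]
  [FiberBundle F V] [VectorBundle ℝ F V]
  {V' : M → Type*} [∀ x, AddCommGroup (V' x)] [∀ x, Module ℝ (V' x)]
  [TopologicalSpace (TotalSpace F' V')] [∀ x, TopologicalSpace (V' x)]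
  [FiberBundle F' V'] [VectorBundle ℝ F' V']
  {K : Type*} [NormedAddCommGroup K] [NormedSpace ℝ K] (L : (F × F') ≃L[ℝ] K)

variable (V V') in
/-- The inclusion of a vector bundle into the model of a direct sum. -/
def modelInl (m : M) : V m →ₗ[ℝ] (modelCore (F × F') (V ×ᵇ V') L).Fiber m :=
  (toModel (F × F') (V ×ᵇ V') L m).toLinearMap ∘ₗ LinearMap.inl ℝ (V m) (V' m)

variable (V V') in
/-- The projection of the model of a direct sum to the second summand. -/
def modelSnd (m : M) : (modelCore (F × F') (V ×ᵇ V') L).Fiber m →ₗ[ℝ] V' m :=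
  LinearMap.snd ℝ (V m) (V' m) ∘ₗ (toModel (F × F') (V ×ᵇ V') L m).symm.toLinearMap

theorem contMDiff_modelInl : ContMDiff (𝓘(ℝ, EX).prod 𝓘(ℝ, F)) (𝓘(ℝ, EX).prod 𝓘(ℝ, K)) ∞
    (fun x : TotalSpace F V => (⟨x.proj, modelInl V V' L x.proj x.2⟩ :
      TotalSpace K (modelCore (F × F') (V ×ᵇ V') L).Fiber)) := by
  intro x
  have h : ContMDiffAt (𝓘(ℝ, EX).prod 𝓘(ℝ, F)) (𝓘(ℝ, EX).prod 𝓘(ℝ, F × F')) ∞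
      (fun x : TotalSpace F V => (⟨x.proj, (x.2, 0)⟩ : TotalSpace (F × F') (V ×ᵇ V'))) x :=
    contMDiffAt_prod_along (p := fun x : TotalSpace F V => x.proj) (s := fun x => x.2)
      (t := fun x => (0 : V' x.proj)) contMDiffAt_id
      (contMDiffAt_zero_along (contMDiffAt_proj V))
  exact (contMDiffAt_toModel_iff L).2 h

theorem contMDiff_modelSnd : ContMDiff (𝓘(ℝ, EX).prod 𝓘(ℝ, K)) (𝓘(ℝ, EX).prod 𝓘(ℝ, F')) ∞
    (fun x : TotalSpace K (modelCore (F × F') (V ×ᵇ V') L).Fiber =>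
      (⟨x.proj, modelSnd V V' L x.proj x.2⟩ : TotalSpace F' V')) := by
  intro x
  have h : ContMDiffAt (𝓘(ℝ, EX).prod 𝓘(ℝ, K)) (𝓘(ℝ, EX).prod 𝓘(ℝ, F × F')) ∞
      (fun x : TotalSpace K (modelCore (F × F') (V ×ᵇ V') L).Fiber =>
        (⟨x.proj, (toModel (F × F') (V ×ᵇ V') L x.proj).symm x.2⟩ :
          TotalSpace (F × F') (V ×ᵇ V'))) x := by
    refine (contMDiffAt_toModel_iff L).1 ?_
    simp only [LinearEquiv.apply_symm_apply]
    exact contMDiffAt_id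
  exact ContMDiffAt.comp x contMDiffAt_snd_along h

theorem modelInl_injective (m : M) : Function.Injective (modelInl V V' L m) :=
  (toModel (F × F') (V ×ᵇ V') L m).injective.comp LinearMap.inl_injective

theorem modelSnd_surjective (m : M) : Function.Surjective (modelSnd V V' L m) :=
  Prod.snd_surjective.comp (toModel (F × F') (V ×ᵇ V') L m).symm.surjective

theorem exact_modelInl_modelSnd (m : M) :
    Function.Exact (modelInl V V' L m) (modelSnd V V' L m) := by
  intro y
  constructor
  · intro h
    refine ⟨((toModel (F × F') (V ×ᵇ V') L m).symm y).1, ?_⟩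
    change toModel (F × F') (V ×ᵇ V') L m (((toModel (F × F') (V ×ᵇ V') L m).symm y).1, 0) = y
    rw [← (show ((toModel (F × F') (V ×ᵇ V') L m).symm y).2 = 0 from h)]
    exact (toModel (F × F') (V ×ᵇ V') L m).apply_symm_apply y
  · rintro ⟨a, rfl⟩
    change ((toModel (F × F') (V ×ᵇ V') L m).symm (toModel (F × F') (V ×ᵇ V') L m (a, 0))).2 = 0
    rw [LinearEquiv.symm_apply_apply]

/-- The bundle is V ⊕ V' transported to a Euclidean model fibre. Fibres of a vector bundle core are
copies of the model fibre, so they lie in `Type` whatever the universes of V and V'; the maps are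
the inclusion and projection of the sum. -/
theorem exists_bundle_sections_prod {M : Type*} [TopologicalSpace M] [ChartedSpace EX M]
    [FiniteDimensional ℝ F] [FiniteDimensional ℝ F']
    (V : M → Type*) [∀ x, AddCommGroup (V x)] [∀ x, Module ℝ (V x)]
    [TopologicalSpace (TotalSpace F V)] [∀ x, TopologicalSpace (V x)]
    [FiberBundle F V] [VectorBundle ℝ F V] [ContMDiffVectorBundle ∞ F V 𝓘(ℝ, EX)]
    (V' : M → Type*) [∀ x, AddCommGroup (V' x)] [∀ x, Module ℝ (V' x)]
    [TopologicalSpace (TotalSpace F' V')] [∀ x, TopologicalSpace (V' x)]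
    [FiberBundle F' V'] [VectorBundle ℝ F' V'] [ContMDiffVectorBundle ∞ F' V' 𝓘(ℝ, EX)] :
    ∃ (r : ℕ) (Bh : M → Type) (_ : ∀ m, AddCommGroup (Bh m)) (_ : ∀ m, Module ℝ (Bh m))
      (_ : TopologicalSpace (TotalSpace (EuclideanSpace ℝ (Fin r)) Bh))
      (_ : ∀ m, TopologicalSpace (Bh m))
      (_ : FiberBundle (EuclideanSpace ℝ (Fin r)) Bh)
      (_ : VectorBundle ℝ (EuclideanSpace ℝ (Fin r)) Bh)
      (_ : ContMDiffVectorBundle ∞ (EuclideanSpace ℝ (Fin r)) Bh 𝓘(ℝ, EX))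
      (Λ : ∀ U : Opens M, smoothSections 𝓘(ℝ, EX) (EuclideanSpace ℝ (Fin r)) Bh U
        ≃ₗ[SmoothFun 𝓘(ℝ, EX) U]
          (smoothSections 𝓘(ℝ, EX) F V U × smoothSections 𝓘(ℝ, EX) F' V' U))
      (j : ∀ m, V m →ₗ[ℝ] Bh m) (p : ∀ m, Bh m →ₗ[ℝ] V' m),
      (∀ (U W : Opens M) (h : W ≤ U)
        (s : smoothSections 𝓘(ℝ, EX) (EuclideanSpace ℝ (Fin r)) Bh U),
        Λ W (smoothSections.res 𝓘(ℝ, EX) (EuclideanSpace ℝ (Fin r)) h s) =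
          (smoothSections.res 𝓘(ℝ, EX) F h (Λ U s).1,
            smoothSections.res 𝓘(ℝ, EX) F' h (Λ U s).2)) ∧
      ContMDiff (𝓘(ℝ, EX).prod 𝓘(ℝ, F)) (𝓘(ℝ, EX).prod 𝓘(ℝ, EuclideanSpace ℝ (Fin r))) ∞
        (fun x : TotalSpace F V =>
            (⟨x.proj, j x.proj x.2⟩ : TotalSpace (EuclideanSpace ℝ (Fin r)) Bh)) ∧
      ContMDiff (𝓘(ℝ, EX).prod 𝓘(ℝ, EuclideanSpace ℝ (Fin r))) (𝓘(ℝ, EX).prod 𝓘(ℝ, F')) ∞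
        (fun x : TotalSpace (EuclideanSpace ℝ (Fin r)) Bh =>
          (⟨x.proj, p x.proj x.2⟩ : TotalSpace F' V')) ∧
      (∀ m, Function.Injective (j m) ∧ Function.Exact (j m) (p m) ∧
        Function.Surjective (p m)) ∧
      (∀ (U : Opens M) (α : smoothSections 𝓘(ℝ, EX) F V U) (m : U),
        ((Λ U).symm (α, 0)).1 m = j m (α.1 m)) ∧
      (∀ (U : Opens M) (s : smoothSections 𝓘(ℝ, EX) (EuclideanSpace ℝ (Fin r)) Bh U) (m : U),
        (Λ U s).2.1 m = p m (s.1 m)) := by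
  let L : (F × F') ≃L[ℝ] EuclideanSpace ℝ (Fin (Module.finrank ℝ (F × F'))) :=
    ContinuousLinearEquiv.ofFinrankEq (by simp)
  exact ⟨_, (modelCore _ (V ×ᵇ V') L).Fiber, inferInstance, inferInstance,
    inferInstance, inferInstance, inferInstance, inferInstance, inferInstance,
    fun U => (smoothSectionsModelEquiv (V := V ×ᵇ V') L U).symm.trans (smoothSectionsProdEquiv U),
    modelInl V V' L, modelSnd V V' L, fun U W h s => rfl, contMDiff_modelInl L,
    contMDiff_modelSnd L,
    fun m => ⟨modelInl_injective L m, exact_modelInl_modelSnd L m, modelSnd_surjective L m⟩,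
    fun U α m => rfl, fun U s m => rfl⟩

end ModelSum

end SectionEquivalences

/-! ### Local freeness of 𝒞(𝔼) and the vector bundle B̂. -/

section BundleOfIsotropicSections


variable {E : Type*} [NormedAddCommGroup E] [NormedSpace ℝ E]
  {M : Type*} [TopologicalSpace M] [ChartedSpace E M]
  {FQ : Type*} [NormedAddCommGroup FQ] [NormedSpace ℝ FQ]
  {Q : M → Type*} [∀ m, AddCommGroup (Q m)] [∀ m, Module ℝ (Q m)]
  [TopologicalSpace (TotalSpace FQ Q)] [∀ m, TopologicalSpace (Q m)]
  [FiberBundle FQ Q] [VectorBundle ℝ FQ Q]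
  {FB : Type*} [NormedAddCommGroup FB] [NormedSpace ℝ FB]
  {B : M → Type*} [∀ m, AddCommGroup (B m)] [∀ m, Module ℝ (B m)]
  [TopologicalSpace (TotalSpace FB B)] [∀ m, TopologicalSpace (B m)]
  [FiberBundle FB B] [VectorBundle ℝ FB B]
  {FDQ : Type*} [NormedAddCommGroup FDQ] [NormedSpace ℝ FDQ]
  {DQ : TotalSpace FQ Q → Type*} [∀ q, AddCommGroup (DQ q)] [∀ q, Module ℝ (DQ q)]
  [TopologicalSpace (TotalSpace FDQ DQ)] [∀ q, TopologicalSpace (DQ q)]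
  [FiberBundle FDQ DQ] [VectorBundle ℝ FDQ DQ]
  {FDB : Type*} [NormedAddCommGroup FDB] [NormedSpace ℝ FDB]
  {DB : TotalSpace FB B → Type*} [∀ b, AddCommGroup (DB b)] [∀ b, Module ℝ (DB b)]
  [TopologicalSpace (TotalSpace FDB DB)] [∀ b, TopologicalSpace (DB b)]
  [FiberBundle FDB DB] [VectorBundle ℝ FDB DB]

variable [FiniteDimensional ℝ FQ] [FiniteDimensional ℝ FDB]
  [ContMDiffVectorBundle ∞ FQ Q 𝓘(ℝ, E)] [ContMDiffVectorBundle ∞ FB B 𝓘(ℝ, E)]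
  [ContMDiffVectorBundle ∞ FDQ DQ (𝓘(ℝ, E).prod 𝓘(ℝ, FQ))]
  [ContMDiffVectorBundle ∞ FDB DB (𝓘(ℝ, E).prod 𝓘(ℝ, FB))]

namespace MetricDoubleVectorBundle

variable (𝔼 : MetricDoubleVectorBundle E FQ Q FB B FDQ DQ FDB DB)

variable (E FQ Q FB B) in
/-- The sections of `(Q^* ∧ Q^*) ⊕ B` are pairs of a two-form and a section of `B`. -/
def twoFormsProdEquiv (U : Opens M) :
    smoothSections 𝓘(ℝ, E) ((FQ [⋀^Fin 2]→L[ℝ] ℝ) × FB)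
        ((fun m => Q m [⋀^Fin 2]→L[ℝ] Bundle.Trivial M ℝ m) ×ᵇ B) U
      ≃ₗ[SmoothFun 𝓘(ℝ, E) U] (twoForms E FQ Q U × smoothSections 𝓘(ℝ, E) FB B U) :=
  smoothSectionsProdEquiv (V := fun m => Q m [⋀^Fin 2]→L[ℝ] Bundle.Trivial M ℝ m) (V' := B) U

/-- A Lagrangian splitting identifies `𝒞(𝔼)` with the sections of `(Q^* ∧ Q^*) ⊕ B`. -/
def sectionsEquiv {S : ∀ (m : M) (q : Q m), B m →ₗ[ℝ] DQ ⟨m, q⟩} (hS : ∀ m, 𝔼.IsLagrangianAt S m)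
    (U : Opens M) :
    smoothSections 𝓘(ℝ, E) ((FQ [⋀^Fin 2]→L[ℝ] ℝ) × FB)
        ((fun m => Q m [⋀^Fin 2]→L[ℝ] Bundle.Trivial M ℝ m) ×ᵇ B) U
      ≃ₗ[SmoothFun 𝓘(ℝ, E) U] 𝔼.isotropicSections U :=
  (twoFormsProdEquiv E FQ Q FB B U).trans (𝔼.splitEquiv hS U)

theorem isotropicRes_sectionsEquiv {S : ∀ (m : M) (q : Q m), B m →ₗ[ℝ] DQ ⟨m, q⟩}
    (hS : ∀ m, 𝔼.IsLagrangianAt S m) {U W : Opens M} (h : W ≤ U)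
    (s : smoothSections 𝓘(ℝ, E) ((FQ [⋀^Fin 2]→L[ℝ] ℝ) × FB)
      ((fun m => Q m [⋀^Fin 2]→L[ℝ] Bundle.Trivial M ℝ m) ×ᵇ B) U) :
    𝔼.isotropicRes h (𝔼.sectionsEquiv hS U s) =
      𝔼.sectionsEquiv hS W (smoothSections.res 𝓘(ℝ, E) ((FQ [⋀^Fin 2]→L[ℝ] ℝ) × FB)
        (V := (fun m => Q m [⋀^Fin 2]→L[ℝ] Bundle.Trivial M ℝ m) ×ᵇ B) h s) := rfl

/-- A local frame of (Q^* ∧ Q^*) ⊕ B, carried over by the splitting; the identification commutes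
with restriction. -/
theorem exists_basis_isotropicSections [FiniteDimensional ℝ FB]
    {S : ∀ (m : M) (q : Q m), B m →ₗ[ℝ] DQ ⟨m, q⟩} (hS : ∀ m, 𝔼.IsLagrangianAt S m) (p : M) :
    ∃ (U : Opens M) (_ : p ∈ U) (n : ℕ) (χ : Fin n → 𝔼.isotropicSections U),
      ∀ (W : Opens M) (h : W ≤ U),
        ∃ β : Module.Basis (Fin n) (SmoothFun 𝓘(ℝ, E) W) (𝔼.isotropicSections W),
          ∀ i, β i = 𝔼.isotropicRes h (χ i) := by
  let e := trivializationAt ((FQ [⋀^Fin 2]→L[ℝ] ℝ) × FB)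
    ((fun m => Q m [⋀^Fin 2]→L[ℝ] Bundle.Trivial M ℝ m) ×ᵇ B) p
  let U : Opens M := ⟨e.baseSet, e.open_baseSet⟩
  obtain ⟨s, -, hβ⟩ := smoothSections.exists_basis (IX := 𝓘(ℝ, E))
    (Module.finBasis ℝ ((FQ [⋀^Fin 2]→L[ℝ] ℝ) × FB)) e U (le_refl _)
  refine ⟨U, mem_baseSet_trivializationAt _ _ p, _, fun i => 𝔼.sectionsEquiv hS U (s i),
    fun W h => ?_⟩
  obtain ⟨β, hβ⟩ := hβ W h
  refine ⟨β.map (𝔼.sectionsEquiv hS W), fun i => ?_⟩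
  rw [Module.Basis.map_apply, hβ, isotropicRes_sectionsEquiv]

/-- The splitting sends (α, 0) to the core-linear section of α, and the base section of the image of
(α, b) is b. So the sequence of the direct sum induces the sequence of sheaves. -/
theorem exists_bundle_isotropicSections [FiniteDimensional ℝ FB]
    {S : ∀ (m : M) (q : Q m), B m →ₗ[ℝ] DQ ⟨m, q⟩} (hS : ∀ m, 𝔼.IsLagrangianAt S m) :
    ∃ (r : ℕ) (Bh : M → Type) (_ : ∀ m, AddCommGroup (Bh m)) (_ : ∀ m, Module ℝ (Bh m))
      (_ : TopologicalSpace (TotalSpace (EuclideanSpace ℝ (Fin r)) Bh))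
      (_ : ∀ m, TopologicalSpace (Bh m))
      (_ : FiberBundle (EuclideanSpace ℝ (Fin r)) Bh)
      (_ : VectorBundle ℝ (EuclideanSpace ℝ (Fin r)) Bh)
      (_ : ContMDiffVectorBundle ∞ (EuclideanSpace ℝ (Fin r)) Bh 𝓘(ℝ, E))
      (Ψ : ∀ U : Opens M, smoothSections 𝓘(ℝ, E) (EuclideanSpace ℝ (Fin r)) Bh U
        ≃ₗ[SmoothFun 𝓘(ℝ, E) U] 𝔼.isotropicSections U)
      (j : ∀ m, (Q m [⋀^Fin 2]→L[ℝ] Bundle.Trivial M ℝ m) →ₗ[ℝ] Bh m)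
      (p : ∀ m, Bh m →ₗ[ℝ] B m),
      (∀ (U W : Opens M) (h : W ≤ U)
        (s : smoothSections 𝓘(ℝ, E) (EuclideanSpace ℝ (Fin r)) Bh U),
        𝔼.isotropicRes h (Ψ U s) = Ψ W (smoothSections.res 𝓘(ℝ, E) (EuclideanSpace ℝ (Fin r)) h s)) ∧
      ContMDiff (𝓘(ℝ, E).prod 𝓘(ℝ, FQ [⋀^Fin 2]→L[ℝ] ℝ))
        (𝓘(ℝ, E).prod 𝓘(ℝ, EuclideanSpace ℝ (Fin r))) ∞
        (fun x : TotalSpace (FQ [⋀^Fin 2]→L[ℝ] ℝ)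
          (fun m => Q m [⋀^Fin 2]→L[ℝ] Bundle.Trivial M ℝ m) =>
            (⟨x.proj, j x.proj x.2⟩ : TotalSpace (EuclideanSpace ℝ (Fin r)) Bh)) ∧
      ContMDiff (𝓘(ℝ, E).prod 𝓘(ℝ, EuclideanSpace ℝ (Fin r))) (𝓘(ℝ, E).prod 𝓘(ℝ, FB)) ∞
        (fun x : TotalSpace (EuclideanSpace ℝ (Fin r)) Bh =>
          (⟨x.proj, p x.proj x.2⟩ : TotalSpace FB B)) ∧
      (∀ m, Function.Injective (j m) ∧ Function.Exact (j m) (p m) ∧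
        Function.Surjective (p m)) ∧
      (∀ (U : Opens M) (α : twoForms E FQ Q U) (m : U),
        ((Ψ U).symm (𝔼.coreLinear U α)).1 m = j m (α.1 m)) ∧
      (∀ (U : Opens M) (s : smoothSections 𝓘(ℝ, E) (EuclideanSpace ℝ (Fin r)) Bh U) (m : U),
        (𝔼.isotropicBase U (Ψ U s)).1 m = p m (s.1 m)) := by
  obtain ⟨r, Bh, i₁, i₂, i₃, i₄, i₅, i₆, i₇, Λ, j, p, hΛ, hj, hp, he, hΛj, hΛp⟩ :=
    exists_bundle_sections_prod (EX := E) (F := FQ [⋀^Fin 2]→L[ℝ] ℝ) (F' := FB)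
      (fun m => Q m [⋀^Fin 2]→L[ℝ] Bundle.Trivial M ℝ m) B
  refine ⟨r, Bh, i₁, i₂, i₃, i₄, i₅, i₆, i₇, fun U => (Λ U).trans (𝔼.splitEquiv hS U), j, p,
    fun U W h s => ?_, hj, hp, he, fun U α m => ?_, fun U s m => ?_⟩
  · rw [LinearEquiv.trans_apply, LinearEquiv.trans_apply, hΛ U W h s]
    rfl
  · have h : 𝔼.coreLinear U α = 𝔼.splitEquiv hS U (α, 0) := by
      rw [splitEquiv_apply, map_zero, add_zero]
    rw [h, LinearEquiv.trans_symm, LinearEquiv.trans_apply, LinearEquiv.symm_apply_apply, hΛj]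
  · rw [LinearEquiv.trans_apply, isotropicBase_splitEquiv, hΛp]

end MetricDoubleVectorBundle

end BundleOfIsotropicSections
end

theorem proposition3p8
    {E : Type*} [NormedAddCommGroup E] [NormedSpace ℝ E] [FiniteDimensional ℝ E]
    {M : Type*} [TopologicalSpace M] [T2Space M] [SecondCountableTopology M]
    [ChartedSpace E M] [IsManifold 𝓘(ℝ, E) ∞ M]
    {FQ : Type*} [NormedAddCommGroup FQ] [NormedSpace ℝ FQ] [FiniteDimensional ℝ FQ]
    {Q : M → Type*} [∀ m, AddCommGroup (Q m)] [∀ m, Module ℝ (Q m)]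
    [TopologicalSpace (TotalSpace FQ Q)] [∀ m, TopologicalSpace (Q m)]
    [FiberBundle FQ Q] [VectorBundle ℝ FQ Q] [ContMDiffVectorBundle ∞ FQ Q 𝓘(ℝ, E)]
    {FB : Type*} [NormedAddCommGroup FB] [NormedSpace ℝ FB] [FiniteDimensional ℝ FB]
    {B : M → Type*} [∀ m, AddCommGroup (B m)] [∀ m, Module ℝ (B m)]
    [TopologicalSpace (TotalSpace FB B)] [∀ m, TopologicalSpace (B m)]
    [FiberBundle FB B] [VectorBundle ℝ FB B] [ContMDiffVectorBundle ∞ FB B 𝓘(ℝ, E)]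
    {FDQ : Type*} [NormedAddCommGroup FDQ] [NormedSpace ℝ FDQ] [FiniteDimensional ℝ FDQ]
    {DQ : TotalSpace FQ Q → Type*} [∀ q, AddCommGroup (DQ q)] [∀ q, Module ℝ (DQ q)]
    [TopologicalSpace (TotalSpace FDQ DQ)] [∀ q, TopologicalSpace (DQ q)]
    [FiberBundle FDQ DQ] [VectorBundle ℝ FDQ DQ]
    [ContMDiffVectorBundle ∞ FDQ DQ (𝓘(ℝ, E).prod 𝓘(ℝ, FQ))]
    {FDB : Type*} [NormedAddCommGroup FDB] [NormedSpace ℝ FDB] [FiniteDimensional ℝ FDB]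
    {DB : TotalSpace FB B → Type*} [∀ b, AddCommGroup (DB b)] [∀ b, Module ℝ (DB b)]
    [TopologicalSpace (TotalSpace FDB DB)] [∀ b, TopologicalSpace (DB b)]
    [FiberBundle FDB DB] [VectorBundle ℝ FDB DB]
    [ContMDiffVectorBundle ∞ FDB DB (𝓘(ℝ, E).prod 𝓘(ℝ, FB))]
    (𝔼 : MetricDoubleVectorBundle E FQ Q FB B FDQ DQ FDB DB) :
    -- `𝒞(𝔼)` is a sheaf
    (∀ (κ : Type*) (𝒰 : κ → Opens M) (χ : ∀ i, 𝔼.isotropicSections (𝒰 i)),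
      (∀ i j, 𝔼.isotropicRes (inf_le_left : 𝒰 i ⊓ 𝒰 j ≤ 𝒰 i) (χ i) =
        𝔼.isotropicRes (inf_le_right : 𝒰 i ⊓ 𝒰 j ≤ 𝒰 j) (χ j)) →
      ∃! s : 𝔼.isotropicSections (⨆ i, 𝒰 i), ∀ i, 𝔼.isotropicRes (le_iSup 𝒰 i) s = χ i) ∧
    -- it is locally free and finitely generated
    (∀ p : M, ∃ (U : Opens M) (_ : p ∈ U) (n : ℕ) (χ : Fin n → 𝔼.isotropicSections U),
      ∀ (W : Opens M) (h : W ≤ U),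
        ∃ β : Module.Basis (Fin n) (SmoothFun 𝓘(ℝ, E) W) (𝔼.isotropicSections W),
          ∀ i, β i = 𝔼.isotropicRes h (χ i)) ∧
    -- the short exact sequence of sheaves of modules
    ∃ ι : ∀ U : Opens M, twoForms E FQ Q U →ₗ[SmoothFun 𝓘(ℝ, E) U] 𝔼.isotropicSections U,
      (∀ U α, 𝔼.IsCoreLinear α (ι U α).1) ∧
      (∀ (U W : Opens M) (h : W ≤ U) (α : twoForms E FQ Q U),
        𝔼.isotropicRes h (ι U α) = ι W (twoForms.res h α)) ∧
      (∀ (U W : Opens M) (h : W ≤ U) (χ : 𝔼.isotropicSections U),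
        𝔼.isotropicBase W (𝔼.isotropicRes h χ) =
          smoothSections.res 𝓘(ℝ, E) FB h (𝔼.isotropicBase U χ)) ∧
      (∀ U, Function.Injective (ι U) ∧ Function.Exact (ι U) (𝔼.isotropicBase U) ∧
        Function.Surjective (𝔼.isotropicBase U)) ∧
      -- Lagrangian splittings are equivalent to splittings of the sequence
      (∃ Θ : 𝔼.LagrangianSplitting ≃ 𝔼.SheafSplitting,
        ∀ (σ : 𝔼.LagrangianSplitting) (U : Opens M) (b : smoothSections 𝓘(ℝ, E) FB B U)
          (m : U) (q : Q m),
          sectionValue ((Θ σ).toFun U b).1 m q = σ.1.toFun m q (b.1 m)) ∧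
      -- the vector bundle with sections `𝒞(𝔼)` and the short exact sequence of vector bundles
      ∃ (r : ℕ) (Bh : M → Type) (_ : ∀ m, AddCommGroup (Bh m)) (_ : ∀ m, Module ℝ (Bh m))
        (_ : TopologicalSpace (TotalSpace (EuclideanSpace ℝ (Fin r)) Bh))
        (_ : ∀ m, TopologicalSpace (Bh m))
        (_ : FiberBundle (EuclideanSpace ℝ (Fin r)) Bh)
        (_ : VectorBundle ℝ (EuclideanSpace ℝ (Fin r)) Bh)
        (_ : ContMDiffVectorBundle ∞ (EuclideanSpace ℝ (Fin r)) Bh 𝓘(ℝ, E))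
        (Ψ : ∀ U : Opens M, smoothSections 𝓘(ℝ, E) (EuclideanSpace ℝ (Fin r)) Bh U
          ≃ₗ[SmoothFun 𝓘(ℝ, E) U] 𝔼.isotropicSections U)
        (j : ∀ m, (Q m [⋀^Fin 2]→L[ℝ] Bundle.Trivial M ℝ m) →ₗ[ℝ] Bh m)
        (p : ∀ m, Bh m →ₗ[ℝ] B m),
        (∀ (U W : Opens M) (h : W ≤ U)
          (s : smoothSections 𝓘(ℝ, E) (EuclideanSpace ℝ (Fin r)) Bh U),
          𝔼.isotropicRes h (Ψ U s) = Ψ W (smoothSections.res 𝓘(ℝ, E) (EuclideanSpace ℝ (Fin r)) h s)) ∧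
        ContMDiff (𝓘(ℝ, E).prod 𝓘(ℝ, FQ [⋀^Fin 2]→L[ℝ] ℝ))
          (𝓘(ℝ, E).prod 𝓘(ℝ, EuclideanSpace ℝ (Fin r))) ∞
          (fun x : TotalSpace (FQ [⋀^Fin 2]→L[ℝ] ℝ)
            (fun m => Q m [⋀^Fin 2]→L[ℝ] Bundle.Trivial M ℝ m) =>
              (⟨x.proj, j x.proj x.2⟩ : TotalSpace (EuclideanSpace ℝ (Fin r)) Bh)) ∧
        ContMDiff (𝓘(ℝ, E).prod 𝓘(ℝ, EuclideanSpace ℝ (Fin r))) (𝓘(ℝ, E).prod 𝓘(ℝ, FB)) ∞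
          (fun x : TotalSpace (EuclideanSpace ℝ (Fin r)) Bh =>
            (⟨x.proj, p x.proj x.2⟩ : TotalSpace FB B)) ∧
        (∀ m, Function.Injective (j m) ∧ Function.Exact (j m) (p m) ∧
          Function.Surjective (p m)) ∧
        (∀ (U : Opens M) (α : twoForms E FQ Q U) (m : U),
          ((Ψ U).symm (ι U α)).1 m = j m (α.1 m)) ∧
        (∀ (U : Opens M) (s : smoothSections 𝓘(ℝ, E) (EuclideanSpace ℝ (Fin r)) Bh U) (m : U),
          (𝔼.isotropicBase U (Ψ U s)).1 m = p m (s.1 m)) := by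
  -- One global splitting serves local freeness, surjectivity onto Γ(B) over every open set, and the
  -- vector bundle; gluing, exactness at the other two places and the correspondence of splittings
  -- do not use it.
  obtain ⟨S, hS⟩ := 𝔼.exists_isLagrangianAt
  exact ⟨fun κ 𝒰 χ hχ => 𝔼.existsUnique_glue 𝒰 χ hχ, 𝔼.exists_basis_isotropicSections hS,
    𝔼.coreLinear, 𝔼.isCoreLinear_coreLinear, fun U W h α => rfl,
    fun U W h χ => 𝔼.isotropicBase_res h χ,
    fun U => ⟨𝔼.coreLinear_injective U, 𝔼.exact_coreLinear U,
      fun b => ⟨_, 𝔼.isotropicBase_splitSection hS U b⟩⟩,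
    ⟨MetricDoubleVectorBundle.splittingEquiv, fun σ U b m q => σ.mk_linear m q (b.1 m)⟩,
    𝔼.exists_bundle_isotropicSections hS⟩
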